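/- Let $\Sigma$ be a closed connected oriented surface of genus $g\ge 2$ with a hyperbolic metric, i.e. $\Sigma=\Gamma\backslash\mathbb H^2$ with $\Gamma<\mathrm{PSL}_2(\mathbf R)$ acting freely, properly discontinuously and cocompactly on the hyperbolic plane. Let $M=S\Sigma=\Gamma\backslash S\mathbb H^2$ be its unit tangent bundle, $\mathcal G$ the foliation of $M$ by the orbits of the geodesic flow, $\mathcal F$ the foliation of $M$ by the weakly stable leaves of the geodesic flow, and $\widetilde{\mathcal G},\widetilde{\mathcal F}$ the lifted foliations of the universal cover $\widetilde M$. A projective structure on $M$ is a maximal atlas of (topological) charts with values in $\mathbb P^3(\mathbf R)$ whose changes of coordinates are locally restrictions of elements of $\mathrm{PGL}_4(\mathbf R)$; it has a developing map $\mathrm{dev}:\widetilde M\to\mathbb P^3(\mathbf R)$, i.e. a projective map for the structure lifted to $\widetilde M$, unique up to $\mathrm{PGL}_4(\mathbf R)$. Two projective structures are equivalent if there is a homeomorphism of $M$, isotopic to the identity, which is projective from one to the other; $\mathcal P(M)$ is the set of equivalence classes. A projective structure is foliated if $\mathrm{dev}$ maps each leaf of $\widetilde{\mathcal G}$ into a projective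 line and each leaf of $\widetilde{\mathcal F}$ into a projective plane. A foliated structure is convex if $\mathrm{dev}(f)$ is convex for every leaf $f$ of $\widetilde{\mathcal F}$, where a subset of $\mathbb P^3(\mathbf R)$ is convex if its intersection with every projective line is connected (possibly empty); it is properly convex if moreover the closure of $\mathrm{dev}(f)$ contains no projective line, for every such $f$. Two foliated projective structures are equivalent if there is a homeomorphism of $M$, isotopic to the identity and preserving both $\mathcal F$ and $\mathcal G$, which is projective from one to the other. Let $\mathcal P_f(M)$ be the set of equivalence classes of foliated projective structures, and $\mathcal P_{cf}(M)$, $\mathcal P_{pcf}(M)$ its subsets of classes of convex, respectively properly convex, foliated projective structures. Then both inclusions $$\mathcal P_{pcf}(M)\subset\mathcal P_{cf}(M)\subset\mathcal P_f(M)$$ are strict, and the map $\mathcal P_f(M)\to\mathcal P(M)$ that forgets the foliations is not surjective. -/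

import Mathlib

open Filter Topology
open scoped MatrixGroups UpperHalfPlane LinearAlgebra.Projectivization unitInterval

noncomputable section

/-! ## The unit tangent bundle of the hyperbolic plane -/

/-- The action of `PSL(2, ℝ)` on the hyperbolic plane `ℍ` by Möbius transformations. -/
instance pslActionUpperHalfPlane : MulAction PSL(2, ℝ) ℍ :=
  MulAction.compHom ℍ Matrix.ProjectiveSpecialLinearGroup.toPGL

/-- The unit tangent bundle of the hyperbolic plane: pairs `(z, v)` of a point `z` of the upper
half-plane and a tangent vector `v ∈ ℂ` at `z` of length `1` for the metric `|dz| / Im z`. -/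
abbrev UnitTangentH : Type := {p : ℍ × ℂ // ‖p.2‖ = p.1.im}

/-- The derivative of the Möbius transformation of `g` at `z` is `1 / (c z + d) ^ 2`. -/
def slDeriv (g : SL(2, ℝ)) (z : ℍ) : ℂ := 1 / UpperHalfPlane.denom (g : GL (Fin 2) ℝ) z ^ 2

lemma norm_slDeriv (g : SL(2, ℝ)) (z : ℍ) : ‖slDeriv g z‖ * z.im = (g • z).im := by
  have h : (g • z).im = _ := UpperHalfPlane.im_smul_eq_div_normSq (g : GL (Fin 2) ℝ) z
  rw [h, slDeriv, norm_div, norm_pow, norm_one, Complex.normSq_eq_norm_sq]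
  simp
  ring

lemma slDeriv_mul (g h : SL(2, ℝ)) (z : ℍ) :
    slDeriv (g * h) z = slDeriv g (h • z) * slDeriv h z := by
  have e : UpperHalfPlane.denom ((g * h : SL(2, ℝ)) : GL (Fin 2) ℝ) z =
      UpperHalfPlane.denom (g : GL (Fin 2) ℝ) ((h • z : ℍ) : ℂ) *
        UpperHalfPlane.denom (h : GL (Fin 2) ℝ) z := by
    have := UpperHalfPlane.denom_cocycle_σ (g : GL (Fin 2) ℝ) (h : GL (Fin 2) ℝ) z
    rw [map_mul, this]
    simp [UpperHalfPlane.σ]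
    rfl
  unfold slDeriv
  rw [e, mul_pow]
  ring

/-- `SL(2, ℝ)` acts on the unit tangent bundle by `g • (z, v) = (g • z, Dg_z v)`. -/
instance slActionUnitTangentH : MulAction SL(2, ℝ) UnitTangentH where
  smul g p := ⟨(g • p.1.1, slDeriv g p.1.1 * p.1.2), by
    rw [norm_mul, p.2, norm_slDeriv]⟩
  one_smul p := by
    apply Subtype.ext
    apply Prod.ext
    · exact one_smul _ _
    · change slDeriv 1 _ * _ = _
      simp [slDeriv]
  mul_smul g h p := by
    apply Subtype.ext
    apply Prod.ext
    · exact mul_smul _ _ _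
    · change slDeriv (g * h) _ * _ = slDeriv g (h • p.1.1) * (slDeriv h p.1.1 * p.1.2)
      rw [slDeriv_mul, mul_assoc]

lemma center_smul_unitTangentH :
    Subgroup.center SL(2, ℝ) ≤ (MulAction.toPermHom SL(2, ℝ) UnitTangentH).ker := by
  intro g hg
  rw [Matrix.SpecialLinearGroup.mem_center_iff] at hg
  obtain ⟨r, hr, hg⟩ := hg
  have hr2 : r ^ 2 = 1 := by simpa using hr
  have h (i j : Fin 2) : g i j = if i = j then r else 0 := by
    have := congrFun (congrFun hg i) j
    rw [Matrix.scalar_apply, Matrix.diagonal_apply] at this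
    exact this.symm
  have hr2' : (r : ℂ) ^ 2 = 1 := by exact_mod_cast hr2
  have hr0 : (r : ℂ) ≠ 0 := fun h0 => by simp [h0] at hr2'
  rw [MonoidHom.mem_ker]
  ext1 p
  apply Subtype.ext
  apply Prod.ext
  · change g • p.1.1 = p.1.1
    apply UpperHalfPlane.ext
    rw [UpperHalfPlane.coe_specialLinearGroup_apply]
    simp [h, hr0]
  · change slDeriv g p.1.1 * p.1.2 = p.1.2
    have : UpperHalfPlane.denom (g : GL (Fin 2) ℝ) p.1.1 = r := by
      simp [UpperHalfPlane.denom, h]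
    simp [slDeriv, this, hr2']

/-- The action of `PSL(2, ℝ)` on the unit tangent bundle by derivatives of Möbius
transformations. -/
instance pslActionUnitTangentH : MulAction PSL(2, ℝ) UnitTangentH :=
  MulAction.compHom UnitTangentH
    (QuotientGroup.lift _ (MulAction.toPermHom SL(2, ℝ) UnitTangentH) center_smul_unitTangentH)

/-- The velocity vectors of the unit speed geodesic `t ↦ e ^ t * i`. -/
def verticalVelocity (t : ℝ) : UnitTangentH :=
  ⟨(⟨(Real.exp t : ℝ) * Complex.I, by
      rw [Complex.im_ofReal_mul, Complex.I_im, mul_one]; exact Real.exp_pos t⟩, (Real.exp t : ℝ) * Complex.I), by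
    rw [norm_mul, Complex.norm_I, mul_one, Complex.norm_real, Real.norm_eq_abs, Real.abs_exp]
    change _ = Complex.im _
    rw [Complex.im_ofReal_mul, Complex.I_im, mul_one]⟩

/-- The velocity vector at time `t` of the unit speed geodesic `s ↦ g • (e ^ s * i)` of `ℍ`.
All unit speed geodesics of the hyperbolic plane are of this form, so `geodesicVelocity g t` is
the point of the orbit of the geodesic flow through `geodesicVelocity g 0` reached at
time `t`. -/
def geodesicVelocity (g : PSL(2, ℝ)) (t : ℝ) : UnitTangentH := g • verticalVelocity t

/-- The leaf of the geodesic foliation through `x`: the orbit of `x` under the geodesic flow. -/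
def geodesicLeaf (x : UnitTangentH) : Set UnitTangentH :=
  {y | ∃ (g : PSL(2, ℝ)) (s t : ℝ), geodesicVelocity g s = x ∧ geodesicVelocity g t = y}

/-- The leaf of the weakly stable foliation through `x`: the unit tangent vectors `y` such that,
after a time shift, the geodesics with initial velocities `x` and `y` become
asymptotic as the time goes to `+∞`. -/
def stableLeaf (x : UnitTangentH) : Set UnitTangentH :=
  {y | ∃ g h : PSL(2, ℝ), geodesicVelocity g 0 = x ∧ geodesicVelocity h 0 = y ∧
    ∃ s : ℝ, Tendsto
      (fun t : ℝ => dist (geodesicVelocity g t).1.1 (geodesicVelocity h (t + s)).1.1)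
      atTop (𝓝 0)}

/-! ## Closed hyperbolic surfaces and their unit tangent bundles -/

/-- The quotient `Γ \ ℍ` is a closed oriented hyperbolic surface of genus `g`, with universal
covering `ℍ` and fundamental group `Γ`. The genus is half of the first Betti number, i.e. of the
rank of the first homology group, which is the abelianization of the fundamental group. -/
structure IsClosedSurfaceGroup (Γ : Subgroup PSL(2, ℝ)) (g : ℕ) : Prop where
  properlyDiscontinuous : ProperlyDiscontinuousSMul Γ ℍ
  free : ∀ (γ : Γ) (z : ℍ), γ • z = z → γ = 1
  cocompact : CompactSpace (MulAction.orbitRel.Quotient Γ ℍ)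
  genus : Module.finrank ℤ (Additive (Abelianization Γ)) = 2 * g

/-- The unit tangent bundle `M` of the surface `Γ \ ℍ`. -/
abbrev UnitTangent (Γ : Subgroup PSL(2, ℝ)) : Type := MulAction.orbitRel.Quotient Γ UnitTangentH

/-- The covering from the unit tangent bundle of `ℍ` onto the unit tangent bundle of `Γ \ ℍ`. -/
def toUnitTangent (Γ : Subgroup PSL(2, ℝ)) (x : UnitTangentH) : UnitTangent Γ := Quotient.mk _ x

/-- Being on the same leaf of the foliation of `M` induced by a family of leaves upstairs. -/
def SameLeaf (Γ : Subgroup PSL(2, ℝ)) (leaf : UnitTangentH → Set UnitTangentH)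
    (a b : UnitTangent Γ) : Prop :=
  ∃ x, ∃ y ∈ leaf x, toUnitTangent Γ x = a ∧ toUnitTangent Γ y = b

/-- The universal covering of the unit tangent bundle of `ℍ`, hence also of `M`: a point of `ℍ`
together with a real-valued angle. -/
abbrev UniversalCover : Type := ℍ × ℝ

/-- The covering `(z, θ) ↦ (z, Im z * e ^ (i θ))` from the universal covering. -/
def fromCover (x : UniversalCover) : UnitTangentH :=
  ⟨(x.1, x.1.im * Complex.exp (x.2 * Complex.I)), by
    simp [Complex.norm_exp_ofReal_mul_I, abs_of_pos x.1.im_pos]⟩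

/-- The leaf through `x` of the foliation lifted to the universal covering. -/
def liftedLeaf (leaf : UnitTangentH → Set UnitTangentH) (x : UniversalCover) :
    Set UniversalCover :=
  connectedComponentIn (fromCover ⁻¹' leaf (fromCover x)) x

/-! ## Projective geometry -/

/-- Real projective space of dimension three. -/
abbrev RP3 : Type := ℙ ℝ (Fin 4 → ℝ)

/-- Projective space carries the quotient topology. -/
instance topologicalSpaceRP3 : TopologicalSpace RP3 :=
  inferInstanceAs (TopologicalSpace (Quotient (projectivizationSetoid ℝ (Fin 4 → ℝ))))

/-- The projective subspace of lines contained in a linear subspace. -/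
def projSubspace (W : Submodule ℝ (Fin 4 → ℝ)) : Set RP3 := {p | p.submodule ≤ W}

/-- `ℓ` is a projective line. -/
def IsProjLine (l : Set RP3) : Prop :=
  ∃ W : Submodule ℝ (Fin 4 → ℝ), Module.finrank ℝ W = 2 ∧ l = projSubspace W

/-- `P` is a projective plane. -/
def IsProjPlane (P : Set RP3) : Prop :=
  ∃ W : Submodule ℝ (Fin 4 → ℝ), Module.finrank ℝ W = 3 ∧ P = projSubspace W

/-- Convex: the intersection with any projective line is connected (possibly empty). -/
def IsProjConvex (C : Set RP3) : Prop := ∀ l, IsProjLine l → IsPreconnected (C ∩ l)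

/-- Properly convex: convex, and the closure contains no projective line. -/
def IsProperlyProjConvex (C : Set RP3) : Prop :=
  IsProjConvex C ∧ ∀ l, IsProjLine l → ¬ l ⊆ closure C

/-! ## Projective structures -/

/-- A map between open subsets of projective space is locally projective: near every point of
its source it is the restriction of an element of `PGL(4, ℝ)`. -/
def IsLocallyProjective (e : OpenPartialHomeomorph RP3 RP3) : Prop :=
  ∀ p ∈ e.source, ∃ g : PGL(4, ℝ), ∀ᶠ p' in 𝓝 p, e p' = g • p'

/-- Two charts are compatible: both changes of coordinates are locally projective. -/
def ChartsCompatible {M : Type*} [TopologicalSpace M] (φ ψ : OpenPartialHomeomorph M RP3) :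
    Prop :=
  IsLocallyProjective (φ.symm.trans ψ) ∧ IsLocallyProjective (ψ.symm.trans φ)

/-- A projective structure on a 3-manifold: a maximal atlas of charts with values in projective
space whose changes of coordinates are locally projective. -/
structure ProjectiveStructure (M : Type*) [TopologicalSpace M] where
  atlas : Set (OpenPartialHomeomorph M RP3)
  cover : ∀ x, ∃ φ ∈ atlas, x ∈ φ.source
  compatible : ∀ φ ∈ atlas, ∀ ψ ∈ atlas, ChartsCompatible φ ψ
  maximal : ∀ φ, (∀ ψ ∈ atlas, ChartsCompatible φ ψ) → φ ∈ atlas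

section Structures

variable {M : Type*} [TopologicalSpace M]

/-- The homeomorphism `h` is a projective map from `(M, S)` to `(M, T)`: in charts it is
locally projective. -/
def IsProjectiveMap (S T : ProjectiveStructure M) (h : M ≃ₜ M) : Prop :=
  ∀ φ ∈ S.atlas, ∀ ψ ∈ T.atlas, ∀ x ∈ φ.source, h x ∈ ψ.source →
    ∃ g : PGL(4, ℝ), ∀ᶠ x' in 𝓝 x, ψ (h x') = g • φ x'

/-- The homeomorphism `h` is isotopic to the identity. -/
def IsIsotopicToId (h : M ≃ₜ M) : Prop :=
  ∃ H : I → (M ≃ₜ M), Continuous (fun p : I × M => H p.1 p.2) ∧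
    H 0 = Homeomorph.refl M ∧ H 1 = h

lemma IsProjectiveMap.refl (S : ProjectiveStructure M) :
    IsProjectiveMap S S (Homeomorph.refl M) := by
  intro φ hφ ψ hψ x hx hx'
  have hx' : x ∈ ψ.source := hx'
  obtain ⟨g, hg⟩ := (S.compatible φ hφ ψ hψ).1 (φ x) (by simp [hx, hx'])
  refine ⟨g, ?_⟩
  filter_upwards [(φ.continuousAt hx).eventually hg, φ.open_source.mem_nhds hx] with y hy hy'
  simpa [φ.left_inv hy'] using hy

lemma IsProjectiveMap.symm {S T : ProjectiveStructure M} {h : M ≃ₜ M}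
    (H : IsProjectiveMap S T h) : IsProjectiveMap T S h.symm := by
  intro ψ hψ φ hφ y hy hy'
  obtain ⟨g, hg⟩ := H φ hφ ψ hψ (h.symm y) hy' (by simpa using hy)
  refine ⟨g⁻¹, ?_⟩
  filter_upwards [h.symm.continuous.continuousAt.eventually hg] with z hz
  rw [Homeomorph.apply_symm_apply] at hz
  rw [hz, inv_smul_smul]

lemma IsProjectiveMap.trans {S T U : ProjectiveStructure M} {h k : M ≃ₜ M}
    (H : IsProjectiveMap S T h) (K : IsProjectiveMap T U k) :
    IsProjectiveMap S U (h.trans k) := by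
  intro φ hφ χ hχ x hx hx'
  obtain ⟨ψ, hψ, hxψ⟩ := T.cover (h x)
  obtain ⟨g, hg⟩ := H φ hφ ψ hψ x hx hxψ
  obtain ⟨g', hg'⟩ := K ψ hψ χ hχ (h x) hxψ hx'
  refine ⟨g' * g, ?_⟩
  filter_upwards [hg, h.continuous.continuousAt.eventually hg'] with z hz hz'
  rw [mul_smul, ← hz, ← hz']
  rfl

lemma IsIsotopicToId.refl : IsIsotopicToId (Homeomorph.refl M) :=
  ⟨fun _ => Homeomorph.refl M, continuous_snd, rfl, rfl⟩

lemma IsIsotopicToId.symm {h : M ≃ₜ M} (H : IsIsotopicToId h) : IsIsotopicToId h.symm := by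
  obtain ⟨H, hc, h0, h1⟩ := H
  refine ⟨fun t => h.symm.trans (H (unitInterval.symm t)), ?_, ?_, ?_⟩
  · exact hc.comp ((unitInterval.continuous_symm.comp continuous_fst).prodMk
      (h.symm.continuous.comp continuous_snd))
  · ext x
    simp [h1]
  · ext x
    simp [h0]

lemma IsIsotopicToId.trans {h k : M ≃ₜ M} (H : IsIsotopicToId h) (K : IsIsotopicToId k) :
    IsIsotopicToId (h.trans k) := by
  obtain ⟨H, hc, h0, h1⟩ := H
  obtain ⟨K, kc, k0, k1⟩ := K
  refine ⟨fun t => (H t).trans (K t), ?_, ?_, ?_⟩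
  · exact kc.comp (continuous_fst.prodMk hc)
  · simp only [h0, k0]; rfl
  · simp only [h1, k1]

variable (M) in
/-- Equivalence of projective structures. -/
instance projectiveSetoid : Setoid (ProjectiveStructure M) where
  r S T := ∃ h : M ≃ₜ M, IsIsotopicToId h ∧ IsProjectiveMap S T h
  iseqv :=
    { refl := fun S => ⟨_, IsIsotopicToId.refl, IsProjectiveMap.refl S⟩
      symm := fun ⟨_, h, h'⟩ => ⟨_, h.symm, h'.symm⟩
      trans := fun ⟨_, h, h'⟩ ⟨_, k, k'⟩ => ⟨_, h.trans k, h'.trans k'⟩ }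

variable (M) in
/-- The set `P(M)` of equivalence classes of projective structures on `M`. -/
def ProjModuli : Type _ := Quotient (projectiveSetoid M)

end Structures

/-! ## Foliated projective structures -/

section Foliated

variable {Γ : Subgroup PSL(2, ℝ)}

/-- `dev` is a developing map of `S`: a projective map from the universal covering of `M`, with
the projective structure induced by `S`, to projective space. -/
def IsDevelopingMap (S : ProjectiveStructure (UnitTangent Γ)) (dev : UniversalCover → RP3) :
    Prop :=
  ∀ x, ∀ φ ∈ S.atlas, toUnitTangent Γ (fromCover x) ∈ φ.source →
    ∃ g : PGL(4, ℝ), ∀ᶠ x' in 𝓝 x, dev x' = g • φ (toUnitTangent Γ (fromCover x'))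

/-- `dev` is a developing map of `S` which sends each leaf of the lifted geodesic foliation into
a projective line and each leaf of the lifted weakly stable foliation into a projective plane. -/
def IsFoliatedDevelopingMap (S : ProjectiveStructure (UnitTangent Γ))
    (dev : UniversalCover → RP3) : Prop :=
  IsDevelopingMap S dev ∧
    (∀ x, ∃ l, IsProjLine l ∧ dev '' liftedLeaf geodesicLeaf x ⊆ l) ∧
    (∀ x, ∃ P, IsProjPlane P ∧ dev '' liftedLeaf stableLeaf x ⊆ P)

/-- Foliated projective structures. Developing maps exist and are unique up to `PGL(4, ℝ)`, so the
choice of the developing map does not matter, here and in the next two definitions. -/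
def IsFoliated (S : ProjectiveStructure (UnitTangent Γ)) : Prop :=
  ∃ dev, IsFoliatedDevelopingMap S dev

/-- Convex foliated projective structures: weakly stable leaves develop onto convex sets. -/
def IsConvexFoliated (S : ProjectiveStructure (UnitTangent Γ)) : Prop :=
  ∃ dev, IsFoliatedDevelopingMap S dev ∧ ∀ x, IsProjConvex (dev '' liftedLeaf stableLeaf x)

/-- Properly convex foliated projective structures: weakly stable leaves develop onto properly
convex sets. -/
def IsProperlyConvexFoliated (S : ProjectiveStructure (UnitTangent Γ)) : Prop :=
  ∃ dev, IsFoliatedDevelopingMap S dev ∧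
    ∀ x, IsProperlyProjConvex (dev '' liftedLeaf stableLeaf x)

variable (Γ) in
/-- `h` respects both foliations of `M`. -/
def PreservesFoliations (h : UnitTangent Γ ≃ₜ UnitTangent Γ) : Prop :=
  (∀ a b, SameLeaf Γ geodesicLeaf (h a) (h b) ↔ SameLeaf Γ geodesicLeaf a b) ∧
    ∀ a b, SameLeaf Γ stableLeaf (h a) (h b) ↔ SameLeaf Γ stableLeaf a b

variable (Γ) in
/-- Equivalence of foliated projective structures. -/
instance foliatedSetoid : Setoid {S : ProjectiveStructure (UnitTangent Γ) // IsFoliated S} where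
  r S T := ∃ h : UnitTangent Γ ≃ₜ UnitTangent Γ,
    IsIsotopicToId h ∧ IsProjectiveMap S.1 T.1 h ∧ PreservesFoliations Γ h
  iseqv :=
    { refl := fun S => ⟨_, IsIsotopicToId.refl, IsProjectiveMap.refl S.1,
        fun _ _ => Iff.rfl, fun _ _ => Iff.rfl⟩
      symm := by
        rintro S T ⟨h, hi, hp, hG, hF⟩
        refine ⟨_, hi.symm, hp.symm, fun a b => ?_, fun a b => ?_⟩
        · simpa using (hG (h.symm a) (h.symm b)).symm
        · simpa using (hF (h.symm a) (h.symm b)).symm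
      trans := fun ⟨h, hi, hp, hG, hF⟩ ⟨k, ki, kp, kG, kF⟩ =>
        ⟨_, hi.trans ki, hp.trans kp, fun a b => (kG (h a) (h b)).trans (hG a b),
          fun a b => (kF (h a) (h b)).trans (hF a b)⟩ }

variable (Γ) in
/-- The set of equivalence classes of foliated projective structures on `M`. -/
def FoliatedModuli : Type := Quotient (foliatedSetoid Γ)

variable (Γ) in
/-- The subset of classes of convex foliated projective structures. -/
def ConvexFoliatedModuli : Set (FoliatedModuli Γ) :=
  {c | ∃ S, IsConvexFoliated S.1 ∧ (Quotient.mk (foliatedSetoid Γ) S : FoliatedModuli Γ) = c}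

variable (Γ) in
/-- The subset of classes of properly convex foliated projective structures. -/
def ProperlyConvexFoliatedModuli : Set (FoliatedModuli Γ) :=
  {c | ∃ S, IsProperlyConvexFoliated S.1 ∧
    (Quotient.mk (foliatedSetoid Γ) S : FoliatedModuli Γ) = c}

variable (Γ) in
/-- The map forgetting the foliations. -/
def forgetFoliations : FoliatedModuli Γ → ProjModuli (UnitTangent Γ) :=
  Quotient.map (sa := foliatedSetoid Γ) (sb := projectiveSetoid (UnitTangent Γ)) Subtype.val
    (fun _ _ ⟨h, hi, hp, _⟩ => ⟨h, hi, hp⟩)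

end Foliated

end

/-! The action on the vertical unit vector at `i` identifies the unit tangent bundle of `ℍ` with
`PSL(2, ℝ)`. Weakly stable leaves become cosets `gB` of the upper triangular group, and orbits of
the geodesic flow become cosets of the diagonal group. A local homeomorphism from the universal
covering to projective space that is equivariant under all isometries therefore defines a structure
on every quotient (`exists_structure_of_equivariant`). By homogeneity it is foliated once the leaf
of vertical vectors develops into a plane and one vertical geodesic into a line.

Two such maps give the strict inclusions. The map `matDev` is the inclusion of `PSL(2, ℝ)` into the
projective space of 2×2 matrices. It sends `B` onto an affine half-plane, which is convex but has a
projective line in its closure. The map `cubicDev` is the orbit map of the binary cubic `X (X ^ 2 -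
Y ^ 2)`. The orbit is open because the three roots are distinct, and `B` is sent onto the exterior
of a parabola, which is not convex. These properties concern the whole equivalence class: an
equivalence lifts to the universal covering and permutes the lifted leaves, and developing maps are
unique up to `PGL(4, ℝ)`, so equivalent structures have the same developed leaves up to projective
maps (`exists_image_leaf_eq`).

For the failure of surjectivity, the positive first Betti number gives a homomorphism `ϑ : Γ → ℝ`
with `ϑ γ₀ = 1`, and averaging gives a continuous `u` on `ℍ` with `u (γ z) = u z + ϑ γ`. Rotating
the fibers by `u` before applying `matDev` multiplies the holonomy of `γ` on the right by a rotation
of angle proportional to `ϑ γ`. If the resulting structure were equivalent to a foliated one, its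
developing map `D`, composed with a lift `k` commuting with the deck group, would send every weakly
stable leaf into a plane. Now `γ₀` has no fixed point in `ℍ`, so it is conjugate into `B` and one of
its lifts preserves a leaf `L`. Then `D (k L)` lies in a plane `W` and in its preimage under the
holonomy `A` of that lift. In complex coordinates on `ℝ⁴ = ℂ²`, `A` is a real matrix with real
eigenvalues times a non-real number, so it preserves no real hyperplane
(`finrank_inf_comap_holEquiv_le`). Hence `D (k L)` lies in a line, which is impossible because `D ∘
k` is locally injective and `L` is a surface (`not_injOn_mk_of_finrank_le_two`). -/

noncomputable section

/-! ## Topology and linear algebra of projective space -/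

lemma isQuotientMap_projMk :
    IsQuotientMap (fun v : {v : Fin 4 → ℝ // v ≠ 0} => (Projectivization.mk ℝ v.1 v.2 : RP3)) :=
  isQuotientMap_quot_mk

lemma continuous_projMk {X : Type*} [TopologicalSpace X] {f : X → Fin 4 → ℝ}
    (hf : Continuous f) (h0 : ∀ x, f x ≠ 0) :
    Continuous fun x => (Projectivization.mk ℝ (f x) (h0 x) : RP3) :=
  isQuotientMap_projMk.continuous.comp (hf.subtype_mk h0)

/-- The preimage in the punctured vector space is the union of all rescalings of `U`, each of them
open. -/
lemma isOpen_projMk_image {U : Set (Fin 4 → ℝ)} (hU : IsOpen U) :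
    IsOpen {p : RP3 | ∃ v, ∃ hv : v ≠ 0, v ∈ U ∧ Projectivization.mk ℝ v hv = p} := by
  rw [← isQuotientMap_projMk.isOpen_preimage]
  have : (fun v : {v : Fin 4 → ℝ // v ≠ 0} => (Projectivization.mk ℝ v.1 v.2 : RP3)) ⁻¹'
      {p : RP3 | ∃ v, ∃ hv : v ≠ 0, v ∈ U ∧ Projectivization.mk ℝ v hv = p} =
      ⋃ a : ℝˣ, {v | a • v.1 ∈ U} := by
    ext ⟨v, hv⟩
    simp only [Set.mem_preimage, Set.mem_ofPred_eq, Set.mem_iUnion]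
    constructor
    · rintro ⟨w, hw, hwU, h⟩
      obtain ⟨a, ha⟩ := (Projectivization.mk_eq_mk_iff ℝ w v hw hv).1 h
      exact ⟨a, by rwa [ha]⟩
    · rintro ⟨a, ha⟩
      refine ⟨a • v, (smul_ne_zero_iff_ne a).2 hv, ha, ?_⟩
      exact (Projectivization.mk_eq_mk_iff ℝ _ _ _ _).2 ⟨a, rfl⟩
  rw [this]
  refine isOpen_iUnion fun a => hU.preimage ?_
  exact continuous_subtype_val.const_smul a

/-- The element of `PGL(4, ℝ)` given by a linear automorphism of `ℝ⁴`. -/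
def pglOfLinearEquiv (e : (Fin 4 → ℝ) ≃ₗ[ℝ] (Fin 4 → ℝ)) : PGL(4, ℝ) :=
  .mk (Matrix.GeneralLinearGroup.toLin.symm
    ((LinearMap.GeneralLinearGroup.generalLinearEquiv ℝ (Fin 4 → ℝ)).symm e))

lemma pglOfLinearEquiv_smul_mk (e : (Fin 4 → ℝ) ≃ₗ[ℝ] (Fin 4 → ℝ)) {v : Fin 4 → ℝ}
    (hv : v ≠ 0) :
    pglOfLinearEquiv e • (Projectivization.mk ℝ v hv : RP3) =
      Projectivization.mk ℝ (e v) (e.map_ne_zero_iff.2 hv) := by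
  rw [pglOfLinearEquiv, Projectivization.PGL.mk_smul_mk]
  congr 1
  change Matrix.mulVec (Matrix.GeneralLinearGroup.toLin.symm _).1 v = e v
  rw [← Matrix.toLin'_apply]
  change Matrix.toLin' (LinearMap.toMatrix' e.toLinearMap) v = e v
  simp

lemma exists_linearEquiv_of_pgl (g : PGL(4, ℝ)) :
    ∃ e : (Fin 4 → ℝ) ≃ₗ[ℝ] (Fin 4 → ℝ), pglOfLinearEquiv e = g := by
  induction g using Matrix.ProjGenLinGroup.induction_on with | mk g =>
  refine ⟨LinearMap.GeneralLinearGroup.generalLinearEquiv ℝ (Fin 4 → ℝ)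
    (Matrix.GeneralLinearGroup.toLin g), ?_⟩
  simp [pglOfLinearEquiv]

instance continuousConstSMulRP3 : ContinuousConstSMul PGL(4, ℝ) RP3 where
  continuous_const_smul g := by
    obtain ⟨e, rfl⟩ := exists_linearEquiv_of_pgl g
    rw [isQuotientMap_projMk.continuous_iff]
    simp only [Function.comp_def, pglOfLinearEquiv_smul_mk]
    exact continuous_projMk
      ((LinearMap.continuous_of_finiteDimensional e.toLinearMap).comp continuous_subtype_val) _

lemma mk_mem_projSubspace {W : Submodule ℝ (Fin 4 → ℝ)} {v : Fin 4 → ℝ} {hv : v ≠ 0} :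
    (Projectivization.mk ℝ v hv : RP3) ∈ projSubspace W ↔ v ∈ W := by
  rw [projSubspace, Set.mem_ofPred_eq, Projectivization.submodule_mk,
    Submodule.span_singleton_le_iff_mem]

lemma pglOfLinearEquiv_smul_mem_projSubspace (e : (Fin 4 → ℝ) ≃ₗ[ℝ] (Fin 4 → ℝ))
    (W : Submodule ℝ (Fin 4 → ℝ)) (p : RP3) :
    pglOfLinearEquiv e • p ∈ projSubspace W ↔ p ∈ projSubspace (W.comap e.toLinearMap) := by
  induction p using Projectivization.ind with | _ v hv =>
  rw [pglOfLinearEquiv_smul_mk, mk_mem_projSubspace, mk_mem_projSubspace]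
  rfl

lemma finrank_comap_linearEquiv (e : (Fin 4 → ℝ) ≃ₗ[ℝ] (Fin 4 → ℝ))
    (W : Submodule ℝ (Fin 4 → ℝ)) :
    Module.finrank ℝ (W.comap e.toLinearMap) = Module.finrank ℝ W := by
  have : W.comap e.toLinearMap = W.map e.symm.toLinearMap := by
    exact (Submodule.map_equiv_eq_comap_symm e.symm W).symm
  rw [this]
  exact LinearEquiv.finrank_map_eq e.symm W

lemma IsProjLine.preimage {l : Set RP3} (hl : IsProjLine l) (g : PGL(4, ℝ)) :
    IsProjLine ((g • ·) ⁻¹' l) := by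
  obtain ⟨W, hW, rfl⟩ := hl
  obtain ⟨e, rfl⟩ := exists_linearEquiv_of_pgl g
  exact ⟨W.comap e.toLinearMap, by rw [finrank_comap_linearEquiv, hW],
    Set.ext fun p => pglOfLinearEquiv_smul_mem_projSubspace e W p⟩

lemma IsProjPlane.preimage {P : Set RP3} (hP : IsProjPlane P) (g : PGL(4, ℝ)) :
    IsProjPlane ((g • ·) ⁻¹' P) := by
  obtain ⟨W, hW, rfl⟩ := hP
  obtain ⟨e, rfl⟩ := exists_linearEquiv_of_pgl g
  exact ⟨W.comap e.toLinearMap, by rw [finrank_comap_linearEquiv, hW],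
    Set.ext fun p => pglOfLinearEquiv_smul_mem_projSubspace e W p⟩

lemma IsProjConvex.smul {C : Set RP3} (hC : IsProjConvex C) (g : PGL(4, ℝ)) :
    IsProjConvex ((g • ·) '' C) := by
  intro l hl
  rw [← Set.image_inter_preimage]
  exact (hC _ (hl.preimage g)).image _ (continuous_const_smul g).continuousOn

lemma IsProperlyProjConvex.smul {C : Set RP3} (hC : IsProperlyProjConvex C) (g : PGL(4, ℝ)) :
    IsProperlyProjConvex ((g • ·) '' C) := by
  refine ⟨hC.1.smul g, fun l hl h => hC.2 _ (hl.preimage g) ?_⟩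
  rw [← Set.preimage_image_eq C (MulAction.injective g), ← (isOpenMap_smul g).preimage_closure_eq_closure_preimage
    (continuous_const_smul g)]
  exact Set.preimage_mono h

/-- Two projective transformations that agree on a nonempty open set are equal. -/
lemma smul_eq_smul_of_eventuallyEq {g g' : PGL(4, ℝ)} {p : RP3}
    (h : ∀ᶠ p' in 𝓝 p, g • p' = g' • p') (p' : RP3) : g • p' = g' • p' := by
  obtain ⟨e, rfl⟩ := exists_linearEquiv_of_pgl g
  obtain ⟨e', rfl⟩ := exists_linearEquiv_of_pgl g'
  induction p using Projectivization.ind with | _ v hv =>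
  -- The images of `v + t • w` under `e` and `e'` are proportional for small `t`. Each 2×2 minor is
  -- a polynomial of degree two in `t` that vanishes near `0`, and its leading coefficient is the
  -- minor for `w`.
  have key (w : Fin 4 → ℝ) (i j : Fin 4) : e w i * e' w j = e w j * e' w i := by
    have hc : Tendsto (fun t : ℝ => v + t • w) (𝓝 0) (𝓝 v) := by
      have : Continuous fun t : ℝ => v + t • w := by fun_prop
      simpa using this.tendsto 0
    have h1 : ∀ᶠ t : ℝ in 𝓝 0, e (v + t • w) i * e' (v + t • w) j =
        e (v + t • w) j * e' (v + t • w) i := by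
      have hne : ∀ᶠ t : ℝ in 𝓝 0, v + t • w ≠ 0 := hc.eventually_ne hv
      have hq : Tendsto (fun x : {v : Fin 4 → ℝ // v ≠ 0} =>
          (Projectivization.mk ℝ x.1 x.2 : RP3)) (𝓝 ⟨v, hv⟩) (𝓝 (Projectivization.mk ℝ v hv)) :=
        isQuotientMap_projMk.continuous.tendsto _
      have h2 := hq.eventually h
      rw [nhds_subtype_eq_comap, eventually_comap] at h2
      filter_upwards [hne, hc.eventually h2] with t ht h3
      have h4 := h3 ⟨_, ht⟩ rfl
      simp only [pglOfLinearEquiv_smul_mk] at h4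
      obtain ⟨a, ha⟩ := (Projectivization.mk_eq_mk_iff' ℝ _ _ _ _).1 h4
      rw [← ha]
      simp only [Pi.smul_apply, smul_eq_mul]
      ring
    simp only [map_add, map_smul, Pi.add_apply, Pi.smul_apply, smul_eq_mul] at h1
    obtain ⟨ε, hε, h2⟩ := Metric.eventually_nhds_iff.1 h1
    -- The second difference at `-ε / 2`, `0`, `ε / 2` isolates the coefficient of `t ^ 2`.
    have p0 := @h2 0 (by simpa using hε)
    have p1 := @h2 (ε / 2) (by simp [abs_of_pos hε, hε])
    have p2 := @h2 (-(ε / 2)) (by simp [abs_of_pos hε, hε])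
    have hε2 : ε ^ 2 ≠ 0 := by positivity
    apply mul_left_cancel₀ hε2
    linear_combination 2 * p1 + 2 * p2 - 4 * p0
  induction p' using Projectivization.ind with | _ w hw =>
  rw [pglOfLinearEquiv_smul_mk, pglOfLinearEquiv_smul_mk, Projectivization.mk_eq_mk_iff']
  have hne : e' w ≠ 0 := e'.map_ne_zero_iff.2 hw
  obtain ⟨j, hj⟩ := Function.ne_iff.1 hne
  refine ⟨e w j / e' w j, funext fun i => ?_⟩
  have hj' : e' w j ≠ 0 := hj
  have := key w i j
  rw [Pi.smul_apply, smul_eq_mul, div_mul_eq_mul_div, div_eq_iff hj']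
  linarith

/-- A map to projective space which lifts to a local homeomorphism of cones is a local
homeomorphism. -/
lemma isLocalHomeomorph_projMk {X : Type*} [TopologicalSpace X] {f : X → Fin 4 → ℝ}
    (h0 : ∀ x, f x ≠ 0)
    (hf : IsLocalHomeomorph fun p : ℝ × X => Real.exp p.1 • f p.2) :
    IsLocalHomeomorph fun x => (Projectivization.mk ℝ (f x) (h0 x) : RP3) := by
  have hfc : Continuous f := by
    have := hf.continuous.comp (Continuous.prodMk_right (0 : ℝ))
    simpa [Function.comp_def] using this
  have hopen : IsOpenMap fun x => (Projectivization.mk ℝ (f x) (h0 x) : RP3) := by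
    intro U hU
    convert isOpen_projMk_image (hf.isOpenMap _ (isOpen_univ.prod hU)) using 1
    ext p
    constructor
    · rintro ⟨x, hx, rfl⟩
      exact ⟨f x, h0 x, ⟨(0, x), ⟨trivial, hx⟩, by simp⟩, rfl⟩
    · rintro ⟨v, hv, ⟨⟨s, x⟩, ⟨-, hx⟩, rfl⟩, rfl⟩
      refine ⟨x, hx, ?_⟩
      exact (Projectivization.mk_eq_mk_iff' ℝ _ _ _ _).2 ⟨Real.exp (-s), by
        simp [smul_smul, ← Real.exp_add]⟩
  have hcont := continuous_projMk hfc h0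
  rw [isLocalHomeomorph_iff_isOpenEmbedding_restrict]
  intro x
  obtain ⟨U, hU, hxU, hinj⟩ := hf.isLocallyInjective ((0 : ℝ), x)
  -- Local injectivity: if `f y = a • f z` with `y`, `z` near `x`, the factor `a` is read off from a
  -- coordinate `j` that does not vanish at `x`, so it is close to `1`. Then `(0, y)` and `(log a,
  -- z)` are close to `(0, x)` and have the same image in the cone.
  obtain ⟨j, hj⟩ := Function.ne_iff.1 (h0 x)
  have hj : f x j ≠ 0 := hj
  have hfj : Continuous fun y => f y j := (continuous_apply j).comp hfc
  have ha : ContinuousAt (fun y : X × X => f y.1 j / f y.2 j) (x, x) :=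
    (hfj.comp continuous_fst).continuousAt.div (hfj.comp continuous_snd).continuousAt hj
  have ha1 : f x j / f x j = 1 := div_self hj
  have hlog : ContinuousAt (fun y : X × X => (Real.log (f y.1 j / f y.2 j), y.2)) (x, x) :=
    (ha.log (by simp [ha1])).prodMk continuous_snd.continuousAt
  have e1 : ∀ᶠ y : X × X in 𝓝 (x, x), (Real.log (f y.1 j / f y.2 j), y.2) ∈ U :=
    hlog.eventually (by simpa [ha1] using hU.mem_nhds hxU)
  have e2 : ∀ᶠ y : X × X in 𝓝 (x, x), 0 < f y.1 j / f y.2 j :=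
    ha.eventually (by simpa [ha1] using lt_mem_nhds (zero_lt_one' ℝ))
  have e3 : ∀ᶠ y : X × X in 𝓝 (x, x), ((0 : ℝ), y.1) ∈ U :=
    ((Continuous.prodMk_right (0 : ℝ)).comp continuous_fst).continuousAt.eventually
      (hU.mem_nhds hxU)
  have e4 := e1.and (e2.and e3)
  rw [nhds_prod_eq] at e4
  obtain ⟨V, hV, hV'⟩ := mem_prod_same_iff.1 e4
  refine ⟨interior V, interior_mem_nhds.2 hV, ?_⟩
  refine .of_continuous_injective_isOpenMap (hcont.comp continuous_subtype_val) ?_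
    (hopen.comp isOpen_interior.isOpenMap_subtype_val)
  rintro ⟨y, hy⟩ ⟨z, hz⟩ hyz
  obtain ⟨hm, hp, hm'⟩ := hV' (Set.mk_mem_prod (interior_subset hy) (interior_subset hz))
  obtain ⟨a, ha⟩ := (Projectivization.mk_eq_mk_iff' ℝ _ _ _ _).1 hyz
  have hzj : f z j ≠ 0 := fun h => by simp [h] at hp
  have haj : f y j / f z j = a := by
    rw [← ha, Pi.smul_apply, smul_eq_mul, mul_div_cancel_right₀ _ hzj]
  have hap : 0 < a := haj ▸ hp
  have := hinj hm' hm (by simpa [haj, Real.exp_log hap] using ha.symm)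
  exact Subtype.ext (congrArg Prod.snd this)

/-! ## Projective structures and developing maps -/

section Developing

variable {X M : Type*} [TopologicalSpace X] [TopologicalSpace M]

/-- The map `D` is projective from `X`, with the structure induced by `S` along `q`, to projective
space. -/
def IsDevelopingAlong (q : X → M) (S : ProjectiveStructure M) (D : X → RP3) : Prop :=
  ∀ x, ∀ φ ∈ S.atlas, q x ∈ φ.source → ∃ g : PGL(4, ℝ), ∀ᶠ x' in 𝓝 x, D x' = g • φ (q x')

/-- The chart is a local inverse of `q` followed by `D`. At another point over its domain, `heq`
compares the two branches of `D` by one projective transformation. -/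
lemma exists_chart_of_dev {q : X → M} (hq : IsLocalHomeomorph q) {D : X → RP3}
    (hD : IsLocalHomeomorph D)
    (heq : ∀ x y, q x = q y → ∃ g : PGL(4, ℝ), ∀ᶠ p : X × X in 𝓝 (x, y),
      q p.1 = q p.2 → D p.1 = g • D p.2) (x : X) :
    ∃ φ : OpenPartialHomeomorph M RP3, q x ∈ φ.source ∧
      ∀ y, q y ∈ φ.source → ∃ g : PGL(4, ℝ), ∀ᶠ y' in 𝓝 y, D y' = g • φ (q y') := by
  obtain ⟨e, hxe, rfl⟩ := hq x
  obtain ⟨d, hxd, rfl⟩ := hD x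
  refine ⟨e.symm.trans d, by simp [hxe, hxd], fun y hy => ?_⟩
  have hy' : e y ∈ e.target := by simp at hy; exact hy.1
  obtain ⟨g, hg⟩ := heq y (e.symm (e y)) (e.right_inv hy').symm
  refine ⟨g, ?_⟩
  have hc : ContinuousAt (fun z => (z, e.symm (e z))) y :=
    continuousAt_id.prodMk ((e.symm.continuousAt hy').comp hq.continuous.continuousAt)
  filter_upwards [hc.eventually hg,
    hq.continuous.continuousAt.eventually (e.open_target.mem_nhds hy')] with z hz hz'
  exact hz (e.right_inv hz').symm

/-- The projective structure with a given developing map `D` along a covering `q`. -/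
def ProjectiveStructure.ofDev {q : X → M} (hq : IsLocalHomeomorph q)
    (hs : Function.Surjective q) {D : X → RP3} (hD : IsLocalHomeomorph D)
    (heq : ∀ x y, q x = q y → ∃ g : PGL(4, ℝ), ∀ᶠ p : X × X in 𝓝 (x, y),
      q p.1 = q p.2 → D p.1 = g • D p.2) : ProjectiveStructure M where
  atlas := {φ | ∀ x, q x ∈ φ.source → ∃ g : PGL(4, ℝ), ∀ᶠ x' in 𝓝 x, D x' = g • φ (q x')}
  cover m := by
    obtain ⟨x, rfl⟩ := hs m
    obtain ⟨φ, h1, h2⟩ := exists_chart_of_dev hq hD heq x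
    exact ⟨φ, h2, h1⟩
  compatible := by
    have key (φ ψ : OpenPartialHomeomorph M RP3)
        (hφ : ∀ x, q x ∈ φ.source → ∃ g : PGL(4, ℝ), ∀ᶠ x' in 𝓝 x, D x' = g • φ (q x'))
        (hψ : ∀ x, q x ∈ ψ.source → ∃ g : PGL(4, ℝ), ∀ᶠ x' in 𝓝 x, D x' = g • ψ (q x')) :
        IsLocallyProjective (φ.symm.trans ψ) := by
      intro p hp
      have hp1 : p ∈ φ.target := by simp at hp; exact hp.1
      have hp2 : φ.symm p ∈ ψ.source := by simp at hp; exact hp.2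
      obtain ⟨x, hx⟩ := hs (φ.symm p)
      obtain ⟨g, hg⟩ := hφ x (hx ▸ φ.map_target hp1)
      obtain ⟨g', hg'⟩ := hψ x (hx ▸ hp2)
      refine ⟨g'⁻¹ * g, ?_⟩
      have h : ∀ᶠ m in 𝓝 (φ.symm p), g • φ m = g' • ψ m := by
        rw [← hx, ← hq.map_nhds_eq, eventually_map]
        filter_upwards [hg, hg'] with y hy hy'
        rw [← hy, ← hy']
      filter_upwards [(φ.symm.continuousAt hp1).eventually h, φ.open_target.mem_nhds hp1]
        with p' h1 h2
      rw [φ.right_inv h2] at h1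
      rw [mul_smul, h1, inv_smul_smul]
      rfl
    exact fun φ hφ ψ hψ => ⟨key φ ψ hφ hψ, key ψ φ hψ hφ⟩
  maximal φ hφ x hx := by
    obtain ⟨ψ, h1, h2⟩ := exists_chart_of_dev hq hD heq x
    obtain ⟨g, hg⟩ := h2 x h1
    obtain ⟨g', hg'⟩ := (hφ ψ h2).1 (φ (q x)) (by simp [hx, h1])
    refine ⟨g * g', ?_⟩
    filter_upwards [hg, hq.continuous.continuousAt.eventually
      ((φ.continuousAt hx).eventually hg'), hq.continuous.continuousAt.eventually
      (φ.open_source.mem_nhds hx)] with y hy hy' hy''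
    rw [hy, mul_smul, ← hy']
    simp [φ.left_inv hy'']

lemma isDevelopingAlong_ofDev {q : X → M} (hq : IsLocalHomeomorph q)
    (hs : Function.Surjective q) {D : X → RP3} (hD : IsLocalHomeomorph D)
    (heq : ∀ x y, q x = q y → ∃ g : PGL(4, ℝ), ∀ᶠ p : X × X in 𝓝 (x, y),
      q p.1 = q p.2 → D p.1 = g • D p.2) :
    IsDevelopingAlong q (.ofDev hq hs hD heq) D :=
  fun x _ hφ hx => hφ x hx

/-- Developing maps are unique up to a projective transformation. -/
lemma IsDevelopingAlong.exists_eq_smul [PreconnectedSpace X] [Nonempty X] {q : X → M}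
    (hq : IsLocalHomeomorph q) {S : ProjectiveStructure M} {D E : X → RP3}
    (hD : IsDevelopingAlong q S D) (hE : IsDevelopingAlong q S E) :
    ∃ g : PGL(4, ℝ), ∀ x, E x = g • D x := by
  have loc (x : X) : ∃ g : PGL(4, ℝ), ∀ᶠ x' in 𝓝 x, E x' = g • D x' := by
    obtain ⟨φ, hφ, hx⟩ := S.cover (q x)
    obtain ⟨g, hg⟩ := hD x φ hφ hx
    obtain ⟨g', hg'⟩ := hE x φ hφ hx
    refine ⟨g' * g⁻¹, ?_⟩
    filter_upwards [hg, hg'] with y hy hy'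
    rw [hy, hy', mul_smul, inv_smul_smul]
  -- In a chart, `D` is a projective transformation composed with local homeomorphisms, so its
  -- values near `x` fill an open set, and a projective transformation is determined by its action
  -- there.
  have uniq (x : X) (g g' : PGL(4, ℝ)) (h : ∀ᶠ x' in 𝓝 x, g • D x' = g' • D x') (p : RP3) :
      g • p = g' • p := by
    obtain ⟨φ, hφ, hx⟩ := S.cover (q x)
    obtain ⟨k, hk⟩ := hD x φ hφ hx
    have h1 : ∀ᶠ p in 𝓝 (φ (q x)), (g * k) • p = (g' * k) • p := by
      rw [← φ.map_nhds_eq hx, ← hq.map_nhds_eq, eventually_map, eventually_map]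
      filter_upwards [h, hk] with y hy hy'
      rw [mul_smul, mul_smul, ← hy', hy]
    have := smul_eq_smul_of_eventuallyEq h1 (k⁻¹ • p)
    simpa [mul_smul] using this
  obtain ⟨x₀⟩ := ‹Nonempty X›
  obtain ⟨g, hg⟩ := loc x₀
  refine ⟨g, ?_⟩
  have hopen : IsOpen {x | ∀ᶠ x' in 𝓝 x, E x' = g • D x'} := isOpen_setOfPred_eventually_nhds
  have hclosed : IsClosed {x | ∀ᶠ x' in 𝓝 x, E x' = g • D x'} := by
    refine isClosed_of_closure_subset fun x hx => ?_
    obtain ⟨g', hg'⟩ := loc x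
    obtain ⟨y, hy, hy'⟩ := mem_closure_iff_nhds.1 hx _ (eventually_eventually_nhds.2 hg')
    have := uniq y g g' (by
      filter_upwards [hy, hy'] with z hz hz'
      rw [← hz, ← hz'])
    filter_upwards [hg'] with z hz
    rw [hz, this]
  have := IsClopen.eq_univ ⟨hclosed, hopen⟩ ⟨x₀, hg⟩
  exact fun x => (Set.eq_univ_iff_forall.1 this x).self_of_nhds

/-- Together with uniqueness of developing maps, this compares the developing maps of two equivalent
structures through a lift `k` of the equivalence. -/
lemma IsDevelopingAlong.comp_lift {q : X → M} (hq : Continuous q) {S T : ProjectiveStructure M}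
    {h : M ≃ₜ M} (hST : IsProjectiveMap S T h) {E : X → RP3} (hE : IsDevelopingAlong q T E)
    {k : X → X} (hk : Continuous k) (hqk : ∀ x, q (k x) = h (q x)) :
    IsDevelopingAlong q S (E ∘ k) := by
  intro x φ hφ hx
  obtain ⟨ψ, hψ, hxψ⟩ := T.cover (h (q x))
  obtain ⟨g, hg⟩ := hE (k x) ψ hψ (by rwa [hqk])
  obtain ⟨g', hg'⟩ := hST φ hφ ψ hψ (q x) hx hxψ
  refine ⟨g * g', ?_⟩
  filter_upwards [hk.continuousAt.eventually hg, hq.continuousAt.eventually hg'] with y hy hy'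
  rw [Function.comp_apply, hy, hqk, hy', mul_smul]

end Developing

/-! ## The group action on the unit tangent bundle and its universal covering -/

lemma smul_unitTangentH_fst (g : SL(2, ℝ)) (x : UnitTangentH) : (g • x).1.1 = g • x.1.1 := rfl

lemma smul_unitTangentH_snd (g : SL(2, ℝ)) (x : UnitTangentH) :
    (g • x).1.2 = slDeriv g x.1.1 * x.1.2 := rfl

lemma psl_smul_unitTangentH_fst (γ : PSL(2, ℝ)) (x : UnitTangentH) :
    (γ • x).1.1 = γ • x.1.1 := by
  induction γ using QuotientGroup.induction_on
  rfl

/-- The denominator of the Möbius transformation of `g`. -/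
def slDenom (g : SL(2, ℝ)) (z : ℍ) : ℂ := g 1 0 * z + g 1 1

lemma slDenom_ne_zero (g : SL(2, ℝ)) (z : ℍ) : slDenom g z ≠ 0 :=
  UpperHalfPlane.denom_ne_zero (g : GL (Fin 2) ℝ) z

lemma slDeriv_eq (g : SL(2, ℝ)) (z : ℍ) : slDeriv g z = 1 / slDenom g z ^ 2 := rfl

lemma continuous_slDenom (g : SL(2, ℝ)) : Continuous (slDenom g) := by
  unfold slDenom
  have := UpperHalfPlane.continuous_coe
  fun_prop

lemma im_sl_smul (g : SL(2, ℝ)) (z : ℍ) : (g • z).im = z.im / ‖slDenom g z‖ ^ 2 := by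
  rw [← norm_slDeriv, slDeriv_eq, norm_div, norm_pow, norm_one]
  ring

lemma coe_sl_smul (g : SL(2, ℝ)) (z : ℍ) :
    ((g • z : ℍ) : ℂ) = (g 0 0 * z + g 0 1) / slDenom g z := by
  rw [UpperHalfPlane.coe_specialLinearGroup_apply]
  rfl

instance : ContinuousConstSMul SL(2, ℝ) UnitTangentH where
  continuous_const_smul g := by
    refine Continuous.subtype_mk (f := fun x : UnitTangentH =>
      (g • x.1.1, slDeriv g x.1.1 * x.1.2)) ?_ _
    have h1 : Continuous fun x : UnitTangentH => x.1.1 := by fun_prop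
    refine (h1.const_smul g).prodMk (Continuous.mul ?_ (by fun_prop))
    simp only [slDeriv_eq]
    exact continuous_const.div (((continuous_slDenom g).comp h1).pow 2)
      fun x => pow_ne_zero _ (slDenom_ne_zero _ _)

instance : ContinuousConstSMul PSL(2, ℝ) UnitTangentH where
  continuous_const_smul g := by
    induction g using QuotientGroup.induction_on with | H g => exact continuous_const_smul g

instance : ContinuousConstSMul PSL(2, ℝ) ℍ where
  continuous_const_smul g := by
    induction g using QuotientGroup.induction_on with
    | H g => exact continuous_const_smul (T := ℍ) g

instance (Γ : Subgroup PSL(2, ℝ)) : ContinuousConstSMul Γ ℍ where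
  continuous_const_smul γ := continuous_const_smul γ.1

instance (Γ : Subgroup PSL(2, ℝ)) : ContinuousConstSMul Γ UnitTangentH where
  continuous_const_smul γ := continuous_const_smul γ.1

lemma fromCover_eq_iff {x y : UniversalCover} :
    fromCover x = fromCover y ↔ x.1 = y.1 ∧ ∃ n : ℤ, x.2 = y.2 + n * (2 * Real.pi) := by
  rw [Subtype.ext_iff, Prod.ext_iff]
  refine and_congr_right fun h => ?_
  change (x.1.im : ℂ) * Complex.exp (x.2 * Complex.I) = y.1.im * Complex.exp (y.2 * Complex.I) ↔ _
  have him : (y.1.im : ℂ) ≠ 0 := by exact_mod_cast y.1.im_pos.ne'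
  change x.1 = y.1 at h
  rw [h, mul_right_inj' him, Complex.exp_eq_exp_iff_exists_int]
  refine exists_congr fun n => ?_
  have : (y.2 * Complex.I + n * (2 * Real.pi * Complex.I) : ℂ) =
    ((y.2 + n * (2 * Real.pi) : ℝ) : ℂ) * Complex.I := by push_cast; ring
  rw [this, mul_left_inj' Complex.I_ne_zero]
  norm_cast

/-- The denominator has imaginary part `c * Im z`. It stays off the branch cut when `c ≠ 0` and is
constant when `c = 0`. -/
lemma continuous_arg_slDenom (g : SL(2, ℝ)) : Continuous fun z => Complex.arg (slDenom g z) := by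
  by_cases hc : g 1 0 = 0
  · have : (fun z => Complex.arg (slDenom g z)) = fun _ => Complex.arg (g 1 1) := by
      ext z; simp [slDenom, hc]
    rw [this]
    exact continuous_const
  · refine continuous_iff_continuousAt.2 fun z =>
      ContinuousAt.comp (g := Complex.arg) (f := slDenom g) ?_
        (continuous_slDenom g).continuousAt
    refine Complex.continuousAt_arg (Or.inr ?_)
    simp [slDenom, hc, z.im_ne_zero]

/-- A lift to the universal covering of the action of `g`. -/
def liftSL (g : SL(2, ℝ)) : UniversalCover ≃ₜ UniversalCover where
  -- The derivative is the inverse square of the denominator, whence the factor `2` and the sign.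
  toFun x := (g • x.1, x.2 - 2 * Complex.arg (slDenom g x.1))
  invFun x := (g⁻¹ • x.1, x.2 + 2 * Complex.arg (slDenom g (g⁻¹ • x.1)))
  left_inv x := by simp
  right_inv x := by simp
  continuous_toFun := by
    refine (continuous_fst.const_smul g).prodMk (continuous_snd.sub (continuous_const.mul ?_))
    exact (continuous_arg_slDenom g).comp continuous_fst
  continuous_invFun := by
    refine (continuous_fst.const_smul g⁻¹).prodMk (continuous_snd.add (continuous_const.mul ?_))
    exact (continuous_arg_slDenom g).comp (continuous_fst.const_smul g⁻¹)

lemma fromCover_liftSL (g : SL(2, ℝ)) (x : UniversalCover) :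
    fromCover (liftSL g x) = g • fromCover x := by
  apply Subtype.ext
  apply Prod.ext
  · rfl
  · change ((g • x.1).im : ℂ) *
      Complex.exp ((x.2 - 2 * Complex.arg (slDenom g x.1) : ℝ) * Complex.I) =
      slDeriv g x.1 * (x.1.im * Complex.exp (x.2 * Complex.I))
    have h0 := slDenom_ne_zero g x.1
    have h1 := Complex.norm_mul_exp_arg_mul_I (slDenom g x.1)
    have hn : (‖slDenom g x.1‖ : ℂ) ≠ 0 := by simpa using h0
    have he := Complex.exp_ne_zero (Complex.arg (slDenom g x.1) * Complex.I)
    have h2 : Complex.exp ((x.2 - 2 * Complex.arg (slDenom g x.1) : ℝ) * Complex.I) =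
        Complex.exp (x.2 * Complex.I) / Complex.exp (Complex.arg (slDenom g x.1) * Complex.I) ^ 2 := by
      rw [← Complex.exp_nat_mul, ← Complex.exp_sub]
      congr 1
      push_cast
      ring
    rw [im_sl_smul, slDeriv_eq, h2]
    conv_rhs => rw [← h1]
    push_cast
    field_simp

/-- Translation of the angle. -/
def shiftAngle (a : ℝ) : UniversalCover ≃ₜ UniversalCover :=
  (Homeomorph.refl ℍ).prodCongr (Homeomorph.addRight a)

lemma shiftAngle_apply (a : ℝ) (x : UniversalCover) : shiftAngle a x = (x.1, x.2 + a) := rfl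

lemma fromCover_shiftAngle (n : ℤ) (x : UniversalCover) :
    fromCover (shiftAngle (n * (2 * Real.pi)) x) = fromCover x :=
  fromCover_eq_iff.2 ⟨rfl, n, rfl⟩

/-- `f` lifts the action of `γ` to the universal covering. -/
def IsLift (γ : PSL(2, ℝ)) (f : UniversalCover ≃ₜ UniversalCover) : Prop :=
  ∀ x, fromCover (f x) = γ • fromCover x

lemma isLift_liftSL (g : SL(2, ℝ)) : IsLift (QuotientGroup.mk g) (liftSL g) := fromCover_liftSL g

lemma isLift_shiftAngle (n : ℤ) : IsLift 1 (shiftAngle (n * (2 * Real.pi))) := fun x => by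
  rw [fromCover_shiftAngle, one_smul]

lemma IsLift.mul {γ δ : PSL(2, ℝ)} {f k : UniversalCover ≃ₜ UniversalCover} (hf : IsLift γ f)
    (hk : IsLift δ k) : IsLift (γ * δ) (f * k) := fun x => by
  rw [mul_smul, ← hk, ← hf]
  rfl

lemma IsLift.inv {γ : PSL(2, ℝ)} {f : UniversalCover ≃ₜ UniversalCover} (hf : IsLift γ f) :
    IsLift γ⁻¹ f⁻¹ := fun x => by
  rw [eq_inv_smul_iff, ← hf]
  exact congrArg fromCover (f.apply_symm_apply x)

lemma exists_isLift_apply_eq {γ : PSL(2, ℝ)} {x y : UniversalCover}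
    (h : fromCover y = γ • fromCover x) : ∃ f, IsLift γ f ∧ f x = y := by
  induction γ using QuotientGroup.induction_on with | H g =>
  change fromCover y = g • fromCover x at h
  rw [← fromCover_liftSL, fromCover_eq_iff] at h
  obtain ⟨h1, n, h2⟩ := h
  refine ⟨shiftAngle (n * (2 * Real.pi)) * liftSL g, ?_, Prod.ext h1.symm h2.symm⟩
  simpa using (isLift_shiftAngle n).mul (isLift_liftSL g)

lemma surjective_fromCover : Function.Surjective fromCover := by
  rintro ⟨⟨z, v⟩, h⟩
  refine ⟨(z, v.arg), Subtype.ext (Prod.ext rfl ?_)⟩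
  change (z.im : ℂ) * _ = v
  rw [← h]
  exact Complex.norm_mul_exp_arg_mul_I v

/-- The base point of the universal covering, over the vertical unit tangent vector at `i`. -/
def baseCover : UniversalCover := (UpperHalfPlane.I, Real.pi / 2)

lemma fromCover_baseCover : fromCover baseCover = verticalVelocity 0 := by
  apply Subtype.ext
  apply Prod.ext
  · apply UpperHalfPlane.ext
    change Complex.I = (Real.exp 0 : ℝ) * Complex.I
    simp
  · change ((UpperHalfPlane.I : ℍ).im : ℂ) * Complex.exp ((Real.pi / 2 : ℝ) * Complex.I) =
      (Real.exp 0 : ℝ) * Complex.I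
    push_cast
    rw [Complex.exp_pi_div_two_mul_I]
    simp

/-- The rotation matrix of angle `φ`. -/
def rotSL (φ : ℝ) : SL(2, ℝ) :=
  ⟨!![Real.cos φ, -Real.sin φ; Real.sin φ, Real.cos φ], by
    rw [Matrix.det_fin_two_of]
    linarith [Real.sin_sq_add_cos_sq φ]⟩

lemma rotSL_smul_I (φ : ℝ) : rotSL φ • UpperHalfPlane.I = UpperHalfPlane.I := by
  apply UpperHalfPlane.ext
  rw [coe_sl_smul, div_eq_iff (slDenom_ne_zero _ _)]
  simp [slDenom, rotSL]
  linear_combination -(Complex.sin φ) * Complex.I_sq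

lemma exists_sl_smul_base (x : UnitTangentH) : ∃ g : SL(2, ℝ), g • verticalVelocity 0 = x := by
  obtain ⟨g, hg⟩ := MulAction.exists_smul_eq SL(2, ℝ) UpperHalfPlane.I x.1.1
  have hb1 : (verticalVelocity 0).1.1 = UpperHalfPlane.I := by
    rw [← fromCover_baseCover]; rfl
  have hb2 : (verticalVelocity 0).1.2 = Complex.I := by
    change ((Real.exp 0 : ℝ) : ℂ) * Complex.I = Complex.I
    simp
  set v : ℂ := (g⁻¹ • x).1.2 with hv
  have hx1 : (g⁻¹ • x).1.1 = UpperHalfPlane.I := by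
    rw [smul_unitTangentH_fst, ← hg, inv_smul_smul]
  have hvn : ‖v‖ = 1 := by rw [hv, (g⁻¹ • x).2, hx1]; rfl
  obtain ⟨t, ht⟩ : ∃ t : ℝ, v = Complex.exp (t * Complex.I) := by
    refine ⟨v.arg, ?_⟩
    have := Complex.norm_mul_exp_arg_mul_I v
    rw [hvn] at this
    simpa using this.symm
  -- The derivative of `rotSL φ` at `i` is `e ^ (-2 i φ)`, and `φ = (π / 2 - t) / 2` turns the
  -- vector `i` into `e ^ (i t)`.
  refine ⟨g * rotSL ((Real.pi / 2 - t) / 2), ?_⟩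
  rw [mul_smul, ← eq_inv_smul_iff]
  apply Subtype.ext
  apply Prod.ext
  · rw [smul_unitTangentH_fst, hx1, hb1, rotSL_smul_I]
  · rw [smul_unitTangentH_snd, hb1, hb2, ← hv, ht, slDeriv_eq]
    set φ := (Real.pi / 2 - t) / 2 with hφ
    have : slDenom (rotSL φ) UpperHalfPlane.I = Complex.exp (φ * Complex.I) := by
      simp [slDenom, rotSL, Complex.exp_mul_I]
      ring
    rw [this, ← Complex.exp_nat_mul, one_div, ← Complex.exp_neg]
    nth_rewrite 2 [← Complex.exp_pi_div_two_mul_I]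
    rw [← Complex.exp_add]
    congr 1
    rw [hφ]
    push_cast
    ring

/-! ## The covering of the unit tangent bundle of the surface -/

/-- The unit tangent bundle of the hyperbolic plane is a product. -/
def unitTangentHomeomorph : UnitTangentH ≃ₜ ℍ × Circle where
  toFun x := (x.1.1, ⟨x.1.2 / x.1.1.im, by
    change _ ∈ Submonoid.unitSphere ℂ
    rw [← SetLike.mem_coe, Submonoid.coe_unitSphere, mem_sphere_zero_iff_norm, norm_div, x.2, Complex.norm_real, Real.norm_eq_abs,
      abs_of_pos x.1.1.im_pos, div_self x.1.1.im_pos.ne']⟩)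
  invFun p := ⟨(p.1, p.1.im * p.2), by
    rw [norm_mul, Circle.norm_coe, mul_one, Complex.norm_real, Real.norm_eq_abs,
      abs_of_pos p.1.im_pos]⟩
  left_inv x := by
    have : (x.1.1.im : ℂ) ≠ 0 := by exact_mod_cast x.1.1.im_pos.ne'
    apply Subtype.ext
    apply Prod.ext
    · rfl
    · exact mul_div_cancel₀ _ this
  right_inv p := by
    have : (p.1.im : ℂ) ≠ 0 := by exact_mod_cast p.1.im_pos.ne'
    apply Prod.ext
    · rfl
    · apply Subtype.ext
      exact mul_div_cancel_left₀ _ this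
  continuous_toFun := by
    have h1 : Continuous fun x : UnitTangentH => x.1.1 := by fun_prop
    refine h1.prodMk (Continuous.subtype_mk ?_ _)
    refine Continuous.div (by fun_prop)
      (Complex.continuous_ofReal.comp (UpperHalfPlane.continuous_im.comp h1)) fun x => ?_
    exact_mod_cast x.1.1.im_pos.ne'
  continuous_invFun := by
    refine Continuous.subtype_mk (continuous_fst.prodMk ?_) _
    exact (Complex.continuous_ofReal.comp (UpperHalfPlane.continuous_im.comp continuous_fst)).mul
      (continuous_subtype_val.comp continuous_snd)

lemma isLocalHomeomorph_fromCover : IsLocalHomeomorph fromCover := by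
  have h1 : IsLocalHomeomorph (Prod.map id Circle.exp : ℍ × ℝ → ℍ × Circle) := fun x => by
    obtain ⟨e, he, h⟩ := isLocalHomeomorph_circleExp x.2
    exact ⟨(OpenPartialHomeomorph.refl ℍ).prod e, by simp [he], by rw [h]; rfl⟩
  have h2 : fromCover = unitTangentHomeomorph.symm ∘ Prod.map id Circle.exp := by
    funext x
    apply Subtype.ext
    apply Prod.ext
    · rfl
    · change (x.1.im : ℂ) * _ = x.1.im * (Circle.exp x.2 : ℂ)
      rw [Circle.coe_exp]
  rw [h2]
  exact unitTangentHomeomorph.symm.isLocalHomeomorph.comp h1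

instance : MulAction (UniversalCover ≃ₜ UniversalCover) UniversalCover where
  smul f x := f x
  one_smul _ := rfl
  mul_smul _ _ _ := rfl

/-- The covering of `M` by its universal covering. -/
def coverMap (Γ : Subgroup PSL(2, ℝ)) (x : UniversalCover) : UnitTangent Γ :=
  toUnitTangent Γ (fromCover x)

/-- The deck transformations of the universal covering of `M`. -/
def deckGroup (Γ : Subgroup PSL(2, ℝ)) : Subgroup (UniversalCover ≃ₜ UniversalCover) where
  carrier := {f | ∃ γ ∈ Γ, IsLift γ f}
  mul_mem' := fun ⟨γ, hγ, h⟩ ⟨δ, hδ, h'⟩ => ⟨γ * δ, mul_mem hγ hδ, h.mul h'⟩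
  one_mem' := ⟨1, one_mem _, fun _ => (one_smul _ _).symm⟩
  inv_mem' := fun ⟨γ, hγ, h⟩ => ⟨γ⁻¹, inv_mem hγ, h.inv⟩

lemma toUnitTangent_eq_iff {Γ : Subgroup PSL(2, ℝ)} {x y : UnitTangentH} :
    toUnitTangent Γ x = toUnitTangent Γ y ↔ ∃ γ ∈ Γ, x = γ • y := by
  unfold toUnitTangent
  rw [Quotient.eq, MulAction.orbitRel_apply, MulAction.mem_orbit_iff]
  constructor
  · rintro ⟨γ, h⟩
    exact ⟨γ, γ.2, h.symm⟩
  · rintro ⟨γ, hγ, h⟩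
    exact ⟨⟨γ, hγ⟩, h.symm⟩

section Covering

variable {Γ : Subgroup PSL(2, ℝ)} {g : ℕ} (hΓ : IsClosedSurfaceGroup Γ g)
include hΓ

lemma exists_nhds_free (z : ℍ) :
    ∃ U ∈ 𝓝 z, ∀ γ ∈ Γ, ∀ w ∈ U, γ • w ∈ U → γ = 1 := by
  have := hΓ.properlyDiscontinuous
  obtain ⟨U, hU, h⟩ := ProperlyDiscontinuousSMul.exists_nhds_image_smul_eq_self Γ z
  refine ⟨U, hU, fun γ hγ w hw hw' => ?_⟩
  have := hΓ.free ⟨γ, hγ⟩ z (h ⟨γ, hγ⟩ ⟨γ • w, ⟨w, hw, rfl⟩, hw'⟩)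
  exact congrArg Subtype.val this

omit hΓ in
lemma isOpenMap_coverMap : IsOpenMap (coverMap Γ) := by
  have : IsOpenMap (toUnitTangent Γ) := isOpenMap_quotient_mk'_mul (Γ := Γ) (T := UnitTangentH)
  exact this.comp isLocalHomeomorph_fromCover.isOpenMap

omit hΓ in
lemma continuous_coverMap : Continuous (coverMap Γ) :=
  continuous_quotient_mk'.comp isLocalHomeomorph_fromCover.continuous

omit hΓ in
lemma surjective_coverMap : Function.Surjective (coverMap Γ) :=
  Quotient.mk_surjective.comp surjective_fromCover

omit hΓ in
lemma coverMap_eq_iff {x y : UniversalCover} :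
    coverMap Γ x = coverMap Γ y ↔ ∃ γ ∈ Γ, fromCover x = γ • fromCover y :=
  toUnitTangent_eq_iff

lemma isQuotientCoveringMap_coverMap : IsQuotientCoveringMap (coverMap Γ) (deckGroup Γ) where
  toIsQuotientMap := isOpenMap_coverMap.isQuotientMap continuous_coverMap surjective_coverMap
  continuous_const_smul f := f.1.continuous
  apply_eq_iff_mem_orbit {x y} := by
    rw [coverMap_eq_iff, MulAction.mem_orbit_iff]
    constructor
    · rintro ⟨γ, hγ, h⟩
      obtain ⟨f, hf, hfx⟩ := exists_isLift_apply_eq h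
      exact ⟨⟨f, γ, hγ, hf⟩, hfx⟩
    · rintro ⟨⟨f, γ, hγ, hf⟩, rfl⟩
      exact ⟨γ, hγ, hf y⟩
  disjoint x := by
    obtain ⟨U, hU, h⟩ := exists_nhds_free hΓ x.1
    -- Two angles in a ball of radius `1` differ by less than `2 π`, which excludes the nontrivial
    -- shifts of the angle.
    refine ⟨U ×ˢ Metric.ball x.2 1, prod_mem_nhds hU (Metric.ball_mem_nhds _ one_pos), ?_⟩
    rintro ⟨f, γ, hγ, hf⟩ ⟨_, ⟨y, hy, rfl⟩, hy'⟩
    change f y ∈ _ at hy'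
    have h1 : γ • y.1 = (f y).1 := by
      have := congrArg (fun x : UnitTangentH => x.1.1) (hf y)
      exact (psl_smul_unitTangentH_fst _ _).symm.trans this.symm
    obtain rfl := h γ hγ y.1 hy.1 (h1 ▸ hy'.1)
    have h2 : f y = y := by
      have h3 := hf y
      rw [one_smul, fromCover_eq_iff] at h3
      obtain ⟨h4, n, h5⟩ := h3
      have a1 := Real.dist_eq _ _ ▸ Metric.mem_ball.1 hy.2
      have a2 := Real.dist_eq _ _ ▸ Metric.mem_ball.1 hy'.2
      rw [abs_lt] at a1 a2
      have hn : n = 0 := by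
        have hpi := Real.pi_gt_three
        have b1 : (n : ℝ) < 1 := by
          by_contra! hh
          nlinarith
        have b2 : (-1 : ℝ) < n := by
          by_contra! hh
          nlinarith
        have c1 : n < 1 := by exact_mod_cast b1
        have c2 : -1 < n := by exact_mod_cast b2
        omega
      rw [hn] at h5
      exact Prod.ext h4 (by simpa using h5)
    -- A lift of the identity that fixes a point is the identity.
    have h3 : (f : UniversalCover → UniversalCover) = id :=
      (T2Space.isSeparatedMap fromCover).eq_of_comp_eq
        isLocalHomeomorph_fromCover.isLocallyInjective f.continuous continuous_id
        (funext fun z => by simpa using hf z) y h2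
    exact Subtype.ext (Homeomorph.ext fun z => congrFun h3 z)

lemma isCoveringMap_coverMap : IsCoveringMap (coverMap Γ) :=
  (isQuotientCoveringMap_coverMap hΓ).isCoveringMap

/-- Freeness and proper discontinuity make the element of `Γ` relating two points of a fiber locally
constant. This supplies the hypothesis `heq` of `ProjectiveStructure.ofDev`. -/
lemma exists_eventually_fromCover_eq {x y : UniversalCover} (h : coverMap Γ x = coverMap Γ y) :
    ∃ γ ∈ Γ, ∀ᶠ p : UniversalCover × UniversalCover in 𝓝 (x, y),
      coverMap Γ p.1 = coverMap Γ p.2 → fromCover p.1 = γ • fromCover p.2 := by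
  obtain ⟨γ, hγ, hxy⟩ := coverMap_eq_iff.1 h
  have hxy1 : x.1 = γ • y.1 := by
    have := congrArg (fun x : UnitTangentH => x.1.1) hxy
    exact this.trans (psl_smul_unitTangentH_fst _ _)
  obtain ⟨U, hU, hfree⟩ := exists_nhds_free hΓ x.1
  refine ⟨γ, hγ, ?_⟩
  have h1 : ∀ᶠ p : UniversalCover × UniversalCover in 𝓝 (x, y), p.1.1 ∈ U :=
    (continuous_fst.comp continuous_fst).continuousAt.eventually hU
  have h2 : ∀ᶠ p : UniversalCover × UniversalCover in 𝓝 (x, y), γ • p.2.1 ∈ U :=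
    ((continuous_fst.comp continuous_snd).const_smul γ).continuousAt.eventually
      (by simpa [← hxy1] using hU)
  filter_upwards [h1, h2] with p hp1 hp2 hp
  obtain ⟨δ, hδ, hp3⟩ := coverMap_eq_iff.1 hp
  have hp4 : p.1.1 = δ • p.2.1 := by
    have := congrArg (fun x : UnitTangentH => x.1.1) hp3
    exact this.trans (psl_smul_unitTangentH_fst _ _)
  have := hfree (δ * γ⁻¹) (mul_mem hδ (inv_mem hγ)) _ hp2 (by
    rwa [mul_smul, inv_smul_smul, ← hp4])
  rw [hp3, mul_inv_eq_one.1 this]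

end Covering

/-! ## Matrix coordinates and the leaves of the foliations -/

/-- Pairs of complex numbers as vectors of `ℝ⁴`; the pair `(a i + b, c i + d)` corresponds to the
matrix with entries `a, b, c, d`. -/
def pairEquiv : (ℂ × ℂ) ≃ₗ[ℝ] (Fin 4 → ℝ) where
  toFun p := ![p.1.im, p.1.re, p.2.im, p.2.re]
  invFun v := (⟨v 1, v 0⟩, ⟨v 3, v 2⟩)
  left_inv _ := rfl
  right_inv v := by ext i; fin_cases i <;> rfl
  map_add' p q := by ext i; fin_cases i <;> simp
  map_smul' c p := by ext i; fin_cases i <;> simp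

lemma pairEquiv_apply (p : ℂ × ℂ) : pairEquiv p = ![p.1.im, p.1.re, p.2.im, p.2.re] := rfl

/-- A square root of `i e ^ (-i θ)`. -/
def rotor (θ : ℝ) : ℂ := Complex.exp (((Real.pi / 2 - θ) / 2 : ℝ) * Complex.I)

lemma rotor_ne_zero (θ : ℝ) : rotor θ ≠ 0 := Complex.exp_ne_zero _

lemma rotor_pi_div_two : rotor (Real.pi / 2) = 1 := by simp [rotor]

lemma rotor_add (θ α : ℝ) : rotor (θ + α) = Complex.exp ((-α / 2 : ℝ) * Complex.I) * rotor θ := by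
  rw [rotor, rotor, ← Complex.exp_add]
  congr 1
  push_cast
  ring

lemma rotor_im_eq_zero {θ : ℝ} (h : (rotor θ).im = 0) :
    ∃ n : ℤ, θ = Real.pi / 2 + n * (2 * Real.pi) := by
  rw [rotor, Complex.exp_ofReal_mul_I_im, Real.sin_eq_zero_iff] at h
  obtain ⟨n, hn⟩ := h
  exact ⟨-n, by push_cast; linarith⟩

/-- The matrix in `GL(2, ℝ)`, up to scaling, that sends the base vector to the unit tangent vector
under `x`, written as a pair of complex numbers. -/
def matPair (x : UniversalCover) : ℂ × ℂ := (x.1 * rotor x.2, rotor x.2)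

/-- `matPair` in real coordinates. -/
def matVec (x : UniversalCover) : Fin 4 → ℝ := pairEquiv (matPair x)

/-- Left multiplication by `g` in complex coordinates. -/
def slPair (g : SL(2, ℝ)) (p : ℂ × ℂ) : ℂ × ℂ :=
  (g 0 0 * p.1 + g 0 1 * p.2, g 1 0 * p.1 + g 1 1 * p.2)

/-- The angle changes by `-2 arg` of the denominator, so the rotor is multiplied by the denominator
divided by its norm. A shift of the angle by `2 π n` contributes the sign `(-1) ^ n`. Only a real
factor is lost, which projective space does not see. -/
lemma exists_matPair_eq {g : SL(2, ℝ)} {x y : UniversalCover}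
    (h : fromCover x = g • fromCover y) :
    ∃ r : ℝ, r ≠ 0 ∧ matPair x = r • slPair g (matPair y) := by
  rw [← fromCover_liftSL, fromCover_eq_iff] at h
  obtain ⟨h1, n, h2⟩ := h
  change x.1 = g • y.1 at h1
  change x.2 = y.2 - 2 * Complex.arg (slDenom g y.1) + _ at h2
  have h0 := slDenom_ne_zero g y.1
  have hn : (‖slDenom g y.1‖ : ℂ) ≠ 0 := by simpa using h0
  have hm1 : ((-1 : ℂ)) ^ n ≠ 0 := zpow_ne_zero _ (by norm_num)
  have hexp : Complex.exp (((-(n * (2 * Real.pi)) / 2 : ℝ)) * Complex.I) = (-1) ^ (-n) := by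
    rw [← Complex.exp_pi_mul_I, ← Complex.exp_int_mul]
    congr 1
    push_cast
    ring
  have harg : Complex.exp (((-(-(2 * Complex.arg (slDenom g y.1))) / 2 : ℝ)) * Complex.I) =
      slDenom g y.1 / ‖slDenom g y.1‖ := by
    rw [eq_div_iff hn]
    conv_rhs => rw [← Complex.norm_mul_exp_arg_mul_I (slDenom g y.1)]
    rw [mul_comm]
    congr 3
    push_cast
    ring
  have hr : rotor x.2 = (((-1) ^ (-n) / ‖slDenom g y.1‖ : ℝ) : ℂ) *
      (slDenom g y.1 * rotor y.2) := by
    rw [h2, rotor_add, sub_eq_add_neg, rotor_add, hexp, harg]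
    push_cast
    ring
  refine ⟨(-1) ^ (-n) / ‖slDenom g y.1‖,
    div_ne_zero (zpow_ne_zero _ (by norm_num)) (norm_ne_zero_iff.2 h0), ?_⟩
  apply Prod.ext
  · change (x.1 : ℂ) * rotor x.2 = _ • _
    rw [Complex.real_smul, h1, hr, coe_sl_smul]
    simp only [slPair, matPair]
    field_simp
  · change rotor x.2 = _ • _
    rw [Complex.real_smul, hr]
    simp only [slPair, matPair, slDenom]
    ring

lemma matVec_apply (x : UniversalCover) :
    matVec x = ![(matPair x).1.im, (matPair x).1.re, (matPair x).2.im, (matPair x).2.re] := rfl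

/-- Left multiplication by `g` on 2×2 matrices written as vectors. -/
def slVec (g : SL(2, ℝ)) (m : Fin 4 → ℝ) : Fin 4 → ℝ :=
  ![g 0 0 * m 0 + g 0 1 * m 2, g 0 0 * m 1 + g 0 1 * m 3,
    g 1 0 * m 0 + g 1 1 * m 2, g 1 0 * m 1 + g 1 1 * m 3]

lemma exists_matVec_eq {g : SL(2, ℝ)} {x y : UniversalCover}
    (h : fromCover x = g • fromCover y) :
    ∃ r : ℝ, r ≠ 0 ∧ matVec x = r • slVec g (matVec y) := by
  obtain ⟨r, hr, h⟩ := exists_matPair_eq h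
  refine ⟨r, hr, ?_⟩
  rw [matVec, h, map_smul]
  congr 1
  ext i
  fin_cases i <;> simp [pairEquiv_apply, slPair, slVec, matVec]

lemma matVec_of_vertical (z : ℍ) : matVec (z, Real.pi / 2) = ![z.im, z.re, 0, 1] := by
  rw [matVec_apply]
  simp [matPair, rotor_pi_div_two]

/-- Two points of the universal covering define geodesics with the same endpoint at `+∞`. -/
def SameEndpoint (x y : UniversalCover) : Prop :=
  matVec x 0 * matVec y 2 = matVec y 0 * matVec x 2

lemma sl_det (g : SL(2, ℝ)) : g 0 0 * g 1 1 - g 0 1 * g 1 0 = 1 := by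
  rw [← Matrix.det_fin_two, g.2]

/-- `SameEndpoint` is the vanishing of the determinant of the two first columns, which left
multiplication by `g` preserves up to the scalars `r` and `s`. -/
lemma IsLift.sameEndpoint_iff {γ : PSL(2, ℝ)} {f : UniversalCover ≃ₜ UniversalCover}
    (hf : IsLift γ f) (x y : UniversalCover) :
    SameEndpoint (f x) (f y) ↔ SameEndpoint x y := by
  induction γ using QuotientGroup.induction_on with | H g =>
  obtain ⟨r, hr, hx⟩ := exists_matVec_eq (hf x)
  obtain ⟨s, hs, hy⟩ := exists_matVec_eq (hf y)
  have hd := sl_det g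
  rw [SameEndpoint, SameEndpoint, hx, hy]
  simp only [slVec, Pi.smul_apply, smul_eq_mul, Matrix.cons_val]
  rw [← sub_eq_zero, ← sub_eq_zero (a := matVec x 0 * matVec y 2)]
  have : r * (g 0 0 * matVec x 0 + g 0 1 * matVec x 2) *
        (s * (g 1 0 * matVec y 0 + g 1 1 * matVec y 2)) -
      s * (g 0 0 * matVec y 0 + g 0 1 * matVec y 2) *
        (r * (g 1 0 * matVec x 0 + g 1 1 * matVec x 2)) =
      (r * s) * (matVec x 0 * matVec y 2 - matVec y 0 * matVec x 2) := by
    linear_combination (r * s) * (matVec x 0 * matVec y 2 - matVec y 0 * matVec x 2) * hd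
  rw [this]
  simp [hr, hs]

lemma coe_verticalVelocity (t : ℝ) : ((verticalVelocity t).1.1 : ℂ) = Real.exp t * Complex.I := rfl

lemma im_verticalVelocity (t : ℝ) : (verticalVelocity t).1.1.im = Real.exp t := by
  change Complex.im (_ * _) = _
  rw [Complex.im_ofReal_mul, Complex.I_im, mul_one]

lemma tendsto_dist_vertical {m : SL(2, ℝ)} (hm : m 1 0 = 0) :
    ∃ s : ℝ, Tendsto (fun t : ℝ =>
      dist (verticalVelocity t).1.1 (m • (verticalVelocity (t + s)).1.1)) atTop (𝓝 0) := by
  have hd := sl_det m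
  rw [hm, mul_zero, sub_zero] at hd
  have ha : m 0 0 ≠ 0 := fun h => by simp [h] at hd
  have hd0 : m 1 1 ≠ 0 := fun h => by simp [h] at hd
  have hdC : ((m 1 1 : ℝ) : ℂ) ≠ 0 := by exact_mod_cast hd0
  have hd' : ((m 0 0 : ℝ) : ℂ) * ((m 1 1 : ℝ) : ℂ) = 1 := by exact_mod_cast hd
  -- With `a = m 0 0` and `b = m 0 1`, the matrix acts by `z ↦ a ^ 2 z + a b`. The time shift
  -- cancels the dilation and leaves two points at equal height `e ^ t` and constant horizontal
  -- distance `|a b|`.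
  refine ⟨-Real.log (m 0 0 ^ 2), ?_⟩
  have hcoe (t : ℝ) : ((m • (verticalVelocity (t + -Real.log (m 0 0 ^ 2))).1.1 : ℍ) : ℂ) =
      Real.exp t * Complex.I + (m 0 0 * m 0 1 : ℝ) := by
    rw [coe_sl_smul, div_eq_iff (slDenom_ne_zero _ _), coe_verticalVelocity, Real.exp_add,
      Real.exp_neg, Real.exp_log (by positivity), slDenom, hm]
    push_cast
    have haC : ((m 0 0 : ℝ) : ℂ) ≠ 0 := by exact_mod_cast ha
    field_simp
    linear_combination (-Complex.exp t * Complex.I - m 0 0 * m 0 1) * hd'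
  have him (t : ℝ) : (m • (verticalVelocity (t + -Real.log (m 0 0 ^ 2))).1.1 : ℍ).im =
      Real.exp t := by
    rw [← UpperHalfPlane.coe_im, hcoe]
    simp [-Complex.ofReal_exp]
  have h1 (t : ℝ) : dist (verticalVelocity t).1.1
      (m • (verticalVelocity (t + -Real.log (m 0 0 ^ 2))).1.1) =
      2 * Real.arsinh (|m 0 0 * m 0 1| / 2 * Real.exp (-t)) := by
    rw [UpperHalfPlane.dist_eq, hcoe, him, coe_verticalVelocity, im_verticalVelocity,
      Real.sqrt_mul_self (Real.exp_pos t).le, dist_eq_norm, sub_add_cancel_left, norm_neg,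
      Complex.norm_real, Real.norm_eq_abs, Real.exp_neg]
    congr 2
    field_simp
  simp only [h1]
  have h2 : Continuous fun u : ℝ => 2 * Real.arsinh (|m 0 0 * m 0 1| / 2 * u) := by
    have := Real.continuous_arsinh
    fun_prop
  have h3 := (h2.tendsto 0).comp (Real.tendsto_exp_neg_atTop_nhds_zero)
  simpa [Function.comp_def] using h3

/-- If `c = m 1 0` is nonzero, the image point at time `t + s` has height at most `e ^ (-(t + s)) /
c ^ 2`, while the vertical geodesic has height `e ^ t`. The logarithm of the ratio of heights bounds
the distance from below and diverges. -/
lemma eq_zero_of_tendsto_dist_vertical {m : SL(2, ℝ)} {s : ℝ} (h : Tendsto (fun t : ℝ =>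
    dist (verticalVelocity t).1.1 (m • (verticalVelocity (t + s)).1.1)) atTop (𝓝 0)) :
    m 1 0 = 0 := by
  by_contra hc
  have hc2 : 0 < m 1 0 ^ 2 := by positivity
  have hlow (t : ℝ) : 2 * t + s + Real.log (m 1 0 ^ 2) ≤
      dist (verticalVelocity t).1.1 (m • (verticalVelocity (t + s)).1.1) := by
    refine le_trans ?_ (UpperHalfPlane.dist_log_im_le _ _)
    rw [Real.dist_eq]
    refine le_trans ?_ (le_abs_self _)
    have hpos : 0 < m 1 0 ^ 2 * Real.exp (t + s) ^ 2 := by positivity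
    have hle : m 1 0 ^ 2 * Real.exp (t + s) ^ 2 ≤
        ‖slDenom m (verticalVelocity (t + s)).1.1‖ ^ 2 := by
      rw [← Complex.normSq_eq_norm_sq, slDenom, coe_verticalVelocity, Complex.normSq_apply]
      simp [-Complex.ofReal_exp]
      nlinarith [sq_nonneg (m 1 1)]
    have hlog := Real.log_le_log hpos hle
    rw [Real.log_mul hc2.ne' (by positivity), Real.log_pow (Real.exp (t + s)) 2, Real.log_exp] at hlog
    rw [im_sl_smul, im_verticalVelocity, im_verticalVelocity, Real.log_exp,
      Real.log_div (Real.exp_pos _).ne' (hpos.trans_le hle).ne', Real.log_exp]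
    push_cast at hlog
    linarith
  have h1 : Tendsto (fun t : ℝ => 2 * t + s + Real.log (m 1 0 ^ 2)) atTop atTop := by
    refine tendsto_atTop_add_const_right _ _ (tendsto_atTop_add_const_right _ _ ?_)
    exact tendsto_id.const_mul_atTop two_pos
  obtain ⟨t, ht1, ht2⟩ :=
    ((h1.eventually_gt_atTop 1).and (h.eventually_lt_const one_pos)).exists
  linarith [hlow t]

lemma matVec_eq_of_smul_base {g : SL(2, ℝ)} {x : UniversalCover}
    (h : g • verticalVelocity 0 = fromCover x) :
    ∃ r : ℝ, r ≠ 0 ∧ matVec x = r • ![g 0 0, g 0 1, g 1 0, g 1 1] := by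
  rw [← fromCover_baseCover] at h
  obtain ⟨r, hr, h⟩ := exists_matVec_eq h.symm
  refine ⟨r, hr, ?_⟩
  rw [h]
  congr 1
  rw [baseCover, matVec_of_vertical]
  simp [slVec]

lemma inv_mul_apply_one_zero (g h : SL(2, ℝ)) :
    (g⁻¹ * h) 1 0 = g 0 0 * h 1 0 - g 1 0 * h 0 0 := by
  rw [Matrix.SpecialLinearGroup.coe_mul, Matrix.SpecialLinearGroup.coe_inv,
    Matrix.adjugate_fin_two, Matrix.mul_apply, Fin.sum_univ_two]
  simp
  ring

lemma dist_sl_smul (g h : SL(2, ℝ)) (z w : ℍ) :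
    dist (g • z) (h • w) = dist z ((g⁻¹ * h) • w) := by
  rw [mul_smul, ← dist_smul g z, smul_inv_smul]

/-- If `g` and `h` carry the base vector to the two given vectors, both conditions say that `g⁻¹ *
h` is upper triangular. -/
lemma mem_stableLeaf_iff (x y : UniversalCover) :
    fromCover y ∈ stableLeaf (fromCover x) ↔ SameEndpoint x y := by
  have key {g h : SL(2, ℝ)} (hg : g • verticalVelocity 0 = fromCover x)
      (hh : h • verticalVelocity 0 = fromCover y) : SameEndpoint x y ↔ (g⁻¹ * h) 1 0 = 0 := by
    obtain ⟨r, hr, hx⟩ := matVec_eq_of_smul_base hg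
    obtain ⟨s, hs, hy⟩ := matVec_eq_of_smul_base hh
    rw [SameEndpoint, hx, hy, inv_mul_apply_one_zero, ← sub_eq_zero]
    simp only [Pi.smul_apply, smul_eq_mul, Matrix.cons_val]
    have : r * g 0 0 * (s * h 1 0) - s * h 0 0 * (r * g 1 0) =
      (r * s) * (g 0 0 * h 1 0 - g 1 0 * h 0 0) := by ring
    rw [this]
    simp [hr, hs]
  constructor
  · rintro ⟨g, h, hg, hh, s, hs⟩
    induction g using QuotientGroup.induction_on with | H g =>
    induction h using QuotientGroup.induction_on with | H h =>
    refine (key hg hh).2 (eq_zero_of_tendsto_dist_vertical (s := s) ?_)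
    simp only [← dist_sl_smul]
    exact hs
  · intro he
    obtain ⟨g, hg⟩ := exists_sl_smul_base (fromCover x)
    obtain ⟨h, hh⟩ := exists_sl_smul_base (fromCover y)
    obtain ⟨s, hs⟩ := tendsto_dist_vertical ((key hg hh).1 he)
    refine ⟨QuotientGroup.mk g, QuotientGroup.mk h, hg, hh, s, ?_⟩
    simp only [← dist_sl_smul] at hs
    exact hs

lemma liftedLeaf_stable_eq (x : UniversalCover) :
    liftedLeaf stableLeaf x = connectedComponentIn {y | SameEndpoint x y} x := by
  rw [liftedLeaf]
  congr 1
  ext y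
  exact mem_stableLeaf_iff x y

lemma sameEndpoint_refl (x : UniversalCover) : SameEndpoint x x := rfl

lemma IsLift.image_liftedLeaf {γ : PSL(2, ℝ)} {f : UniversalCover ≃ₜ UniversalCover}
    (hf : IsLift γ f) (x : UniversalCover) :
    f '' liftedLeaf stableLeaf x = liftedLeaf stableLeaf (f x) := by
  rw [liftedLeaf_stable_eq, liftedLeaf_stable_eq,
    f.image_connectedComponentIn (sameEndpoint_refl x)]
  congr 1
  ext y
  rw [f.image_eq_preimage_symm, Set.mem_preimage]
  change SameEndpoint x (f.symm y) ↔ SameEndpoint (f x) y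
  rw [← hf.sameEndpoint_iff, f.apply_symm_apply]

/-- A vector asymptotic to the vertical ones has angle `π / 2` modulo `2 π`. A connected set meets
only one of these countably many angles. -/
lemma liftedLeaf_stable_vertical (z : ℍ) :
    liftedLeaf stableLeaf (z, Real.pi / 2) = {y | y.2 = Real.pi / 2} := by
  rw [liftedLeaf_stable_eq]
  apply subset_antisymm
  · intro y hy
    have h1 : ((fun y : UniversalCover => y.2) ''
        connectedComponentIn {y | SameEndpoint (z, Real.pi / 2) y} (z, Real.pi / 2)).Countable := by
      refine (Set.countable_range fun n : ℤ => Real.pi / 2 + n * (2 * Real.pi)).mono ?_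
      rintro _ ⟨w, hw, rfl⟩
      have := connectedComponentIn_subset _ _ hw
      change SameEndpoint _ _ at this
      rw [SameEndpoint, matVec_of_vertical] at this
      simp only [Matrix.cons_val, mul_zero, mul_eq_zero, z.im_pos.ne', false_or] at this
      obtain ⟨n, hn⟩ := rotor_im_eq_zero this
      exact ⟨n, hn.symm⟩
    exact h1.isTotallyDisconnected _ subset_rfl
      (isPreconnected_connectedComponentIn.image _ continuous_snd.continuousOn)
      ⟨y, hy, rfl⟩ ⟨_, mem_connectedComponentIn (sameEndpoint_refl _), rfl⟩
  · have hp : IsPreconnected {y : UniversalCover | y.2 = Real.pi / 2} := by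
      have := isPreconnected_univ.image (fun z : ℍ => ((z, Real.pi / 2) : UniversalCover))
        (by fun_prop)
      convert this using 1
      ext ⟨w, t⟩
      constructor
      · rintro rfl
        exact ⟨w, trivial, rfl⟩
      · rintro ⟨_, -, h⟩
        exact (congrArg Prod.snd h).symm
    refine hp.subset_connectedComponentIn rfl fun y hy => ?_
    obtain ⟨w, t⟩ := y
    obtain rfl : t = Real.pi / 2 := hy
    change SameEndpoint _ _
    rw [SameEndpoint, matVec_of_vertical, matVec_of_vertical]
    simp

lemma exists_isLift_base (x : UniversalCover) :
    ∃ (g : SL(2, ℝ)) (f : UniversalCover ≃ₜ UniversalCover),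
      IsLift (QuotientGroup.mk g) f ∧ f baseCover = x := by
  obtain ⟨g, hg⟩ := exists_sl_smul_base (fromCover x)
  rw [← fromCover_baseCover] at hg
  obtain ⟨f, hf⟩ := exists_isLift_apply_eq (γ := QuotientGroup.mk g) hg.symm
  exact ⟨g, f, hf⟩

lemma fromCover_vertical (t : ℝ) :
    fromCover ((verticalVelocity t).1.1, Real.pi / 2) = verticalVelocity t := by
  apply Subtype.ext
  apply Prod.ext
  · rfl
  · change ((verticalVelocity t).1.1.im : ℂ) * Complex.exp ((Real.pi / 2 : ℝ) * Complex.I) =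
      (Real.exp t : ℝ) * Complex.I
    rw [im_verticalVelocity]
    push_cast
    rw [Complex.exp_pi_div_two_mul_I]

/-- The hypothesis forces `m` to be diagonal, hence a translation along the vertical geodesic.
Consequently a geodesic leaf does not depend on the element used to parametrize it. -/
lemma smul_verticalVelocity {m : SL(2, ℝ)} {s : ℝ}
    (h : m • verticalVelocity s = verticalVelocity 0) (t : ℝ) :
    m • verticalVelocity t = verticalVelocity (t - s) := by
  rw [← fromCover_baseCover, ← fromCover_vertical] at h
  obtain ⟨r, hr, h⟩ := exists_matVec_eq h.symm
  rw [baseCover, matVec_of_vertical, matVec_of_vertical, im_verticalVelocity] at h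
  have hre : (verticalVelocity s).1.1.re = 0 := by
    rw [← UpperHalfPlane.coe_re, coe_verticalVelocity]
    simp [-Complex.ofReal_exp]
  have h0 := congrFun h 0
  have h1 := congrFun h 1
  have h2 := congrFun h 2
  have h3 := congrFun h 3
  simp [slVec, hre, hr, (Real.exp_pos s).ne'] at h0 h1 h2 h3
  have hd := sl_det m
  rw [h1, zero_mul, sub_zero] at hd
  have h4 : m 1 1 = m 0 0 * Real.exp s :=
    mul_left_cancel₀ hr (by rw [← h3, ← h0])
  have h5 : Real.exp (t - s) * m 1 1 ^ 2 = Real.exp t := by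
    rw [Real.exp_sub]
    field_simp
    linear_combination m 1 1 * h4 + Real.exp s * hd
  have hd0 : m 1 1 ≠ 0 := fun h => by simp [h] at hd
  have hdC : ((m 1 1 : ℝ) : ℂ) ≠ 0 := by exact_mod_cast hd0
  have hd' : ((m 0 0 : ℝ) : ℂ) * ((m 1 1 : ℝ) : ℂ) = 1 := by exact_mod_cast hd
  have h5' : ((Real.exp (t - s) : ℝ) : ℂ) * ((m 1 1 : ℝ) : ℂ) ^ 2 = (Real.exp t : ℝ) := by
    exact_mod_cast h5
  apply Subtype.ext
  apply Prod.ext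
  · apply UpperHalfPlane.ext
    rw [smul_unitTangentH_fst, coe_sl_smul, div_eq_iff (slDenom_ne_zero _ _),
      coe_verticalVelocity, coe_verticalVelocity, slDenom, h1, h2, ← h5']
    push_cast
    linear_combination (Complex.exp (t - s) * m 1 1 * Complex.I) * hd'
  · rw [smul_unitTangentH_snd, slDeriv_eq, slDenom, h2]
    change _ * ((Real.exp t : ℝ) * Complex.I) = (Real.exp (t - s) : ℝ) * Complex.I
    rw [← h5', Complex.ofReal_zero, zero_mul, zero_add]
    field_simp

/-! ## Developing maps that are equivariant under all isometries -/

section Equivariant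

variable {D : UniversalCover → RP3} {ρ : SL(2, ℝ) → PGL(4, ℝ)}

/-- Isometries act transitively on unit vectors and their lifts permute the leaves, so equivariance
carries everything back to the leaf of vertical vectors. -/
lemma exists_image_stableLeaf_eq
    (hρ : ∀ g x y, fromCover x = g • fromCover y → D x = ρ g • D y) (x : UniversalCover) :
    ∃ k : PGL(4, ℝ), D '' liftedLeaf stableLeaf x =
      (k • ·) '' Set.range fun z : ℍ => D (z, Real.pi / 2) := by
  obtain ⟨g, f, hf, rfl⟩ := exists_isLift_base x
  refine ⟨ρ g, ?_⟩
  rw [← hf.image_liftedLeaf, baseCover, liftedLeaf_stable_vertical]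
  ext p
  constructor
  · rintro ⟨_, ⟨⟨z, t⟩, h, rfl⟩, rfl⟩
    obtain rfl : t = Real.pi / 2 := h
    exact ⟨_, ⟨z, rfl⟩, (hρ g _ _ (hf _)).symm⟩
  · rintro ⟨_, ⟨z, rfl⟩, rfl⟩
    exact ⟨_, ⟨(z, Real.pi / 2), rfl, rfl⟩, hρ g _ _ (hf _)⟩

lemma exists_image_geodesicLeaf_subset
    (hρ : ∀ g x y, fromCover x = g • fromCover y → D x = ρ g • D y) {l : Set RP3}
    (hl : ∀ t, D ((verticalVelocity t).1.1, Real.pi / 2) ∈ l) (x : UniversalCover) :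
    ∃ k : PGL(4, ℝ), D '' liftedLeaf geodesicLeaf x ⊆ (k • ·) ⁻¹' l := by
  obtain ⟨h, hh⟩ := exists_sl_smul_base (fromCover x)
  refine ⟨(ρ h)⁻¹, ?_⟩
  rintro _ ⟨y, hy, rfl⟩
  obtain ⟨g, s, t, hs, ht⟩ := connectedComponentIn_subset _ _ hy
  induction g using QuotientGroup.induction_on with | H g =>
  change g • verticalVelocity s = _ at hs
  change g • verticalVelocity t = _ at ht
  have hm : (h⁻¹ * g) • verticalVelocity s = verticalVelocity 0 := by
    rw [mul_smul, hs, ← hh, inv_smul_smul]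
  have hy' : fromCover y = h • fromCover ((verticalVelocity (t - s)).1.1, Real.pi / 2) := by
    rw [fromCover_vertical, ← smul_verticalVelocity hm t, mul_smul, smul_inv_smul, ht]
  change (ρ h)⁻¹ • D y ∈ l
  rw [hρ h _ _ hy', inv_smul_smul]
  exact hl _

lemma isFoliatedDevelopingMap_of_equivariant {Γ : Subgroup PSL(2, ℝ)}
    {S : ProjectiveStructure (UnitTangent Γ)} (hD : IsDevelopingMap S D)
    (hρ : ∀ g x y, fromCover x = g • fromCover y → D x = ρ g • D y) {l P : Set RP3}
    (hl' : IsProjLine l) (hl : ∀ t, D ((verticalVelocity t).1.1, Real.pi / 2) ∈ l)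
    (hP' : IsProjPlane P) (hP : ∀ z, D (z, Real.pi / 2) ∈ P) :
    IsFoliatedDevelopingMap S D := by
  refine ⟨hD, fun x => ?_, fun x => ?_⟩
  · obtain ⟨k, hk⟩ := exists_image_geodesicLeaf_subset hρ hl x
    exact ⟨_, hl'.preimage k, hk⟩
  · obtain ⟨k, hk⟩ := exists_image_stableLeaf_eq hρ x
    refine ⟨_, hP'.preimage k⁻¹, ?_⟩
    rw [hk]
    rintro _ ⟨_, ⟨z, rfl⟩, rfl⟩
    simpa using hP z

end Equivariant

/-! ## Lifting homeomorphisms to the universal covering -/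

section Lifting

variable {Γ : Subgroup PSL(2, ℝ)} {g : ℕ} (hΓ : IsClosedSurfaceGroup Γ g)
include hΓ

lemma eq_of_coverMap_comp_eq {k₁ k₂ : UniversalCover → UniversalCover} (h₁ : Continuous k₁)
    (h₂ : Continuous k₂) (h : ∀ x, coverMap Γ (k₁ x) = coverMap Γ (k₂ x)) (x₀ : UniversalCover)
    (hx : k₁ x₀ = k₂ x₀) : k₁ = k₂ :=
  (isCoveringMap_coverMap hΓ).eq_of_comp_eq h₁ h₂ (funext h) x₀ hx

/-- A continuous lift of a homeomorphism is a homeomorphism. -/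
lemma exists_homeomorph_eq_lift {h : UnitTangent Γ ≃ₜ UnitTangent Γ}
    {k : UniversalCover → UniversalCover} (hk : Continuous k)
    (hkh : ∀ x, coverMap Γ (k x) = h (coverMap Γ x)) :
    ∃ e : UniversalCover ≃ₜ UniversalCover, ⇑e = k := by
  -- The inverse is the lift of `h.symm` normalized at one point. Both composites are lifts of the
  -- covering map that agree with the identity at a point.
  obtain ⟨F, ⟨hF0, hF⟩, -⟩ := (isCoveringMap_coverMap hΓ).existsUnique_continuousMap_lifts
    (⟨fun x => h.symm (coverMap Γ x), h.symm.continuous.comp continuous_coverMap⟩ :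
      C(UniversalCover, UnitTangent Γ)) (k baseCover) baseCover (by simp [hkh])
  have hF' (x : UniversalCover) : coverMap Γ (F x) = h.symm (coverMap Γ x) := congrFun hF x
  have h1 : F ∘ k = id := eq_of_coverMap_comp_eq hΓ (F.continuous.comp hk) continuous_id
    (fun x => by simp [hF', hkh]) baseCover hF0
  have h2 : k ∘ F = id := eq_of_coverMap_comp_eq hΓ (hk.comp F.continuous) continuous_id
    (fun x => by simp [hF', hkh]) (k baseCover) (by simp [hF0])
  exact ⟨⟨⟨k, F, congrFun h1, congrFun h2⟩, hk, F.continuous⟩, rfl⟩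

/-- A homeomorphism isotopic to the identity lifts to a homeomorphism of the universal covering
that commutes with the deck transformations. -/
lemma exists_equivariant_lift {h : UnitTangent Γ ≃ₜ UnitTangent Γ} (hi : IsIsotopicToId h) :
    ∃ k : UniversalCover ≃ₜ UniversalCover, (∀ x, coverMap Γ (k x) = h (coverMap Γ x)) ∧
      ∀ γ ∈ Γ, ∀ f, IsLift γ f → ∀ x, k (f x) = f (k x) := by
  obtain ⟨H, hc, h0, h1⟩ := hi
  have cov := isCoveringMap_coverMap hΓ
  let G : C(I × UniversalCover, UnitTangent Γ) := ⟨fun p => H p.1 (coverMap Γ p.2),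
    hc.comp (continuous_fst.prodMk (continuous_coverMap.comp continuous_snd))⟩
  have hG0 (x : UniversalCover) : G (0, x) = coverMap Γ (ContinuousMap.id _ x) := by
    simp [G, h0]
  let K := cov.liftHomotopy G (ContinuousMap.id _) hG0
  have hK (t : I) (x : UniversalCover) : coverMap Γ (K (t, x)) = H t (coverMap Γ x) :=
    congrFun (cov.liftHomotopy_lifts G _ hG0) (t, x)
  have hK0 (x : UniversalCover) : K (0, x) = x := cov.liftHomotopy_zero G _ hG0 x
  have hK1 (x : UniversalCover) : coverMap Γ (K (1, x)) = h (coverMap Γ x) := by rw [hK, h1]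
  obtain ⟨k, hk⟩ := exists_homeomorph_eq_lift hΓ (K.continuous.comp (Continuous.prodMk_right 1)) hK1
  refine ⟨k, fun x => by rw [hk]; exact hK1 x, fun γ hγ f hf x => ?_⟩
  have hq (x : UniversalCover) : coverMap Γ (f x) = coverMap Γ x :=
    coverMap_eq_iff.2 ⟨γ, hγ, hf x⟩
  -- Both paths lift the track of `coverMap Γ x` under the isotopy and start at `f x`.
  have := cov.eq_of_comp_eq (A := I) (g₁ := fun t => K (t, f x)) (g₂ := fun t => f (K (t, x)))
    (by fun_prop) (by have := f.continuous; fun_prop)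
    (funext fun t => by simp [hK, hq]) 0 (by simp [hK0])
  rw [hk]
  exact congrFun this 1

omit hΓ in
lemma coverMap_eq_iff_exists_isLift {x y : UniversalCover} :
    coverMap Γ x = coverMap Γ y ↔ ∃ γ ∈ Γ, ∃ f, IsLift γ f ∧ x = f y := by
  rw [coverMap_eq_iff]
  constructor
  · rintro ⟨γ, hγ, h⟩
    obtain ⟨f, hf, hfx⟩ := exists_isLift_apply_eq h
    exact ⟨γ, hγ, f, hf, hfx.symm⟩
  · rintro ⟨γ, hγ, f, hf, rfl⟩
    exact ⟨γ, hγ, hf y⟩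

/-- By proper discontinuity only finitely many elements carry `i` into a given compact set, and `ℍ`
is a countable union of compact sets. -/
lemma countable_of_isClosedSurfaceGroup : Countable Γ := by
  have := hΓ.properlyDiscontinuous
  have h : (Set.univ : Set Γ) ⊆ ⋃ n : ℕ,
      {γ : Γ | ((γ • ·) '' {UpperHalfPlane.I} ∩ compactCovering ℍ n).Nonempty} := by
    intro γ _
    obtain ⟨n, hn⟩ := exists_mem_compactCovering (γ • UpperHalfPlane.I)
    exact Set.mem_iUnion.2 ⟨n, _, ⟨_, rfl, rfl⟩, hn⟩
  rw [← Set.countable_univ_iff]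
  refine (Set.countable_iUnion fun n => ?_).mono h
  exact (ProperlyDiscontinuousSMul.finite_disjoint_inter_image isCompact_singleton
    (isCompact_compactCovering ℍ n)).countable

omit hΓ

/-! ### Endpoints at infinity and the action of lifts on weakly stable leaves -/

lemma continuous_rotor : Continuous rotor := by
  unfold rotor
  fun_prop

lemma continuous_matVec : Continuous matVec := by
  have h1 : Continuous matPair := by
    have h2 := continuous_rotor.comp (continuous_snd (X := ℍ) (Y := ℝ))
    exact ((UpperHalfPlane.continuous_coe.comp continuous_fst).mul h2).prodMk h2
  exact (LinearMap.continuous_of_finiteDimensional pairEquiv.toLinearMap).comp h1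

lemma matVec_column_ne_zero (x : UniversalCover) : 0 < matVec x 0 ^ 2 + matVec x 2 ^ 2 := by
  by_contra! h
  have h0 : matVec x 0 = 0 := by nlinarith [sq_nonneg (matVec x 0), sq_nonneg (matVec x 2)]
  have h2 : matVec x 2 = 0 := by nlinarith [sq_nonneg (matVec x 0), sq_nonneg (matVec x 2)]
  rw [matVec_apply] at h0 h2
  simp only [Matrix.cons_val, matPair] at h0 h2
  rw [Complex.mul_im, h2, mul_zero, zero_add] at h0
  have h3 : (rotor x.2).re ≠ 0 := fun h3 => rotor_ne_zero x.2 (Complex.ext h3 h2)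
  exact mul_ne_zero x.1.im_pos.ne' h3 h0

lemma matVec_ne_zero (x : UniversalCover) : matVec x ≠ 0 := fun h => by
  simpa [h] using matVec_column_ne_zero x

/-- The endpoint at `+∞` of the geodesic of `x`, as a point of the circle `ℝP¹`. -/
def endpoint (x : UniversalCover) : ℝ × ℝ :=
  (matVec x 0 ^ 2 / (matVec x 0 ^ 2 + matVec x 2 ^ 2),
    matVec x 0 * matVec x 2 / (matVec x 0 ^ 2 + matVec x 2 ^ 2))

lemma continuous_endpoint : Continuous endpoint := by
  have h0 : Continuous fun x => matVec x 0 := (continuous_apply 0).comp continuous_matVec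
  have h2 : Continuous fun x => matVec x 2 := (continuous_apply 2).comp continuous_matVec
  have h (x : UniversalCover) := (matVec_column_ne_zero x).ne'
  exact ((h0.pow 2).div ((h0.pow 2).add (h2.pow 2)) h).prodMk
    ((h0.mul h2).div ((h0.pow 2).add (h2.pow 2)) h)

/-- The two numbers are the first row of the orthogonal projection onto the line spanned by the
first column, and they determine that line. -/
lemma endpoint_eq_iff (x y : UniversalCover) : endpoint x = endpoint y ↔ SameEndpoint x y := by
  have hx := (matVec_column_ne_zero x).ne'
  have hy := (matVec_column_ne_zero y).ne'
  rw [endpoint, endpoint, Prod.mk.injEq, div_eq_div_iff hx hy, div_eq_div_iff hx hy, SameEndpoint]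
  generalize matVec x 0 = a at *
  generalize matVec x 2 = c at *
  generalize matVec y 0 = a' at *
  generalize matVec y 2 = c' at *
  constructor
  · rintro ⟨h1, h2⟩
    by_contra h
    have h3 : c * c' = a * a' := by
      refine mul_right_cancel₀ (sub_ne_zero.2 h) ?_
      linear_combination h2
    have h4 : a * c' = -(a' * c) := by
      refine mul_right_cancel₀ (sub_ne_zero.2 h) ?_
      linear_combination h1
    have h5 : a' = 0 := by
      refine (mul_eq_zero.1 (?_ : a' * (a ^ 2 + c ^ 2) = 0)).resolve_right hx
      linear_combination -a * h3 + c * h4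
    subst h5
    simp_all
  · intro h
    exact ⟨by linear_combination (a * c' + a' * c) * h,
      by linear_combination (c * c' - a * a') * h⟩

include hΓ in
-- Preserving leaves in `M` determines the endpoint of a point of the image only up to `Γ`, which
-- leaves countably many possibilities. The image is connected, so its endpoint is constant.
lemma image_liftedLeaf_subset {h : UnitTangent Γ ≃ₜ UnitTangent Γ}
    (hF : ∀ a b, SameLeaf Γ stableLeaf (h a) (h b) ↔ SameLeaf Γ stableLeaf a b)
    {k : UniversalCover ≃ₜ UniversalCover} (hk : ∀ x, coverMap Γ (k x) = h (coverMap Γ x))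
    (x : UniversalCover) :
    k '' liftedLeaf stableLeaf x ⊆ liftedLeaf stableLeaf (k x) := by
  have := countable_of_isClosedSurfaceGroup hΓ
  have hpre : IsPreconnected (k '' liftedLeaf stableLeaf x) :=
    isPreconnected_connectedComponentIn.image _ k.continuous.continuousOn
  have hxL : x ∈ liftedLeaf stableLeaf x := by
    rw [liftedLeaf_stable_eq]
    exact mem_connectedComponentIn (sameEndpoint_refl x)
  choose z hz using fun γ : Γ => surjective_fromCover (γ.1 • fromCover (k x))
  have hcount : (endpoint '' (k '' liftedLeaf stableLeaf x)).Countable := by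
    refine (Set.countable_range fun γ : Γ => endpoint (z γ)).mono ?_
    rintro _ ⟨_, ⟨y, hy, rfl⟩, rfl⟩
    have hy1 := connectedComponentIn_subset _ _ hy
    obtain ⟨X, Y, hXY, hX, hY⟩ := (hF (coverMap Γ x) (coverMap Γ y)).2
      ⟨fromCover x, fromCover y, hy1, rfl, rfl⟩
    obtain ⟨x₁, rfl⟩ := surjective_fromCover X
    obtain ⟨y₁, rfl⟩ := surjective_fromCover Y
    rw [← hk] at hX hY
    obtain ⟨γ, hγ, f, hf, rfl⟩ := coverMap_eq_iff_exists_isLift.1 hX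
    obtain ⟨δ, hδ, f', hf', rfl⟩ := coverMap_eq_iff_exists_isLift.1 hY
    rw [mem_stableLeaf_iff] at hXY
    refine ⟨⟨δ⁻¹ * γ, mul_mem (inv_mem hδ) hγ⟩, (endpoint_eq_iff _ _).2 ?_⟩
    have h1 : SameEndpoint ((f'⁻¹ * f) (k x)) (k y) := by
      rw [← hf'.inv.sameEndpoint_iff] at hXY
      have h2 : f'⁻¹ (f' (k y)) = k y := f'.symm_apply_apply _
      rwa [h2] at hXY
    rw [← mem_stableLeaf_iff] at h1 ⊢
    rwa [hz, ← (hf'.inv.mul hf) (k x)]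
  have hsub := hcount.isTotallyDisconnected _ subset_rfl
    (hpre.image _ continuous_endpoint.continuousOn)
  rw [liftedLeaf_stable_eq (k x)]
  refine hpre.subset_connectedComponentIn ⟨x, hxL, rfl⟩ ?_
  rintro _ ⟨y, hy, rfl⟩
  exact (endpoint_eq_iff _ _).1 (hsub ⟨_, ⟨x, hxL, rfl⟩, rfl⟩ ⟨_, ⟨y, hy, rfl⟩, rfl⟩)

include hΓ in
lemma image_liftedLeaf_eq {h : UnitTangent Γ ≃ₜ UnitTangent Γ}
    (hF : ∀ a b, SameLeaf Γ stableLeaf (h a) (h b) ↔ SameLeaf Γ stableLeaf a b)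
    {k : UniversalCover ≃ₜ UniversalCover} (hk : ∀ x, coverMap Γ (k x) = h (coverMap Γ x))
    (x : UniversalCover) :
    k '' liftedLeaf stableLeaf x = liftedLeaf stableLeaf (k x) := by
  refine (image_liftedLeaf_subset hΓ hF hk x).antisymm fun y hy => ?_
  have h1 := image_liftedLeaf_subset hΓ (h := h.symm) (k := k.symm)
    (fun a b => by rw [← hF]; simp) (fun y => by rw [Homeomorph.eq_symm_apply, ← hk]; simp) (k x)
    ⟨y, hy, rfl⟩
  rw [k.symm_apply_apply] at h1
  exact ⟨_, h1, k.apply_symm_apply y⟩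

include hΓ in
/-- Equivalent foliated structures develop the weakly stable leaves onto the same sets, up to
projective transformations. -/
lemma exists_image_leaf_eq {S T : {S : ProjectiveStructure (UnitTangent Γ) // IsFoliated S}}
    (hST : (foliatedSetoid Γ).r S T) {D E : UniversalCover → RP3} (hD : IsDevelopingMap S.1 D)
    (hE : IsDevelopingMap T.1 E) (x : UniversalCover) :
    ∃ (p : PGL(4, ℝ)) (y : UniversalCover), D '' liftedLeaf stableLeaf x =
      (p • ·) '' (E '' liftedLeaf stableLeaf y) := by
  obtain ⟨h, hi, hp, -, hF⟩ := hST
  obtain ⟨k, hk, -⟩ := exists_equivariant_lift hΓ hi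
  have hEk : IsDevelopingAlong (coverMap Γ) S.1 (E ∘ k) :=
    IsDevelopingAlong.comp_lift continuous_coverMap hp hE k.continuous hk
  obtain ⟨p, hp⟩ := IsDevelopingAlong.exists_eq_smul
    (isCoveringMap_coverMap hΓ).isLocalHomeomorph hEk hD
  refine ⟨p, k x, ?_⟩
  rw [← image_liftedLeaf_eq hΓ hF hk, Set.image_image, Set.image_image]
  exact Set.image_congr fun y _ => hp y

end Lifting

/-! ## Lines and planes given by equations -/

lemma isProjPlane_ker {φ : (Fin 4 → ℝ) →ₗ[ℝ] ℝ} (hφ : φ ≠ 0) :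
    IsProjPlane (projSubspace (LinearMap.ker φ)) := by
  refine ⟨_, ?_, rfl⟩
  have := Module.Dual.finrank_ker_add_one_of_ne_zero (f := φ) hφ
  simp at this
  omega

lemma isProjLine_ker {φ ψ : (Fin 4 → ℝ) →ₗ[ℝ] ℝ} {u v : Fin 4 → ℝ} (h1 : φ u = 1) (h2 : ψ u = 0)
    (h3 : φ v = 0) (h4 : ψ v = 1) : IsProjLine (projSubspace (LinearMap.ker (φ.prod ψ))) := by
  refine ⟨_, ?_, rfl⟩
  have hs : Function.Surjective (φ.prod ψ) := fun p =>
    ⟨p.1 • u + p.2 • v, by simp [h1, h2, h3, h4]⟩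
  have := LinearMap.finrank_range_add_finrank_ker (φ.prod ψ)
  rw [LinearMap.range_eq_top.2 hs] at this
  simp at this
  omega

/-- The projective image of a convex set is convex. -/
lemma isProjConvex_image {K : Set (Fin 4 → ℝ)} (hK : Convex ℝ K) (h0 : ∀ v ∈ K, v ≠ 0) :
    IsProjConvex {p | ∃ v, ∃ hv : v ∈ K, Projectivization.mk ℝ v (h0 v hv) = p} := by
  rintro _ ⟨W, -, rfl⟩
  have hp : IsPreconnected (K ∩ W) := (hK.inter W.convex).isPreconnected
  have hc : Continuous fun v : ↥(K ∩ W) => (Projectivization.mk ℝ v.1 (h0 v v.2.1) : RP3) :=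
    continuous_projMk continuous_subtype_val _
  have := (isPreconnected_iff_preconnectedSpace.1 hp)
  convert isPreconnected_range hc using 1
  ext p
  constructor
  · rintro ⟨⟨v, hv, rfl⟩, hW⟩
    exact ⟨⟨v, hv, mk_mem_projSubspace.1 hW⟩, rfl⟩
  · rintro ⟨⟨v, hv, hW⟩, rfl⟩
    exact ⟨⟨v, hv, rfl⟩, mk_mem_projSubspace.2 hW⟩

/-! ## The structure given by 2×2 matrices -/

/-- In the coordinates `z` and `s + i (π / 2 - θ) / 2`, the map is the exponential in the second
variable followed by `(z, w) ↦ (z w, w)`, which is invertible where `w ≠ 0`. -/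
lemma isLocalHomeomorph_matVec :
    IsLocalHomeomorph fun p : ℝ × UniversalCover => Real.exp p.1 • matVec p.2 := by
  let A : ℝ × UniversalCover ≃ₜ ℍ × ℂ :=
    { toFun := fun p => (p.2.1, ⟨p.1, (Real.pi / 2 - p.2.2) / 2⟩)
      invFun := fun p => (p.2.re, (p.1, Real.pi / 2 - 2 * p.2.im))
      left_inv := fun p => by
        refine Prod.ext rfl (Prod.ext rfl ?_)
        change Real.pi / 2 - 2 * ((Real.pi / 2 - p.2.2) / 2) = p.2.2
        ring
      right_inv := fun p => by
        refine Prod.ext rfl (Complex.ext rfl ?_)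
        change (Real.pi / 2 - (Real.pi / 2 - 2 * p.2.im)) / 2 = p.2.im
        ring
      continuous_toFun := by
        refine (continuous_fst.comp continuous_snd).prodMk ?_
        refine Complex.equivRealProdCLM.symm.continuous.comp
          (g := Complex.equivRealProdCLM.symm)
          (f := fun p : ℝ × UniversalCover => (p.1, (Real.pi / 2 - p.2.2) / 2)) ?_
        fun_prop
      continuous_invFun := by fun_prop }
  let B : ℍ × ℂ → ℍ × ℂ := Prod.map id Complex.exp
  have hexp : IsLocalHomeomorph Complex.exp := fun z => by
    have h := (Complex.hasStrictDerivAt_exp z).hasStrictFDerivAt_equiv (Complex.exp_ne_zero z)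
    exact ⟨h.toOpenPartialHomeomorph Complex.exp, h.mem_toOpenPartialHomeomorph_source, rfl⟩
  have hB : IsLocalHomeomorph B := fun x => by
    obtain ⟨e, he, h⟩ := hexp x.2
    exact ⟨(OpenPartialHomeomorph.refl ℍ).prod e, by simp [he], by simp only [B]; rw [h]; rfl⟩
  let C₁ : ℍ × ℂ → ℂ × ℂ := Prod.map (fun z : ℍ => (z : ℂ)) id
  have hC₁ : IsLocalHomeomorph C₁ :=
    (UpperHalfPlane.isOpenEmbedding_coe.prodMap .id).isLocalHomeomorph
  let C₂ : OpenPartialHomeomorph (ℂ × ℂ) (ℂ × ℂ) :=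
    { toFun := fun p => (p.1 * p.2, p.2)
      invFun := fun p => (p.1 / p.2, p.2)
      source := {p | p.2 ≠ 0}
      target := {p | p.2 ≠ 0}
      map_source' := fun _ h => h
      map_target' := fun _ h => h
      left_inv' := fun p h => Prod.ext (mul_div_cancel_right₀ _ h) rfl
      right_inv' := fun p h => Prod.ext (div_mul_cancel₀ _ h) rfl
      open_source := isOpen_ne.preimage continuous_snd
      open_target := isOpen_ne.preimage continuous_snd
      continuousOn_toFun := by fun_prop
      continuousOn_invFun := by
        refine ContinuousOn.prodMk ?_ continuousOn_snd
        exact continuousOn_fst.div continuousOn_snd fun p h => h }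
  let L := pairEquiv.toContinuousLinearEquiv.toHomeomorph
  have h1 : IsLocalHomeomorph (C₁ ∘ B ∘ A) := hC₁.comp (hB.comp A.isLocalHomeomorph)
  have hC₂ : IsLocalHomeomorphOn C₂ C₂.source := fun p hp => ⟨C₂, hp, rfl⟩
  have h2 : IsLocalHomeomorphOn (C₂ ∘ (C₁ ∘ B ∘ A)) Set.univ :=
    hC₂.comp h1.isLocalHomeomorphOn fun p _ => Complex.exp_ne_zero _
  have h3 : IsLocalHomeomorph (L ∘ C₂ ∘ (C₁ ∘ B ∘ A)) :=
    L.isLocalHomeomorph.comp (isLocalHomeomorph_iff_isLocalHomeomorphOn_univ.2 h2)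
  convert h3 using 1
  funext p
  change Real.exp p.1 • pairEquiv (matPair p.2) = pairEquiv _
  rw [← map_smul]
  congr 1
  have : Complex.exp (⟨p.1, (Real.pi / 2 - p.2.2) / 2⟩ : ℂ) = Real.exp p.1 * rotor p.2.2 := by
    rw [rotor, Complex.ofReal_exp, ← Complex.exp_add]
    congr 1
    rw [Complex.mk_eq_add_mul_I]
  change _ = ((p.2.1 : ℂ) * Complex.exp (⟨p.1, (Real.pi / 2 - p.2.2) / 2⟩ : ℂ),
    Complex.exp (⟨p.1, (Real.pi / 2 - p.2.2) / 2⟩ : ℂ))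
  rw [this]
  apply Prod.ext
  · change _ • _ = _
    rw [Complex.real_smul]
    simp only [matPair]
    ring
  · change _ • _ = _
    rw [Complex.real_smul]
    rfl

/-- The developing map with values in the projective space of 2×2 matrices. -/
def matDev (x : UniversalCover) : RP3 := Projectivization.mk ℝ (matVec x) (matVec_ne_zero x)

lemma isLocalHomeomorph_matDev : IsLocalHomeomorph matDev :=
  isLocalHomeomorph_projMk matVec_ne_zero isLocalHomeomorph_matVec

/-- Left multiplication by `g` followed by multiplication by a complex number, which is right
multiplication by a rotation. -/
def twistEquiv (g : SL(2, ℝ)) (c : ℂˣ) : (ℂ × ℂ) ≃ₗ[ℝ] (ℂ × ℂ) where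
  toFun p := (c * (g 0 0 * p.1 + g 0 1 * p.2), c * (g 1 0 * p.1 + g 1 1 * p.2))
  invFun p := ((c⁻¹ : ℂˣ) * (g 1 1 * p.1 - g 0 1 * p.2), (c⁻¹ : ℂˣ) * (-g 1 0 * p.1 + g 0 0 * p.2))
  map_add' p q := by ext1 <;> simp <;> ring
  map_smul' r p := by ext1 <;> simp <;> ring
  left_inv p := by
    have hd : (g 0 0 : ℂ) * g 1 1 - g 0 1 * g 1 0 = 1 := by exact_mod_cast sl_det g
    have hc : ((c⁻¹ : ℂˣ) : ℂ) * c = 1 := c.inv_mul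
    ext1
    · linear_combination p.1 * ((g 0 0 : ℂ) * g 1 1 - g 0 1 * g 1 0) * hc + p.1 * hd
    · linear_combination p.2 * ((g 0 0 : ℂ) * g 1 1 - g 0 1 * g 1 0) * hc + p.2 * hd
  right_inv p := by
    have hd : (g 0 0 : ℂ) * g 1 1 - g 0 1 * g 1 0 = 1 := by exact_mod_cast sl_det g
    have hc : ((c⁻¹ : ℂˣ) : ℂ) * c = 1 := c.inv_mul
    ext1
    · linear_combination p.1 * ((g 0 0 : ℂ) * g 1 1 - g 0 1 * g 1 0) * hc + p.1 * hd
    · linear_combination p.2 * ((g 0 0 : ℂ) * g 1 1 - g 0 1 * g 1 0) * hc + p.2 * hd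

/-- The unit complex number that corresponds to a rotation of tangent vectors by `α`. -/
def halfRotation (α : ℝ) : ℂˣ :=
  Units.mk0 (Complex.exp ((-α / 2 : ℝ) * Complex.I)) (Complex.exp_ne_zero _)

/-- The linear automorphism `twistEquiv` in real coordinates. -/
def holEquiv (g : SL(2, ℝ)) (α : ℝ) : (Fin 4 → ℝ) ≃ₗ[ℝ] (Fin 4 → ℝ) :=
  pairEquiv.symm ≪≫ₗ twistEquiv g (halfRotation α) ≪≫ₗ pairEquiv

/-- Rotating tangent vectors by `α` is right multiplication of matrices by a rotation. It commutes
with left multiplication and is multiplication by `e ^ (-i α / 2)` in complex coordinates. -/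
lemma matDev_shiftAngle {g : SL(2, ℝ)} {x y : UniversalCover} (h : fromCover x = g • fromCover y)
    (α : ℝ) : matDev (shiftAngle α x) = pglOfLinearEquiv (holEquiv g α) • matDev y := by
  obtain ⟨r, hr, h⟩ := exists_matPair_eq h
  rw [matDev, matDev, pglOfLinearEquiv_smul_mk, Projectivization.mk_eq_mk_iff']
  refine ⟨r, ?_⟩
  rw [matVec, matVec, ← map_smul]
  simp only [holEquiv, LinearEquiv.trans_apply, ← map_smul, LinearEquiv.symm_apply_apply]
  congr 1
  rw [map_smul]
  have h1 : matPair (shiftAngle α x) =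
      ((halfRotation α : ℂ) * (matPair x).1, (halfRotation α : ℂ) * (matPair x).2) := by
    simp only [matPair, shiftAngle_apply, rotor_add, halfRotation, Units.val_mk0]
    ext1 <;> ring
  rw [h1, h]
  simp only [twistEquiv, slPair, LinearEquiv.coe_mk, LinearMap.coe_mk, AddHom.coe_mk,
    Prod.smul_mk, Complex.real_smul]
  ext1 <;> ring

lemma shiftAngle_zero (x : UniversalCover) : shiftAngle 0 x = x := by
  rw [shiftAngle_apply, add_zero]

lemma matDev_equivariant (g : SL(2, ℝ)) (x y : UniversalCover)
    (h : fromCover x = g • fromCover y) :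
    matDev x = pglOfLinearEquiv (holEquiv g 0) • matDev y := by
  have := matDev_shiftAngle h 0
  rwa [shiftAngle_zero] at this

lemma matDev_vertical (z : ℍ) : matDev (z, Real.pi / 2) =
    Projectivization.mk ℝ ![z.im, z.re, 0, 1] (fun h => by simpa using congrFun h 3) := by
  simp only [matDev, matVec_of_vertical]

lemma matDev_leaf_eq : (Set.range fun z : ℍ => matDev (z, Real.pi / 2)) =
    {p | ∃ v, ∃ hv : v ∈ {v : Fin 4 → ℝ | 0 < v 0 ∧ v 2 = 0 ∧ v 3 = 1},
      Projectivization.mk ℝ v (fun h => by simp [h] at hv) = p} := by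
  ext p
  constructor
  · rintro ⟨z, rfl⟩
    exact ⟨_, by simp [z.im_pos], (matDev_vertical z).symm⟩
  · rintro ⟨v, ⟨h0, h2, h3⟩, rfl⟩
    refine ⟨⟨⟨v 1, v 0⟩, h0⟩, ?_⟩
    dsimp only
    rw [matDev_vertical]
    congr 1
    ext i
    fin_cases i <;> simp [h2, h3]

lemma isProjConvex_matDev_leaf : IsProjConvex (Set.range fun z : ℍ => matDev (z, Real.pi / 2)) := by
  rw [matDev_leaf_eq]
  refine isProjConvex_image ?_ _
  have h1 : Convex ℝ {v : Fin 4 → ℝ | 0 < v 0} :=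
    convex_halfSpace_gt (LinearMap.proj (R := ℝ) (φ := fun _ : Fin 4 => ℝ) 0).isLinear 0
  have h2 : Convex ℝ {v : Fin 4 → ℝ | v 2 = 0} :=
    convex_hyperplane (LinearMap.proj (R := ℝ) (φ := fun _ : Fin 4 => ℝ) 2).isLinear 0
  have h3 : Convex ℝ {v : Fin 4 → ℝ | v 3 = 1} :=
    convex_hyperplane (LinearMap.proj (R := ℝ) (φ := fun _ : Fin 4 => ℝ) 3).isLinear 1
  exact h1.inter (h2.inter h3)

/-- The leaf develops onto the half-plane `v 0 > 0` of the affine plane `v 2 = 0`, `v 3 = 1`; its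
boundary line `v 0 = v 2 = 0` lies in the closure. -/
lemma not_isProperlyProjConvex_matDev_leaf :
    ¬ IsProperlyProjConvex (Set.range fun z : ℍ => matDev (z, Real.pi / 2)) := by
  rintro ⟨-, h⟩
  refine h _ (isProjLine_ker (φ := LinearMap.proj 0) (ψ := LinearMap.proj 2)
    (u := ![1, 0, 0, 0]) (v := ![0, 0, 1, 0]) rfl rfl rfl rfl) ?_
  intro p hp
  induction p using Projectivization.ind with | _ v hv =>
  rw [mk_mem_projSubspace, LinearMap.mem_ker] at hp
  have hv0 : v 0 = 0 := congrArg Prod.fst hp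
  have hv2 : v 2 = 0 := congrArg Prod.snd hp
  -- The sign `s` keeps `s * (v 3 + ε * s)` positive for `ε > 0`, even at the point at infinity,
  -- where `v 3 = 0`.
  obtain ⟨s, hs0, hs⟩ : ∃ s : ℝ, s ≠ 0 ∧ 0 ≤ s * v 3 := by
    rcases le_total 0 (v 3) with h | h
    · exact ⟨1, one_ne_zero, by linarith⟩
    · exact ⟨-1, by norm_num, by linarith⟩
  -- approach `v` by matrices with positive diagonal entries, up to sign
  let w : ℝ → Fin 4 → ℝ := fun ε => ![ε * s, v 1, 0, v 3 + ε * s]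
  have hw : Continuous w := by
    refine continuous_pi fun i => ?_
    fin_cases i <;> simp only [w] <;> fun_prop
  have hw0 : w 0 = v := by
    ext i
    fin_cases i <;> simp [w, hv0, hv2]
  rw [mem_closure_iff_nhds]
  intro U hU
  have hq : Tendsto (fun x : {v : Fin 4 → ℝ // v ≠ 0} =>
      (Projectivization.mk ℝ x.1 x.2 : RP3)) (𝓝 ⟨v, hv⟩) (𝓝 (Projectivization.mk ℝ v hv)) :=
    isQuotientMap_projMk.continuous.tendsto _
  have h2 := hq.eventually hU
  rw [nhds_subtype_eq_comap, eventually_comap] at h2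
  have h3 : Tendsto w (𝓝[>] 0) (𝓝 v) := by
    rw [← hw0]
    exact hw.continuousAt.tendsto.mono_left nhdsWithin_le_nhds
  obtain ⟨ε, hε1, hε⟩ := ((h3.eventually h2).and self_mem_nhdsWithin).exists
  have hε : 0 < ε := hε
  have hs2 : 0 < s ^ 2 := by positivity
  have hne : v 3 + ε * s ≠ 0 := fun h0 => by
    have : s * (v 3 + ε * s) = 0 := by rw [h0, mul_zero]
    nlinarith
  have hwne : w ε ≠ 0 := fun h0 => hne (by simpa [w] using congrFun h0 3)
  refine ⟨_, hε1 ⟨w ε, hwne⟩ rfl, ⟨⟨v 1 / (v 3 + ε * s), ε * s / (v 3 + ε * s)⟩, ?_⟩, ?_⟩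
  · change 0 < ε * s / (v 3 + ε * s)
    have : ε * s / (v 3 + ε * s) = (ε * (s * (v 3 + ε * s))) / (v 3 + ε * s) ^ 2 := by
      field_simp
    rw [this]
    have : 0 < s * (v 3 + ε * s) := by nlinarith
    positivity
  · dsimp only
    rw [matDev_vertical, Projectivization.mk_eq_mk_iff']
    refine ⟨(v 3 + ε * s)⁻¹, ?_⟩
    ext i
    fin_cases i
    · change (v 3 + ε * s)⁻¹ * (ε * s) = ε * s / (v 3 + ε * s)
      ring
    · change (v 3 + ε * s)⁻¹ * v 1 = v 1 / (v 3 + ε * s)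
      ring
    · change (v 3 + ε * s)⁻¹ * 0 = 0
      ring
    · exact inv_mul_cancel₀ hne

section MatStructure

variable {Γ : Subgroup PSL(2, ℝ)} {g : ℕ}

/-- Structures on `M` defined by developing maps that are equivariant under all isometries. -/
lemma exists_structure_of_equivariant {D : UniversalCover → RP3} {ρ : SL(2, ℝ) → PGL(4, ℝ)}
    (hΓ : IsClosedSurfaceGroup Γ g) (hD : IsLocalHomeomorph D)
    (hρ : ∀ g x y, fromCover x = g • fromCover y → D x = ρ g • D y) :
    ∃ S : ProjectiveStructure (UnitTangent Γ), IsDevelopingMap S D := by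
  refine ⟨.ofDev (isCoveringMap_coverMap hΓ).isLocalHomeomorph surjective_coverMap hD ?_,
    isDevelopingAlong_ofDev _ _ _ _⟩
  intro x y hxy
  obtain ⟨γ, hγ, h⟩ := exists_eventually_fromCover_eq hΓ hxy
  induction γ using QuotientGroup.induction_on with | H m =>
  exact ⟨ρ m, h.mono fun p hp hq => hρ m _ _ (hp hq)⟩

lemma exists_convex_not_properlyConvex (hΓ : IsClosedSurfaceGroup Γ g) :
    ∃ c ∈ ConvexFoliatedModuli Γ, c ∉ ProperlyConvexFoliatedModuli Γ := by
  obtain ⟨S, hS⟩ := exists_structure_of_equivariant hΓ isLocalHomeomorph_matDev matDev_equivariant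
  have hfol : IsFoliatedDevelopingMap S matDev := by
    refine isFoliatedDevelopingMap_of_equivariant hS matDev_equivariant
      (isProjLine_ker (φ := LinearMap.proj 1) (ψ := LinearMap.proj 2)
        (u := ![0, 1, 0, 0]) (v := ![0, 0, 1, 0]) rfl rfl rfl rfl) (fun t => ?_)
      (isProjPlane_ker (φ := LinearMap.proj 2) (fun h => ?_)) fun z => ?_
    · rw [matDev_vertical, mk_mem_projSubspace, LinearMap.mem_ker]
      refine Prod.ext ?_ rfl
      change (verticalVelocity t).1.1.re = 0
      rw [← UpperHalfPlane.coe_re, coe_verticalVelocity]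
      simp [-Complex.ofReal_exp]
    · simpa using congrArg (fun f => f ![0, 0, 1, 0]) h
    · rw [matDev_vertical, mk_mem_projSubspace, LinearMap.mem_ker]
      rfl
  refine ⟨Quotient.mk (foliatedSetoid Γ) ⟨S, _, hfol⟩, ⟨_, ⟨_, hfol, fun x => ?_⟩, rfl⟩, ?_⟩
  · obtain ⟨k, hk⟩ := exists_image_stableLeaf_eq matDev_equivariant x
    rw [hk]
    exact isProjConvex_matDev_leaf.smul k
  -- Any other representative of the class has a leaf that develops onto a projective image of the
  -- same half-plane.
  · rintro ⟨T, ⟨E, hE, hEc⟩, hT⟩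
    obtain ⟨p, y, hp⟩ := exists_image_leaf_eq hΓ ((foliatedSetoid Γ).symm (Quotient.exact hT))
      hS hE.1 baseCover
    obtain ⟨k, hk⟩ := exists_image_stableLeaf_eq matDev_equivariant baseCover
    apply not_isProperlyProjConvex_matDev_leaf
    have : (Set.range fun z : ℍ => matDev (z, Real.pi / 2)) =
        (k⁻¹ • ·) '' ((p • ·) '' (E '' liftedLeaf stableLeaf y)) := by
      rw [← hp, hk, Set.image_image]
      simp
    rw [this]
    exact ((hEc y).smul p).smul k⁻¹

end MatStructure

/-! ## The structure given by binary cubics -/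

/-- The binary cubic `X (X ^ 2 - Y ^ 2)` transformed by a matrix. -/
def cubicMap (m : Fin 4 → ℝ) : Fin 4 → ℝ :=
  ![m 0 * (m 0 ^ 2 - m 1 ^ 2),
    m 2 * (m 0 ^ 2 - m 1 ^ 2) + 2 * m 0 * (m 0 * m 2 - m 1 * m 3),
    m 0 * (m 2 ^ 2 - m 3 ^ 2) + 2 * m 2 * (m 0 * m 2 - m 1 * m 3),
    m 2 * (m 2 ^ 2 - m 3 ^ 2)]

/-- The action of 2×2 matrices on binary cubics. -/
def symCube (m : Fin 4 → ℝ) : (Fin 4 → ℝ) →ₗ[ℝ] (Fin 4 → ℝ) where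
  toFun f := ![f 0 * m 0 ^ 3 + f 1 * (m 0 ^ 2 * m 1) + f 2 * (m 0 * m 1 ^ 2) + f 3 * m 1 ^ 3,
    3 * f 0 * (m 0 ^ 2 * m 2) + f 1 * (2 * m 0 * m 2 * m 1 + m 0 ^ 2 * m 3) +
      f 2 * (m 2 * m 1 ^ 2 + 2 * m 0 * m 1 * m 3) + 3 * f 3 * (m 1 ^ 2 * m 3),
    3 * f 0 * (m 0 * m 2 ^ 2) + f 1 * (m 2 ^ 2 * m 1 + 2 * m 0 * m 2 * m 3) +
      f 2 * (m 0 * m 3 ^ 2 + 2 * m 2 * m 1 * m 3) + 3 * f 3 * (m 1 * m 3 ^ 2),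
    f 0 * m 2 ^ 3 + f 1 * (m 2 ^ 2 * m 3) + f 2 * (m 2 * m 3 ^ 2) + f 3 * m 3 ^ 3]
  map_add' f f' := by ext i; fin_cases i <;> simp <;> ring
  map_smul' c f := by ext i; fin_cases i <;> simp <;> ring

/-- The determinant of a 2×2 matrix written as a vector. -/
def vecDet (m : Fin 4 → ℝ) : ℝ := m 0 * m 3 - m 1 * m 2

/-- The inverse of a 2×2 matrix written as a vector. -/
def vecInv (m : Fin 4 → ℝ) : Fin 4 → ℝ := (vecDet m)⁻¹ • ![m 3, -m 1, -m 2, m 0]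

/-- The product of 2×2 matrices written as vectors. -/
def vecMul : (Fin 4 → ℝ) →ₗ[ℝ] (Fin 4 → ℝ) →ₗ[ℝ] (Fin 4 → ℝ) :=
  LinearMap.mk₂ ℝ (fun m n => ![m 0 * n 0 + m 1 * n 2, m 0 * n 1 + m 1 * n 3,
    m 2 * n 0 + m 3 * n 2, m 2 * n 1 + m 3 * n 3])
    (fun m m' n => by ext i; fin_cases i <;> simp <;> ring)
    (fun c m n => by ext i; fin_cases i <;> simp <;> ring)
    (fun m n n' => by ext i; fin_cases i <;> simp <;> ring)
    (fun c m n => by ext i; fin_cases i <;> simp <;> ring)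

lemma vecMul_apply (m n : Fin 4 → ℝ) : vecMul m n = ![m 0 * n 0 + m 1 * n 2,
    m 0 * n 1 + m 1 * n 3, m 2 * n 0 + m 3 * n 2, m 2 * n 1 + m 3 * n 3] := rfl

lemma cubicMap_vecMul (m n : Fin 4 → ℝ) : cubicMap (vecMul m n) = symCube m (cubicMap n) := by
  ext i
  fin_cases i <;> simp [cubicMap, vecMul_apply, symCube] <;> ring

lemma cubicMap_smul (c : ℝ) (m : Fin 4 → ℝ) : cubicMap (c • m) = c ^ 3 • cubicMap m := by
  ext i
  fin_cases i <;> simp [cubicMap] <;> ring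

lemma vecMul_vecInv {m : Fin 4 → ℝ} (hm : vecDet m ≠ 0) : vecMul m (vecInv m) = ![1, 0, 0, 1] := by
  have h : (vecDet m)⁻¹ * (m 0 * m 3 - m 1 * m 2) = 1 := inv_mul_cancel₀ hm
  ext i
  fin_cases i <;> simp [vecMul_apply, vecInv]
  · linear_combination h
  · ring
  · ring
  · linear_combination h

lemma vecInv_vecMul {m : Fin 4 → ℝ} (hm : vecDet m ≠ 0) : vecMul (vecInv m) m = ![1, 0, 0, 1] := by
  have h : (vecDet m)⁻¹ * (m 0 * m 3 - m 1 * m 2) = 1 := inv_mul_cancel₀ hm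
  ext i
  fin_cases i <;> simp [vecMul_apply, vecInv]
  · linear_combination h
  · ring
  · ring
  · linear_combination h

lemma vecMul_assoc (m n p : Fin 4 → ℝ) : vecMul m (vecMul n p) = vecMul (vecMul m n) p := by
  ext i
  fin_cases i <;> simp [vecMul_apply] <;> ring

lemma one_vecMul (m : Fin 4 → ℝ) : vecMul ![1, 0, 0, 1] m = m := by
  ext i
  fin_cases i <;> simp [vecMul_apply]

lemma symCube_vecMul (m n : Fin 4 → ℝ) : symCube (vecMul m n) = symCube m ∘ₗ symCube n := by
  ext f i
  fin_cases i <;> simp [symCube, vecMul_apply] <;> ring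

lemma symCube_one : symCube ![1, 0, 0, 1] = LinearMap.id := by
  ext f i
  fin_cases i <;> simp [symCube]

/-- The action of an invertible 2×2 matrix on binary cubics. -/
def symCubeEquiv {m : Fin 4 → ℝ} (hm : vecDet m ≠ 0) : (Fin 4 → ℝ) ≃ₗ[ℝ] (Fin 4 → ℝ) :=
  LinearEquiv.ofLinearMap (symCube m) (symCube (vecInv m))
    (by rw [← symCube_vecMul, vecMul_vecInv hm, symCube_one])
    (by rw [← symCube_vecMul, vecInv_vecMul hm, symCube_one])

lemma symCubeEquiv_apply {m : Fin 4 → ℝ} (hm : vecDet m ≠ 0) (f : Fin 4 → ℝ) :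
    symCubeEquiv hm f = symCube m f := rfl

/-- The action of an invertible 2×2 matrix by left multiplication. -/
def vecMulEquiv {m : Fin 4 → ℝ} (hm : vecDet m ≠ 0) : (Fin 4 → ℝ) ≃ₗ[ℝ] (Fin 4 → ℝ) :=
  LinearEquiv.ofLinearMap (vecMul m) (vecMul (vecInv m))
    (LinearMap.ext fun n => by simp [vecMul_assoc, vecMul_vecInv hm, one_vecMul])
    (LinearMap.ext fun n => by simp [vecMul_assoc, vecInv_vecMul hm, one_vecMul])

/-! ### Local invertibility of the orbit map on binary cubics -/

/-- The derivative of `cubicMap` at the identity matrix. -/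
def cubicDeriv : (Fin 4 → ℝ) ≃L[ℝ] (Fin 4 → ℝ) :=
  LinearEquiv.toContinuousLinearEquiv
    { toFun := fun v => ![3 * v 0, 3 * v 2 - 2 * v 1, -v 0 - 2 * v 3, -v 2]
      invFun := fun w => ![w 0 / 3, (-3 * w 3 - w 1) / 2, -w 3, (-w 2 - w 0 / 3) / 2]
      map_add' := fun v w => by ext i; fin_cases i <;> simp <;> ring
      map_smul' := fun c v => by ext i; fin_cases i <;> simp <;> ring
      left_inv := fun v => by ext i; fin_cases i <;> simp
      right_inv := fun v => by ext i; fin_cases i <;> simp <;> ring }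

lemma cubicDeriv_apply (v : Fin 4 → ℝ) :
    cubicDeriv v = ![3 * v 0, 3 * v 2 - 2 * v 1, -v 0 - 2 * v 3, -v 2] := rfl

lemma hasStrictFDerivAt_cubicMap :
    HasStrictFDerivAt cubicMap (cubicDeriv : (Fin 4 → ℝ) →L[ℝ] (Fin 4 → ℝ)) ![1, 0, 0, 1] := by
  have hp (i : Fin 4) := hasStrictFDerivAt_apply (𝕜 := ℝ) (F' := fun _ : Fin 4 => ℝ) i
    (![1, 0, 0, 1] : Fin 4 → ℝ)
  rw [hasStrictFDerivAt_pi']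
  intro i
  fin_cases i
  · refine HasStrictFDerivAt.congr_fderiv ((hp 0).mul (((hp 0).pow 2).sub ((hp 1).pow 2))) ?_
    refine ContinuousLinearMap.ext fun v => ?_
    simp [cubicDeriv_apply]
    ring
  · refine HasStrictFDerivAt.congr_fderiv (((hp 2).mul (((hp 0).pow 2).sub ((hp 1).pow 2))).add
      (((hp 0).const_mul 2).mul (((hp 0).mul (hp 2)).sub ((hp 1).mul (hp 3))))) ?_
    refine ContinuousLinearMap.ext fun v => ?_
    simp [cubicDeriv_apply]
    ring
  · refine HasStrictFDerivAt.congr_fderiv (((hp 0).mul (((hp 2).pow 2).sub ((hp 3).pow 2))).add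
      (((hp 2).const_mul 2).mul (((hp 0).mul (hp 2)).sub ((hp 1).mul (hp 3))))) ?_
    refine ContinuousLinearMap.ext fun v => ?_
    simp [cubicDeriv_apply]
    ring
  · refine HasStrictFDerivAt.congr_fderiv ((hp 2).mul (((hp 2).pow 2).sub ((hp 3).pow 2))) ?_
    refine ContinuousLinearMap.ext fun v => ?_
    simp [cubicDeriv_apply]

/-- The inverse function theorem applies at the identity matrix, and the equivariance
`cubicMap_vecMul` transports the conclusion to every invertible matrix. -/
lemma isLocalHomeomorphOn_cubicMap : IsLocalHomeomorphOn cubicMap {m | vecDet m ≠ 0} := by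
  intro m hm
  let e₁ := (vecMulEquiv hm).symm.toContinuousLinearEquiv.toHomeomorph
  let e₃ := (symCubeEquiv hm).toContinuousLinearEquiv.toHomeomorph
  let e₂ := hasStrictFDerivAt_cubicMap.toOpenPartialHomeomorph cubicMap
  refine ⟨(e₁.toOpenPartialHomeomorph.trans e₂).trans e₃.toOpenPartialHomeomorph, ?_, ?_⟩
  · have h1 : e₁ m = ![1, 0, 0, 1] := vecInv_vecMul hm
    have h2 : (![1, 0, 0, 1] : Fin 4 → ℝ) ∈ e₂.source :=
      hasStrictFDerivAt_cubicMap.mem_toOpenPartialHomeomorph_source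
    simp [h1, h2]
  · funext n
    change cubicMap n = symCube m (cubicMap (vecMul (vecInv m) n))
    rw [← cubicMap_vecMul, vecMul_assoc, vecMul_vecInv hm, one_vecMul]

lemma cubicMap_ne_zero {m : Fin 4 → ℝ} (hm : vecDet m ≠ 0) : cubicMap m ≠ 0 := by
  have h : vecMul m ![1, 0, 0, 1] = m := by ext i; fin_cases i <;> simp [vecMul_apply]
  rw [← h, cubicMap_vecMul, ← symCubeEquiv_apply hm, (symCubeEquiv hm).map_ne_zero_iff]
  intro h0
  simpa [cubicMap] using congrFun h0 0

lemma vecDet_smul (c : ℝ) (m : Fin 4 → ℝ) : vecDet (c • m) = c ^ 2 * vecDet m := by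
  simp only [vecDet, Pi.smul_apply, smul_eq_mul]
  ring

lemma vecDet_matVec_ne_zero (x : UniversalCover) : vecDet (matVec x) ≠ 0 := by
  have h : vecDet (matVec x) = x.1.im * Complex.normSq (rotor x.2) := by
    rw [vecDet, matVec_apply, Complex.normSq_apply]
    simp [matPair]
    ring
  rw [h]
  exact mul_ne_zero x.1.im_pos.ne' (Complex.normSq_pos.2 (rotor_ne_zero _)).ne'

/-- The developing map with values in the projective space of binary cubics. -/
def cubicDev (x : UniversalCover) : RP3 :=
  Projectivization.mk ℝ (cubicMap (matVec x)) (cubicMap_ne_zero (vecDet_matVec_ne_zero x))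

lemma isLocalHomeomorph_cubicDev : IsLocalHomeomorph cubicDev := by
  refine isLocalHomeomorph_projMk (fun x => cubicMap_ne_zero (vecDet_matVec_ne_zero x)) ?_
  -- `cubicMap` is homogeneous of degree three, so the radial parameter is divided by `3`.
  let e : ℝ × UniversalCover ≃ₜ ℝ × UniversalCover :=
    (Homeomorph.mulRight₀ (1 / 3 : ℝ) (by norm_num)).prodCongr (Homeomorph.refl _)
  have h1 := isLocalHomeomorph_matVec.comp e.isLocalHomeomorph
  have h2 := isLocalHomeomorph_iff_isLocalHomeomorphOn_univ.2
    (isLocalHomeomorphOn_cubicMap.comp h1.isLocalHomeomorphOn fun p _ => by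
      change vecDet (Real.exp _ • _) ≠ 0
      rw [vecDet_smul]
      exact mul_ne_zero (by positivity) (vecDet_matVec_ne_zero _))
  convert h2 using 1
  funext p
  change _ = cubicMap (Real.exp (p.1 * (1 / 3)) • matVec p.2)
  rw [cubicMap_smul, ← Real.exp_nat_mul]
  congr 2
  push_cast
  ring

lemma vecDet_sl_ne_zero (g : SL(2, ℝ)) : vecDet ![g 0 0, g 0 1, g 1 0, g 1 1] ≠ 0 := by
  have : vecDet ![g 0 0, g 0 1, g 1 0, g 1 1] = 1 := sl_det g
  rw [this]
  exact one_ne_zero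

lemma cubicDev_equivariant (g : SL(2, ℝ)) (x y : UniversalCover)
    (h : fromCover x = g • fromCover y) :
    cubicDev x = pglOfLinearEquiv (symCubeEquiv (vecDet_sl_ne_zero g)) • cubicDev y := by
  obtain ⟨r, hr, h⟩ := exists_matVec_eq h
  rw [cubicDev, cubicDev, pglOfLinearEquiv_smul_mk, Projectivization.mk_eq_mk_iff']
  refine ⟨r ^ 3, ?_⟩
  rw [h, cubicMap_smul, symCubeEquiv_apply, ← cubicMap_vecMul]
  rfl

lemma cubicMap_vertical (z : ℍ) : cubicMap (matVec (z, Real.pi / 2)) =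
    ![z.im * (z.im ^ 2 - z.re ^ 2), -(2 * z.im * z.re), -z.im, 0] := by
  rw [matVec_of_vertical]
  ext i
  fin_cases i <;> simp [cubicMap]

/-! ### The vertical leaf of cubics is not convex -/

/-- The normalized product of two coordinates, as a function on projective space. -/
def coordProd : RP3 → ℝ :=
  Projectivization.lift (fun v => v.1 1 * v.1 2 / ∑ i, v.1 i ^ 2) (by
    rintro ⟨v, hv⟩ ⟨w, hw⟩ t (rfl : v = t • w)
    have ht : t ≠ 0 := fun h => hv (by simp [h])
    simp only [Pi.smul_apply, smul_eq_mul, mul_pow, ← Finset.mul_sum]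
    rw [show t * w 1 * (t * w 2) = t ^ 2 * (w 1 * w 2) by ring,
      mul_div_mul_left _ _ (pow_ne_zero 2 ht)])

lemma sum_sq_pos {v : Fin 4 → ℝ} (hv : v ≠ 0) : 0 < ∑ i, v i ^ 2 := by
  obtain ⟨i, hi⟩ := Function.ne_iff.1 hv
  have hi : v i ≠ 0 := hi
  exact Finset.sum_pos' (fun _ _ => sq_nonneg _) ⟨i, Finset.mem_univ _, by positivity⟩

lemma continuous_coordProd : Continuous coordProd := by
  rw [isQuotientMap_projMk.continuous_iff]
  change Continuous fun v : {v : Fin 4 → ℝ // v ≠ 0} => v.1 1 * v.1 2 / ∑ i, v.1 i ^ 2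
  have h (i : Fin 4) : Continuous fun v : {v : Fin 4 → ℝ // v ≠ 0} => v.1 i :=
    (continuous_apply i).comp continuous_subtype_val
  exact ((h 1).mul (h 2)).div (continuous_finsetSum _ fun i _ => (h i).pow 2)
    fun v => (sum_sq_pos v.2).ne'

/-- Up to the factor `-y`, the point over `x + i y` is `[x ^ 2 - y ^ 2 : 2 x : 1 : 0]`, so the leaf
develops onto the exterior of a parabola. The line where the first and third coordinates agree meets
it along `x ^ 2 - y ^ 2 = 1`, whose two branches are separated by the sign of `x`, and this is the
sign of `coordProd`. -/
lemma not_isProjConvex_cubicDev_leaf :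
    ¬ IsProjConvex (Set.range fun z : ℍ => cubicDev (z, Real.pi / 2)) := by
  intro h
  let φ : (Fin 4 → ℝ) →ₗ[ℝ] ℝ :=
    (LinearMap.proj 0 : (Fin 4 → ℝ) →ₗ[ℝ] ℝ) - (LinearMap.proj 2 : (Fin 4 → ℝ) →ₗ[ℝ] ℝ)
  let ψ : (Fin 4 → ℝ) →ₗ[ℝ] ℝ := LinearMap.proj 3
  have hlc := h _ (isProjLine_ker (φ := φ) (ψ := ψ) (u := ![1, 0, 0, 0]) (v := ![0, 0, 0, 1])
    (by simp [φ]) (by simp [ψ]) (by simp [φ]) (by simp [ψ]))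
  have hmem (z : ℍ) : cubicDev (z, Real.pi / 2) ∈ projSubspace (LinearMap.ker (φ.prod ψ)) ↔
      z.re ^ 2 - z.im ^ 2 = 1 := by
    rw [cubicDev, mk_mem_projSubspace, LinearMap.mem_ker, cubicMap_vertical]
    simp [φ, ψ]
    rw [show z.im * (z.im ^ 2 - z.re ^ 2) + z.im = -z.im * (z.re ^ 2 - z.im ^ 2 - 1) by ring,
      mul_eq_zero, or_iff_right (neg_ne_zero.2 z.im_pos.ne'), sub_eq_zero]
  have hval (z : ℍ) : ∃ c : ℝ, 0 < c ∧ coordProd (cubicDev (z, Real.pi / 2)) = c * z.re := by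
    refine ⟨2 * z.im ^ 2 / ∑ i, cubicMap (matVec (z, Real.pi / 2)) i ^ 2, ?_, ?_⟩
    · exact div_pos (mul_pos two_pos (pow_pos z.im_pos 2))
        (sum_sq_pos (cubicMap_ne_zero (vecDet_matVec_ne_zero _)))
    · rw [cubicDev, coordProd, Projectivization.lift_mk]
      change cubicMap _ 1 * cubicMap _ 2 / _ = _
      nth_rewrite 1 2 [cubicMap_vertical]
      simp only [Matrix.cons_val]
      ring
  -- One rational point on each branch, from the triple `3, 4, 5`.
  let zp : ℍ := ⟨⟨5 / 4, 3 / 4⟩, by norm_num⟩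
  let zm : ℍ := ⟨⟨-(5 / 4), 3 / 4⟩, by norm_num⟩
  have hp : (5 / 4 : ℝ) ^ 2 - (3 / 4) ^ 2 = 1 := by norm_num
  have hm : (-(5 / 4) : ℝ) ^ 2 - (3 / 4) ^ 2 = 1 := by norm_num
  obtain ⟨c, hc, hcp⟩ := hval zp
  obtain ⟨d, hd, hdm⟩ := hval zm
  have hcp : coordProd (cubicDev (zp, Real.pi / 2)) = c * (5 / 4) := hcp
  have hdm : coordProd (cubicDev (zm, Real.pi / 2)) = d * (-(5 / 4)) := hdm
  obtain ⟨_, ⟨⟨z, rfl⟩, hz⟩, h0⟩ := hlc.intermediate_value ⟨⟨zm, rfl⟩, (hmem zm).2 hm⟩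
    ⟨⟨zp, rfl⟩, (hmem zp).2 hp⟩ continuous_coordProd.continuousOn
    (⟨by rw [hdm]; linarith, by rw [hcp]; positivity⟩ :
      (0 : ℝ) ∈ Set.Icc (coordProd (cubicDev (zm, Real.pi / 2)))
        (coordProd (cubicDev (zp, Real.pi / 2))))
  obtain ⟨e, he, hez⟩ := hval z
  dsimp only at h0
  rw [hez] at h0
  have h1 := (mul_eq_zero.1 h0).resolve_left he.ne'
  have h2 := (hmem z).1 hz
  rw [h1] at h2
  nlinarith [sq_nonneg z.im]

section CubicStructure

variable {Γ : Subgroup PSL(2, ℝ)} {g : ℕ}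

lemma exists_not_convex (hΓ : IsClosedSurfaceGroup Γ g) :
    ∃ c : FoliatedModuli Γ, c ∉ ConvexFoliatedModuli Γ := by
  obtain ⟨S, hS⟩ :=
    exists_structure_of_equivariant hΓ isLocalHomeomorph_cubicDev cubicDev_equivariant
  have hfol : IsFoliatedDevelopingMap S cubicDev := by
    refine isFoliatedDevelopingMap_of_equivariant hS cubicDev_equivariant
      (isProjLine_ker (φ := LinearMap.proj 1) (ψ := LinearMap.proj 3)
        (u := ![0, 1, 0, 0]) (v := ![0, 0, 0, 1]) rfl rfl rfl rfl) (fun t => ?_)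
      (isProjPlane_ker (φ := LinearMap.proj 3) (fun h => ?_)) fun z => ?_
    · rw [cubicDev, mk_mem_projSubspace, LinearMap.mem_ker, cubicMap_vertical]
      refine Prod.ext ?_ rfl
      change -(2 * _ * (verticalVelocity t).1.1.re) = 0
      rw [← UpperHalfPlane.coe_re, coe_verticalVelocity]
      simp [-Complex.ofReal_exp]
    · simpa using congrArg (fun f => f ![0, 0, 0, 1]) h
    · rw [cubicDev, mk_mem_projSubspace, LinearMap.mem_ker, cubicMap_vertical]
      rfl
  refine ⟨Quotient.mk (foliatedSetoid Γ) ⟨S, _, hfol⟩, ?_⟩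
  rintro ⟨T, ⟨E, hE, hEc⟩, hT⟩
  obtain ⟨p, y, hp⟩ := exists_image_leaf_eq hΓ ((foliatedSetoid Γ).symm (Quotient.exact hT))
    hS hE.1 baseCover
  obtain ⟨k, hk⟩ := exists_image_stableLeaf_eq cubicDev_equivariant baseCover
  apply not_isProjConvex_cubicDev_leaf
  have : (Set.range fun z : ℍ => cubicDev (z, Real.pi / 2)) =
      (k⁻¹ • ·) '' ((p • ·) '' (E '' liftedLeaf stableLeaf y)) := by
    rw [← hp, hk, Set.image_image]
    simp
  rw [this]
  exact ((hEc y).smul p).smul k⁻¹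

end CubicStructure

/-! ## Equivariant functions on the hyperbolic plane -/

/-- Positive rank gives an element of infinite order. The map from its span to `ℝ` extends because
divisible groups are injective. -/
lemma exists_addMonoidHom_apply_eq_one {A : Type*} [AddCommGroup A]
    (h : 0 < Module.finrank ℤ A) : ∃ (f : A →+ ℝ) (a : A), f a = 1 := by
  have hr : Module.rank ℤ A ≠ 0 := fun h0 => by simp [Module.finrank, h0] at h
  rw [Ne, rank_eq_zero_iff] at hr
  push Not at hr
  obtain ⟨a, ha⟩ := hr
  have hinj : Function.Injective (LinearMap.toSpanSingleton ℤ A a) := by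
    rw [← LinearMap.ker_eq_bot, LinearMap.ker_eq_bot']
    intro n hn
    by_contra hn0
    exact ha n hn0 hn
  obtain ⟨f, hf⟩ := (Module.Baer.of_divisible ℝ).extension_property
    (LinearMap.toSpanSingleton ℤ A a) hinj (LinearMap.toSpanSingleton ℤ ℝ 1)
  refine ⟨f.toAddMonoidHom, a, ?_⟩
  have := LinearMap.congr_fun hf 1
  simpa using this

lemma exists_character {Γ : Subgroup PSL(2, ℝ)} {g : ℕ} (hg : 0 < g)
    (hΓ : IsClosedSurfaceGroup Γ g) : ∃ (ϑ : Γ → ℝ) (γ₀ : Γ),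
      (∀ γ δ, ϑ (γ * δ) = ϑ γ + ϑ δ) ∧ ϑ γ₀ = 1 := by
  obtain ⟨f, a, ha⟩ := exists_addMonoidHom_apply_eq_one
    (A := Additive (Abelianization Γ)) (by rw [hΓ.genus]; omega)
  obtain ⟨γ₀, hγ₀⟩ := QuotientGroup.mk_surjective (Additive.toMul a)
  refine ⟨fun γ => f (Additive.ofMul (Abelianization.of γ)), γ₀, fun γ δ => ?_, ?_⟩
  · simp only [map_mul, ofMul_mul, map_add]
  · rw [← ha]
    exact congrArg (fun b => f (Additive.ofMul b)) hγ₀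

/-! ### Averaging over the group -/

/-- A cut-off function on the hyperbolic plane. -/
def bump (n : ℕ) (z : ℍ) : ℝ := max 0 (n - dist z UpperHalfPlane.I)

lemma continuous_bump (n : ℕ) : Continuous (bump n) := by
  unfold bump
  fun_prop

lemma bump_nonneg (n : ℕ) (z : ℍ) : 0 ≤ bump n z := le_max_left _ _

lemma bump_ne_zero_iff {n : ℕ} {z : ℍ} :
    bump n z ≠ 0 ↔ z ∈ Metric.ball UpperHalfPlane.I (n : ℝ) := by
  rw [bump, Metric.mem_ball, ← (le_max_left _ _ : (0 : ℝ) ≤ max 0 _).lt_iff_ne', lt_max_iff]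
  simp

section Average

variable {Γ : Subgroup PSL(2, ℝ)} {g : ℕ} (hΓ : IsClosedSurfaceGroup Γ g)
include hΓ

lemma exists_ball_cover :
    ∃ n : ℕ, ∀ z : ℍ, ∃ γ : Γ, γ⁻¹ • z ∈ Metric.ball UpperHalfPlane.I (n : ℝ) := by
  have := hΓ.cocompact
  let q : ℍ → MulAction.orbitRel.Quotient Γ ℍ := Quotient.mk _
  have ho : IsOpenMap q := isOpenMap_quotient_mk'_mul (Γ := Γ) (T := ℍ)
  obtain ⟨n, hn⟩ := isCompact_univ.elim_directed_cover
    (fun n : ℕ => q '' Metric.ball UpperHalfPlane.I (n : ℝ))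
    (fun n => ho _ Metric.isOpen_ball) (fun x _ => by
      obtain ⟨z, rfl⟩ := Quotient.mk_surjective x
      obtain ⟨n, hn⟩ := exists_nat_gt (dist z UpperHalfPlane.I)
      exact Set.mem_iUnion.2 ⟨n, z, hn, rfl⟩)
    (directed_of_isDirected_le fun m n hmn =>
      Set.image_mono (Metric.ball_subset_ball (by exact_mod_cast hmn)))
  refine ⟨n, fun z => ?_⟩
  obtain ⟨w, hw, hwz⟩ := hn (Set.mem_univ (q z))
  obtain ⟨γ, rfl⟩ := Quotient.exact hwz
  refine ⟨γ⁻¹, ?_⟩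
  rw [inv_inv]
  exact hw

lemma locallyFinite_bump (n : ℕ) (c : Γ → ℝ) :
    LocallyFinite fun γ : Γ => Function.support fun z : ℍ => c γ * bump n (γ⁻¹ • z) := by
  have := hΓ.properlyDiscontinuous
  intro z
  refine ⟨Metric.closedBall z 1, Metric.closedBall_mem_nhds z one_pos, ?_⟩
  refine (ProperlyDiscontinuousSMul.finite_disjoint_inter_image (Γ := Γ)
    (isCompact_closedBall UpperHalfPlane.I (n : ℝ)) (isCompact_closedBall z 1)).subset ?_
  rintro γ ⟨w, hw, hwz⟩
  have h1 := bump_ne_zero_iff.1 (right_ne_zero_of_mul hw)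
  exact
    ⟨w, ⟨γ⁻¹ • w, Metric.ball_subset_closedBall h1, smul_inv_smul γ w⟩, hwz⟩

lemma finite_support_bump (n : ℕ) (c : Γ → ℝ) (z : ℍ) :
    (Function.support fun γ : Γ => c γ * bump n (γ⁻¹ • z)).Finite :=
  (locallyFinite_bump hΓ n c).point_finite z

/-- Take the average of `ϑ γ` with weights `bump n (γ⁻¹ • z)`. The sums are locally finite by proper
discontinuity, and the total weight is positive by cocompactness. Reindexing by `γ ↦ δ * γ` adds `ϑ
δ` to the average. -/
lemma exists_equivariant_function {ϑ : Γ → ℝ} (hϑ : ∀ γ δ, ϑ (γ * δ) = ϑ γ + ϑ δ) :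
    ∃ u : ℍ → ℝ, Continuous u ∧ ∀ (γ : Γ) z, u (γ • z) = u z + ϑ γ := by
  obtain ⟨n, hn⟩ := exists_ball_cover hΓ
  let A (c : Γ → ℝ) (z : ℍ) : ℝ := ∑ᶠ γ : Γ, c γ * bump n (γ⁻¹ • z)
  have hA (c : Γ → ℝ) : Continuous (A c) :=
    continuous_finsum (fun γ => continuous_const.mul
      ((continuous_bump n).comp (continuous_const_smul γ⁻¹))) (locallyFinite_bump hΓ n c)
  have hsmul (c : Γ → ℝ) (δ : Γ) (z : ℍ) : A c (δ • z) = A (fun γ => c (δ * γ)) z := by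
    change ∑ᶠ γ : Γ, _ = _
    rw [← finsum_comp_equiv (Equiv.mulLeft δ)]
    refine finsum_congr fun γ => ?_
    rw [Equiv.coe_mulLeft, mul_inv_rev, mul_smul, inv_smul_smul]
  have hpos (z : ℍ) : 0 < A 1 z := by
    obtain ⟨γ, hγ⟩ := hn z
    refine finsum_pos (fun γ => ?_) ⟨γ, ?_⟩ (finite_support_bump hΓ n 1 z)
    · simpa using bump_nonneg n _
    · simpa using (bump_nonneg n _).lt_of_ne' (bump_ne_zero_iff.2 hγ)
  refine ⟨fun z => A ϑ z / A 1 z, (hA _).div (hA _) fun z => (hpos z).ne', fun δ z => ?_⟩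
  have h1 : A 1 (δ • z) = A 1 z := hsmul 1 δ z
  have h2 : A ϑ (δ • z) = ϑ δ * A 1 z + A ϑ z := by
    rw [hsmul]
    change ∑ᶠ γ : Γ, _ = ϑ δ * (∑ᶠ γ : Γ, _) + ∑ᶠ γ : Γ, _
    rw [mul_finsum, ← finsum_add_distrib _ (finite_support_bump hΓ n ϑ z)]
    · refine finsum_congr fun γ => ?_
      simp only [hϑ, Pi.one_apply]
      ring
    · simpa [Function.HasFiniteSupport] using (finite_support_bump hΓ n (fun _ => ϑ δ) z)
  change A ϑ (δ • z) / A 1 (δ • z) = A ϑ z / A 1 z + ϑ δ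
  rw [h1, h2, add_div, mul_div_cancel_right₀ _ (hpos z).ne', add_comm]

end Average

/-! ## There is no continuous injection of an open disc into the line -/

/-- The one-dimensional Borsuk–Ulam argument on a small circle: the difference of the values at
antipodal points changes sign after a half turn, so it vanishes somewhere. -/
lemma not_injOn_of_mem_nhds {s : Set ℂ} {z : ℂ} (hs : s ∈ 𝓝 z) {f : ℂ → ℝ}
    (hf : ContinuousOn f s) : ¬ s.InjOn f := by
  intro hi
  obtain ⟨r, hr, hrs⟩ := Metric.nhds_basis_closedBall.mem_iff.1 hs
  let c (t : ℝ) : ℂ := circleMap z r t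
  have hc (t : ℝ) : c t ∈ s := hrs (circleMap_mem_closedBall z hr.le t)
  have hfc : Continuous fun t => f (c t) :=
    hf.comp_continuous (continuous_circleMap z r) hc
  have hpi (t : ℝ) : c (t + Real.pi) = z - r * Complex.exp (t * Complex.I) := by
    simp only [c, circleMap]
    push_cast
    rw [add_mul, Complex.exp_add, Complex.exp_pi_mul_I]
    ring
  have hne (t : ℝ) : f (c t) ≠ f (c (t + Real.pi)) := fun h => by
    have := hi (hc _) (hc _) h
    rw [hpi] at this
    simp only [c, circleMap] at this
    have h2 : (r : ℂ) * Complex.exp (t * Complex.I) = 0 := by linear_combination this / 2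
    exact mul_ne_zero (by exact_mod_cast hr.ne') (Complex.exp_ne_zero _) h2
  let k (t : ℝ) : ℝ := f (c t) - f (c (t + Real.pi))
  have hk : Continuous k := hfc.sub (hfc.comp (continuous_id.add continuous_const))
  have hk0 : k Real.pi = -k 0 := by
    have : c (Real.pi + Real.pi) = c 0 := by
      rw [← two_mul, ← zero_add (2 * Real.pi)]
      exact periodic_circleMap z r 0
    simp only [k, this, zero_add]
    ring
  obtain ⟨t, ht⟩ : (0 : ℝ) ∈ Set.range k := by
    rcases le_total 0 (k 0) with h | h
    · exact mem_range_of_exists_le_of_exists_ge hk ⟨Real.pi, by linarith⟩ ⟨0, h⟩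
    · exact mem_range_of_exists_le_of_exists_ge hk ⟨0, h⟩ ⟨Real.pi, by linarith⟩
  exact hne t (sub_eq_zero.1 ht)

lemma upperHalfPlane_not_injOn_of_mem_nhds {s : Set ℍ} {z : ℍ} (hs : s ∈ 𝓝 z) {f : ℍ → ℝ}
    (hf : ContinuousOn f s) : ¬ s.InjOn f := by
  intro hi
  have ho := UpperHalfPlane.isOpenEmbedding_coe
  have hinv (w : ℍ) : UpperHalfPlane.ofComplex (w : ℂ) = w := UpperHalfPlane.ofComplex_apply w
  refine not_injOn_of_mem_nhds (s := UpperHalfPlane.coe '' s) (z := z)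
    (f := f ∘ UpperHalfPlane.ofComplex) (ho.isOpenMap.image_mem_nhds hs) ?_ ?_
  · rintro _ ⟨w, hw, rfl⟩
    refine ContinuousWithinAt.comp (t := s) ?_ ?_ ?_
    · rw [hinv]
      exact hf w hw
    · refine (UpperHalfPlane.ofComplex.continuousAt ?_).continuousWithinAt
      simpa [UpperHalfPlane.ofComplex] using w.im_pos
    · rintro _ ⟨v, hv, rfl⟩
      rwa [hinv]
  · rintro _ ⟨v, hv, rfl⟩ _ ⟨w, hw, rfl⟩ h
    simp only [Function.comp_apply, hinv] at h
    rw [hi hv hw h]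

/-- No continuous map from a neighborhood in the plane to a projective line is injective. -/
lemma not_injOn_mk_of_finrank_le_two {V : Submodule ℝ (Fin 4 → ℝ)} (hV : Module.finrank ℝ V ≤ 2)
    {s : Set ℍ} {z : ℍ} (hs : s ∈ 𝓝 z) {G : ℍ → Fin 4 → ℝ} (hG : Continuous G)
    (hG0 : ∀ w, G w ≠ 0) (hGV : ∀ w, G w ∈ V) :
    ¬ s.InjOn fun w => (Projectivization.mk ℝ (G w) (hG0 w) : RP3) := by
  intro hi
  obtain ⟨e, he⟩ : ∃ e : V →ₗ[ℝ] (Fin 2 → ℝ), Function.Injective e :=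
    finrank_le_iff_exists_linearMap.1 (by simpa using hV)
  obtain ⟨Q, hQ⟩ := e.exists_extend
  have hQV {v : Fin 4 → ℝ} (hv : v ∈ V) (h : Q v = 0) : v = 0 := by
    have h1 : e ⟨v, hv⟩ = 0 := by rw [← hQ]; exact h
    exact congrArg Subtype.val (he (h1.trans (map_zero e).symm))
  have hQc : Continuous Q := Q.continuous_of_finiteDimensional
  obtain ⟨i, hi0⟩ : ∃ i, Q (G z) i ≠ 0 := by
    by_contra! h
    exact hG0 z (hQV (hGV z) (funext h))
  have hc (j : Fin 2) : Continuous fun w => Q (G w) j :=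
    (continuous_apply j).comp (hQc.comp hG)
  have hi' : ∀ j : Fin 2, j = i ∨ j = 1 - i := by fin_cases i <;> simp [Fin.forall_fin_two]
  -- The ratio of the two coordinates is an affine coordinate of the projective line near the image
  -- of `z`, so it would be an injective real function.
  refine upperHalfPlane_not_injOn_of_mem_nhds (z := z)
    (inter_mem hs ((hc i).continuousAt.eventually_ne hi0))
    (f := fun w => Q (G w) (1 - i) / Q (G w) i) ?_ ?_
  · exact (hc _).continuousOn.div (hc _).continuousOn fun w hw => hw.2
  · rintro v ⟨hv, hv0⟩ w ⟨hw, hw0⟩ h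
    change Q (G v) i ≠ 0 at hv0
    change Q (G w) i ≠ 0 at hw0
    dsimp only at h
    rw [div_eq_div_iff hv0 hw0] at h
    refine hi hv hw ((Projectivization.mk_eq_mk_iff' ℝ _ _ _ _).2 ⟨Q (G v) i / Q (G w) i, ?_⟩)
    rw [← sub_eq_zero]
    refine hQV (V.sub_mem (V.smul_mem _ (hGV w)) (hGV v)) (funext fun j => ?_)
    simp only [map_sub, map_smul, Pi.sub_apply, Pi.smul_apply, smul_eq_mul, Pi.zero_apply]
    rcases hi' j with rfl | rfl
    · field_simp
      ring
    · field_simp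
      linear_combination -h

/-! ## The twisted structure -/

/-- Multiplication by a non-real `d` has no real eigenvalue, on the dual space either: the relation
`d ^ 2 = 2 (Re d) d - |d| ^ 2` gives `((μ - Re d) ^ 2 + (Im d) ^ 2) ψ = 0`. -/
lemma eq_zero_of_comp_mul_eq_smul {ψ : ℂ →ₗ[ℝ] ℝ} {d : ℂ} (hd : d.im ≠ 0) {μ : ℝ}
    (h : ∀ w, ψ (d * w) = μ * ψ w) : ψ = 0 := by
  ext w
  have h1 : ψ (d * (d * w)) = μ * (μ * ψ w) := by rw [h, h]
  have h2 : d * (d * w) = (2 * d.re) • (d * w) - (d.re ^ 2 + d.im ^ 2) • w := by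
    apply Complex.ext <;> simp [-Complex.ofReal_pow] <;> ring
  rw [h2, map_sub, map_smul, map_smul, h, smul_eq_mul, smul_eq_mul] at h1
  have h3 : ((μ - d.re) ^ 2 + d.im ^ 2) * ψ w = 0 := by linear_combination -h1
  exact (mul_eq_zero.1 h3).resolve_left (by positivity)

lemma twistEquiv_apply (g : SL(2, ℝ)) (c : ℂˣ) (p : ℂ × ℂ) : twistEquiv g c p =
    ((c * (g 0 0 * p.1 + g 0 1 * p.2), c * (g 1 0 * p.1 + g 1 1 * p.2)) : ℂ × ℂ) := rfl

lemma twistEquiv_twistEquiv (g h : SL(2, ℝ)) (c d : ℂˣ) (p : ℂ × ℂ) :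
    twistEquiv g c (twistEquiv h d p) = twistEquiv (g * h) (c * d) p := by
  simp only [twistEquiv_apply, Matrix.SpecialLinearGroup.coe_mul, Matrix.mul_apply,
    Fin.sum_univ_two, Units.val_mul]
  push_cast
  ext1 <;> ring

/-- A matrix with a real eigenvalue times a non-real number has no real invariant hyperplane. -/
lemma eq_zero_of_comp_twistEquiv {g b : SL(2, ℝ)} (hb : b 1 0 = 0) {c : ℂˣ} (hc : (c : ℂ).im ≠ 0)
    {φ : (ℂ × ℂ) →ₗ[ℝ] ℝ} {μ : ℝ} (h : ∀ p, φ (twistEquiv (g * b * g⁻¹) c p) = μ * φ p) :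
    φ = 0 := by
  have hdet : b 0 0 * b 1 1 = 1 := by simpa [hb] using sl_det b
  have h0 : b 0 0 ≠ 0 := left_ne_zero_of_mul_eq_one hdet
  have h1 : b 1 1 ≠ 0 := right_ne_zero_of_mul_eq_one hdet
  let G := twistEquiv g 1
  have hcomp (p : ℂ × ℂ) : twistEquiv (g * b * g⁻¹) c (G p) = G (twistEquiv b c p) := by
    rw [twistEquiv_twistEquiv, twistEquiv_twistEquiv, inv_mul_cancel_right, mul_one, one_mul]
  have hφ (p : ℂ × ℂ) : φ (G (twistEquiv b c p)) = μ * φ (G p) := by rw [← hcomp, h]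
  -- The first factor is invariant under the triangular matrix, which acts there by the non-real
  -- number `c * b 0 0`.
  have hl : φ ∘ₗ G.toLinearMap ∘ₗ LinearMap.inl ℝ ℂ ℂ = 0 := by
    refine eq_zero_of_comp_mul_eq_smul (d := c * b 0 0) (μ := μ) (by simp [hc, h0]) fun w => ?_
    have := hφ (w, 0)
    rw [twistEquiv_apply b, hb] at this
    simpa [mul_assoc] using this
  -- Modulo the first factor, where the functional already vanishes, the action is multiplication by
  -- `c * b 1 1`.
  have hr : φ ∘ₗ G.toLinearMap ∘ₗ LinearMap.inr ℝ ℂ ℂ = 0 := by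
    refine eq_zero_of_comp_mul_eq_smul (d := c * b 1 1) (μ := μ) (by simp [hc, h1]) fun w => ?_
    have h2 : φ (G (c * (b 0 1 * w), 0)) = 0 := LinearMap.congr_fun hl _
    have h3 := hφ (0, w)
    have h4 : twistEquiv b c (0, w) = ((c * (b 0 1 * w), 0) : ℂ × ℂ) + ((0, c * b 1 1 * w) : ℂ × ℂ) := by
      rw [twistEquiv_apply, hb]
      ext1 <;> simp [mul_assoc]
    rw [h4, map_add, map_add, h2, zero_add] at h3
    exact h3
  have hG : φ ∘ₗ G.toLinearMap = 0 := LinearMap.prod_ext hl hr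
  refine LinearMap.ext fun p => ?_
  simpa using LinearMap.congr_fun hG (G.symm p)

/-- Otherwise `W` would be invariant, and a functional with kernel `W` would be an eigenvector of
the transpose, contrary to `eq_zero_of_comp_twistEquiv`. -/
lemma finrank_inf_comap_holEquiv_le {g b : SL(2, ℝ)} (hb : b 1 0 = 0) {α : ℝ}
    (hα : Real.sin (α / 2) ≠ 0) {W : Submodule ℝ (Fin 4 → ℝ)} (hW : Module.finrank ℝ W = 3) :
    Module.finrank ℝ
      ↥(W ⊓ W.comap (holEquiv (g * b * g⁻¹) α).toLinearMap) ≤ 2 := by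
  set A := holEquiv (g * b * g⁻¹) α with hA
  have hlt : W ⊓ W.comap A.toLinearMap < W := by
    refine inf_le_left.lt_of_ne fun heq => ?_
    have hinv : ∀ v ∈ W, A v ∈ W := fun v hv => inf_eq_left.1 heq hv
    have htop : W < ⊤ := by
      refine lt_top_iff_ne_top.2 fun h => ?_
      rw [h, finrank_top] at hW
      simp at hW
    obtain ⟨φ, hφ0, hφ⟩ := W.exists_le_ker_of_lt_top htop
    have hker : LinearMap.ker φ = W := by
      refine (Submodule.eq_of_le_of_finrank_eq hφ ?_).symm
      have := Module.Dual.finrank_ker_add_one_of_ne_zero (f := φ) hφ0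
      simp at this
      omega
    obtain ⟨v₀, hv₀⟩ := LinearMap.surjective hφ0 1
    -- `φ ∘ A` vanishes on the kernel of `φ`, so it is a multiple of `φ`, with factor read off at
    -- `v₀`.
    have hμ (v : Fin 4 → ℝ) : φ (A v) = φ (A v₀) * φ v := by
      have h1 : v - φ v • v₀ ∈ W := by
        rw [← hker, LinearMap.mem_ker, map_sub, map_smul, hv₀, smul_eq_mul, mul_one, sub_self]
      have h2 := hφ (hinv _ h1)
      rw [LinearMap.mem_ker, map_sub, map_sub, map_smul, map_smul, sub_eq_zero] at h2
      rw [h2, smul_eq_mul, mul_comm]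
    have h0 : φ ∘ₗ pairEquiv.toLinearMap = 0 := by
      refine eq_zero_of_comp_twistEquiv (g := g) hb (c := halfRotation α) (μ := φ (A v₀)) ?_
        fun p => ?_
      · rw [halfRotation, Units.val_mk0, Complex.exp_ofReal_mul_I_im, neg_div, Real.sin_neg]
        exact neg_ne_zero.2 hα
      · have := hμ (pairEquiv p)
        have h3 : A (pairEquiv p) =
            pairEquiv (twistEquiv (g * b * g⁻¹) (halfRotation α) p) := by
          rw [hA, holEquiv]
          simp
        rwa [h3] at this
    refine hφ0 (LinearMap.ext fun v => ?_)
    simpa using LinearMap.congr_fun h0 (pairEquiv.symm v)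
  have := Submodule.finrank_lt_finrank_of_lt hlt
  omega

/-- An element of `SL(2, ℝ)` without fixed points in the hyperbolic plane is conjugate to an upper
triangular one. -/
lemma exists_conj_upperTriangular {m : SL(2, ℝ)} (hm : ∀ z : ℍ, m • z ≠ z) :
    ∃ g b : SL(2, ℝ), m = g * b * g⁻¹ ∧ b 1 0 = 0 := by
  suffices h : ∃ g : SL(2, ℝ), (g⁻¹ * (m * g)) 1 0 = 0 by
    obtain ⟨g, hg⟩ := h
    exact ⟨g, g⁻¹ * (m * g), by group, hg⟩
  have hmg (g : SL(2, ℝ)) : (g⁻¹ * (m * g)) 1 0 = g 0 0 * (m 1 0 * g 0 0 + m 1 1 * g 1 0) -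
      g 1 0 * (m 0 0 * g 0 0 + m 0 1 * g 1 0) := by
    rw [inv_mul_apply_one_zero]
    simp [Matrix.mul_apply, Fin.sum_univ_two]
  have hdet := sl_det m
  by_cases hc : m 1 0 = 0
  · exact ⟨1, by simp [hc]⟩
  -- `D` is the discriminant of the fixed point equation of the Möbius transformation. A real root
  -- `t` gives the eigenvector `(t, 1)`, taken as first column of `g`. If `D < 0`, the root with
  -- positive imaginary part is a fixed point in `ℍ`.
  · set D := (m 0 0 + m 1 1) ^ 2 - 4 with hD
    rcases le_or_gt 0 D with h | h
    · let t := (m 0 0 - m 1 1 + √D) / (2 * m 1 0)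
      let g : SL(2, ℝ) := ⟨!![t, -1; 1, 0], by simp [Matrix.det_fin_two_of]⟩
      have h0 : g 0 0 = t := rfl
      have h1 : g 1 0 = 1 := rfl
      refine ⟨g, ?_⟩
      have hs := Real.sq_sqrt h
      rw [hmg, h0, h1]
      simp only [t]
      field_simp
      linear_combination hs + hD + 4 * hdet
    · exfalso
      let s : ℝ := √(-D) / (2 * |m 1 0|)
      have hs : 0 < s := by
        have := Real.sqrt_pos.2 (neg_pos.2 h)
        positivity
      have hs2 : s ^ 2 * (2 * m 1 0) ^ 2 = -D := by
        have := Real.sq_sqrt (neg_pos.2 h).le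
        simp only [s]
        rw [div_pow, mul_pow, sq_abs, this]
        field_simp
      let z : ℍ := ⟨⟨(m 0 0 - m 1 1) / (2 * m 1 0), s⟩, hs⟩
      apply hm z
      apply UpperHalfPlane.ext
      rw [coe_sl_smul, div_eq_iff (slDenom_ne_zero _ _)]
      apply Complex.ext
      · simp [slDenom, z]
        field_simp
        linear_combination hs2 + hD - 4 * hdet
      · simp [slDenom, z]
        field_simp
        ring

/-- Möbius transformations are conformal, so they commute with rotating all tangent vectors by the
same angle. -/
lemma fromCover_shiftAngle_eq_smul {γ : PSL(2, ℝ)} {x y : UniversalCover}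
    (h : fromCover x = γ • fromCover y) (a : ℝ) :
    fromCover (shiftAngle a x) = γ • fromCover (shiftAngle a y) := by
  induction γ using QuotientGroup.induction_on with | H g =>
  change fromCover x = g • fromCover y at h
  change _ = g • fromCover _
  rw [← fromCover_liftSL, fromCover_eq_iff] at h ⊢
  obtain ⟨h1, n, h2⟩ := h
  refine ⟨h1, n, ?_⟩
  change x.2 = y.2 - 2 * _ + _ at h2
  change x.2 + a = y.2 + a - 2 * _ + _
  rw [h2]
  change _ = y.2 + a - 2 * Complex.arg (slDenom g y.1) + _
  ring

/-! ### Twisting the developing map by an equivariant angle -/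

/-- The rotation of the fibers of the unit tangent bundle by an angle that depends on the
base point. -/
def fiberRotation {u : ℍ → ℝ} (hu : Continuous u) : UniversalCover ≃ₜ UniversalCover where
  toFun x := (x.1, x.2 + u x.1)
  invFun x := (x.1, x.2 - u x.1)
  left_inv x := by simp
  right_inv x := by simp
  continuous_toFun := continuous_fst.prodMk (continuous_snd.add (hu.comp continuous_fst))
  continuous_invFun := continuous_fst.prodMk (continuous_snd.sub (hu.comp continuous_fst))

/-- The developing map of the twisted structure. -/
def twistedDev {u : ℍ → ℝ} (hu : Continuous u) : UniversalCover → RP3 := matDev ∘ fiberRotation hu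

lemma isLocalHomeomorph_twistedDev {u : ℍ → ℝ} (hu : Continuous u) :
    IsLocalHomeomorph (twistedDev hu) :=
  isLocalHomeomorph_matDev.comp (fiberRotation hu).isLocalHomeomorph

/-- The rotation `u y.1` commutes with the isometry. Only the constant increment `a` of `u` remains,
and it enters the holonomy as a right rotation. -/
lemma twistedDev_eq_smul {u : ℍ → ℝ} (hu : Continuous u) {m : SL(2, ℝ)} {a : ℝ}
    (hm : ∀ z : ℍ, u ((QuotientGroup.mk m : PSL(2, ℝ)) • z) = u z + a) {x y : UniversalCover}
    (h : fromCover x = (QuotientGroup.mk m : PSL(2, ℝ)) • fromCover y) :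
    twistedDev hu x = pglOfLinearEquiv (holEquiv m a) • twistedDev hu y := by
  have h1 : x.1 = (QuotientGroup.mk m : PSL(2, ℝ)) • y.1 := by
    have := congrArg (fun x : UnitTangentH => x.1.1) h
    exact this.trans (psl_smul_unitTangentH_fst _ _)
  have h2 := matDev_shiftAngle (fromCover_shiftAngle_eq_smul h (u y.1)) a
  have h3 : fiberRotation hu x = shiftAngle a (shiftAngle (u y.1) x) := by
    change (x.1, x.2 + u x.1) = (x.1, x.2 + u y.1 + a)
    rw [h1, hm, add_assoc]
  rw [twistedDev, Function.comp_apply, h3]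
  exact h2

section TwistedStructure

variable {Γ : Subgroup PSL(2, ℝ)} {g : ℕ}

lemma exists_twisted_structure (hΓ : IsClosedSurfaceGroup Γ g) {ϑ : Γ → ℝ} {u : ℍ → ℝ}
    (hu : Continuous u) (hϑ : ∀ (γ : Γ) z, u (γ • z) = u z + ϑ γ) :
    ∃ S : ProjectiveStructure (UnitTangent Γ), IsDevelopingMap S (twistedDev hu) := by
  refine ⟨.ofDev (isCoveringMap_coverMap hΓ).isLocalHomeomorph surjective_coverMap
    (isLocalHomeomorph_twistedDev hu) ?_, isDevelopingAlong_ofDev _ _ _ _⟩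
  intro x y hxy
  obtain ⟨γ, hγ, h⟩ := exists_eventually_fromCover_eq hΓ hxy
  obtain ⟨m, rfl⟩ := QuotientGroup.mk_surjective γ
  refine ⟨pglOfLinearEquiv (holEquiv m (ϑ ⟨_, hγ⟩)), ?_⟩
  filter_upwards [h] with p hp hpq
  exact twistedDev_eq_smul hu (hϑ ⟨_, hγ⟩) (hp hpq)

/-- A lift of an upper triangular matrix that preserves the leaf of vertical vectors. -/
lemma exists_isLift_vertical {b : SL(2, ℝ)} (hb : b 1 0 = 0) :
    ∃ f, IsLift (QuotientGroup.mk b) f ∧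
      ∀ z : ℍ, f (z, Real.pi / 2) = (b • z, Real.pi / 2) := by
  have hd (z : ℍ) : slDenom b z = (b 1 1 : ℝ) := by simp [slDenom, hb]
  rcases le_or_gt 0 (b 1 1) with h | h
  · refine ⟨liftSL b, isLift_liftSL b, fun z => Prod.ext rfl ?_⟩
    change Real.pi / 2 - 2 * Complex.arg (slDenom b z) = _
    rw [hd, Complex.arg_ofReal_of_nonneg h]
    ring
  -- The negative denominator has argument `π`, which lowers the angle by `2 π`; the shift undoes
  -- this.
  · refine ⟨shiftAngle ((1 : ℤ) * (2 * Real.pi)) * liftSL b, ?_, fun z => Prod.ext rfl ?_⟩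
    · simpa using (isLift_shiftAngle 1).mul (isLift_liftSL b)
    · change Real.pi / 2 - 2 * Complex.arg (slDenom b z) + (1 : ℤ) * (2 * Real.pi) = _
      rw [hd, Complex.arg_ofReal_of_neg h]
      push_cast
      ring

/-- The twisted developing map, composed with an equivariant homeomorphism, does not map all
weakly stable leaves into projective planes. -/
lemma not_exists_isProjPlane_twistedDev {u : ℍ → ℝ} (hu : Continuous u) {m : SL(2, ℝ)}
    (hm : ∀ z : ℍ, m • z ≠ z)
    (hum : ∀ z : ℍ, u ((QuotientGroup.mk m : PSL(2, ℝ)) • z) = u z + 1)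
    {k : UniversalCover ≃ₜ UniversalCover}
    (hk : ∀ f, IsLift (QuotientGroup.mk m) f → ∀ x, k (f x) = f (k x)) :
    ∃ x, ¬ ∃ P, IsProjPlane P ∧ (twistedDev hu ∘ k) '' liftedLeaf stableLeaf x ⊆ P := by
  obtain ⟨g, b, rfl, hb⟩ := exists_conj_upperTriangular hm
  obtain ⟨β, hβ, hβz⟩ := exists_isLift_vertical hb
  let f := liftSL g
  have hf := isLift_liftSL g
  let ι (z : ℍ) : UniversalCover := k (f (z, Real.pi / 2))
  have hlift : IsLift (QuotientGroup.mk (g * b * g⁻¹)) (f * β * f⁻¹) := (hf.mul hβ).mul hf.inv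
  -- The lift of `g * b * g⁻¹` preserves the image under `k` of this leaf and acts on its parameter
  -- `z` by `b`.
  have hι (z : ℍ) : (f * β * f⁻¹) (ι z) = ι (b • z) := by
    rw [← hk _ hlift]
    change k (f (β (f.symm (f _)))) = _
    rw [f.symm_apply_apply, hβz]
  refine ⟨f baseCover, ?_⟩
  rintro ⟨_, ⟨W, hW, rfl⟩, hP⟩
  have hmem (z : ℍ) : twistedDev hu (ι z) ∈ projSubspace W := by
    refine hP ⟨f (z, Real.pi / 2), ?_, rfl⟩
    rw [← hf.image_liftedLeaf, baseCover, liftedLeaf_stable_vertical]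
    exact ⟨_, rfl, rfl⟩
  set A := holEquiv (g * b * g⁻¹) 1 with hA
  -- Since the surface `ι` is invariant, the holonomy maps its development into `W` again.
  have hmem' (z : ℍ) : twistedDev hu (ι z) ∈ projSubspace (W.comap A.toLinearMap) := by
    rw [← pglOfLinearEquiv_smul_mem_projSubspace, hA,
      ← twistedDev_eq_smul hu hum (hlift (ι z)), hι]
    exact hmem _
  have hfin := finrank_inf_comap_holEquiv_le (g := g) hb (α := 1)
    (Real.sin_pos_of_pos_of_lt_pi (by norm_num) (by linarith [Real.pi_gt_three])).ne' hW
  obtain ⟨e, he, heD⟩ := isLocalHomeomorph_twistedDev hu (ι UpperHalfPlane.I)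
  have hιc : Continuous ι := by
    have : Continuous fun z : ℍ => ((z, Real.pi / 2) : UniversalCover) := by fun_prop
    exact k.continuous.comp (f.continuous.comp this)
  refine not_injOn_mk_of_finrank_le_two hfin
    (hιc.continuousAt.preimage_mem_nhds (e.open_source.mem_nhds he))
    (G := fun z => matVec (fiberRotation hu (ι z)))
    (continuous_matVec.comp ((fiberRotation hu).continuous.comp hιc)) (fun z => matVec_ne_zero _)
    (fun z => ?_) ?_
  · have h1 := hmem z
    have h2 := hmem' z
    rw [twistedDev, Function.comp_apply, matDev, mk_mem_projSubspace] at h1 h2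
    exact ⟨h1, h2⟩
  -- The twisted developing map is injective near the chosen point, and `ι` is injective.
  · intro z hz w hw h
    have h1 : ι z = ι w := by
      refine e.injOn hz hw ?_
      rw [← heD]
      exact h
    exact congrArg Prod.fst (f.injective (k.injective h1))

lemma not_surjective_forgetFoliations (hg : 0 < g) (hΓ : IsClosedSurfaceGroup Γ g) :
    ¬ Function.Surjective (forgetFoliations Γ) := by
  intro hsurj
  obtain ⟨ϑ, γ₀, hϑ, hγ₀⟩ := exists_character hg hΓ
  obtain ⟨u, hu, huϑ⟩ := exists_equivariant_function hΓ hϑ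
  obtain ⟨S, hS⟩ := exists_twisted_structure hΓ hu huϑ
  obtain ⟨m, hm⟩ := QuotientGroup.mk_surjective γ₀.1
  have hone : ϑ 1 = 0 := by simpa using hϑ 1 1
  have hfree (z : ℍ) : m • z ≠ z := fun h => by
    have h1 : γ₀ • z = z := by
      change γ₀.1 • z = z
      rw [← hm]
      exact h
    rw [hΓ.free γ₀ z h1, hone] at hγ₀
    exact zero_ne_one hγ₀
  have hum (z : ℍ) : u ((QuotientGroup.mk m : PSL(2, ℝ)) • z) = u z + 1 := by
    rw [hm, ← hγ₀]
    exact huϑ γ₀ z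
  obtain ⟨c, hc⟩ := hsurj (Quotient.mk _ S)
  obtain ⟨⟨T, E, hE, _, hEF⟩, rfl⟩ := Quotient.exists_rep c
  -- Equality in `ProjModuli` says nothing about the action of `h` on the foliations, so the
  -- contradiction uses only that its lift commutes with deck transformations.
  obtain ⟨h, hi, hp⟩ : ∃ h : UnitTangent Γ ≃ₜ UnitTangent Γ,
    IsIsotopicToId h ∧ IsProjectiveMap T S h := Quotient.exact hc
  obtain ⟨k, hk, hkγ⟩ := exists_equivariant_lift hΓ hi
  have hD : IsDevelopingAlong (coverMap Γ) T (twistedDev hu ∘ k) :=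
    IsDevelopingAlong.comp_lift continuous_coverMap hp hS k.continuous hk
  obtain ⟨p, hp⟩ := IsDevelopingAlong.exists_eq_smul
    (isCoveringMap_coverMap hΓ).isLocalHomeomorph hE hD
  obtain ⟨x, hx⟩ := not_exists_isProjPlane_twistedDev hu hfree hum
    (hkγ _ (by rw [hm]; exact γ₀.2))
  apply hx
  obtain ⟨P, hP, hEP⟩ := hEF x
  refine ⟨(p⁻¹ • ·) ⁻¹' P, hP.preimage _, ?_⟩
  rintro _ ⟨y, hy, rfl⟩
  rw [hp, Set.mem_preimage, inv_smul_smul]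
  exact hEP ⟨y, hy, rfl⟩

end TwistedStructure

end

theorem mainTheorem10 (g : ℕ) (hg : 2 ≤ g) (Γ : Subgroup PSL(2, ℝ))
    (hΓ : IsClosedSurfaceGroup Γ g) :
    ProperlyConvexFoliatedModuli Γ ⊂ ConvexFoliatedModuli Γ ∧
      ConvexFoliatedModuli Γ ⊂ Set.univ ∧
      ¬ Function.Surjective (forgetFoliations Γ) := by
  refine ⟨Set.ssubset_iff_subset_ne.2 ⟨?_, fun h => ?_⟩, ?_,
    not_surjective_forgetFoliations (by omega) hΓ⟩
  · rintro _ ⟨S, ⟨E, hE, hEc⟩, rfl⟩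
    exact ⟨S, ⟨E, hE, fun x => (hEc x).1⟩, rfl⟩
  · obtain ⟨c, hc, hc'⟩ := exists_convex_not_properlyConvex hΓ
    exact hc' (h ▸ hc)
  · rw [Set.ssubset_univ_iff, Set.ne_univ_iff_exists_notMem]
    exact exists_not_convex hΓ
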